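/- Let $J\in\mathbb R^{2\times2}$ be skew-symmetric and invertible. Let $q$ and $w$ be $2\times 2$-matrices whose entries are real distributions of order $0$ on $\mathbb R$ (equivalently, signed measures on $\mathbb R$ that are finite on compact sets), with $q$ symmetric and $w$ non-negative, i.e. $w(E)$ is symmetric and positive semidefinite for each bounded Borel set $E$. Suppose that $q$ and $w$ are $\omega$-periodic for some $\omega>0$ and that, for all $\lambda,x\in\mathbb R$, both matrices $$J\pm\tfrac12\bigl(\Delta_q(x)-\lambda\Delta_w(x)\bigr)$$ are invertible, where $\Delta_q(x)=q(\{x\})$ and $\Delta_w(x)=w(\{x\})$ are the point masses at $x$. Let $\mathcal L^2(w)$ be the space of $\operatorname{tr}w$-measurable functions $f:\mathbb R\to\mathbb C^2$ with $\|f\|^2=\int f^*wf<\infty$, and let $L^2(w)$ be its quotient by $\{f:\|f\|=0\}$. A function $u:\mathbb R\to\mathbb C^2$ of locally bounded variation is called balanced if $u=(u^++u^-)/2$, where $u^\pm$ are its right- and left-hand limits. Let $$T_{\max}=\{([u],[f])\in L^2(w)\times L^2(w): u,f\in\mathcal L^2(w),\ u \text{ balanced of locally bounded variation},\ Ju'+qu=wf\},$$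 $$\mathcal L_0=\{u \text{ balanced of locally bounded variation}: Ju'+qu=0,\ wu=0\},$$ where the differential equations are understood in the sense of distributions on $\mathbb R$. The spectrum of a linear relation $T\subset L^2(w)\times L^2(w)$ is the complement of its resolvent set $\{\lambda\in\mathbb C:\ker(T-\lambda)=\{0\},\ \operatorname{ran}(T-\lambda)=L^2(w)\}$, where $T-\lambda=\{(u,f-\lambda u):(u,f)\in T\}$. Then $T_{\max}=\{0\}\times L^2(w)$ if and only if $\mathcal L_0\neq\{0\}$. In this situation the spectrum of $T_{\max}$ is empty. -/

import Mathlib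

namespace PeriodicSystem

open MeasureTheory Matrix
open scoped ComplexOrder

/-- A real distribution of order `0` on the line, identified with a local (finite on compact sets)
signed Borel measure and given by its Jordan decomposition `pos - neg` into two mutually singular
positive measures. Mutual singularity makes the pair unique, so that equality of two such objects
is equality of distributions. -/
structure OrderZeroDist where
  pos : Measure ℝ
  neg : Measure ℝ
  pos_locallyFinite : IsLocallyFiniteMeasure pos
  neg_locallyFinite : IsLocallyFiniteMeasure neg
  mutuallySingular : pos ⟂ₘ neg

open scoped ContDiff in
/-- Test functions: compactly supported smooth functions from `ℝ` to `ℂ`. -/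
def IsTest (φ : ℝ → ℂ) : Prop := ContDiff ℝ ∞ φ ∧ HasCompactSupport φ

namespace OrderZeroDist

/-- The integral `∫ g dR` of a function with respect to the local measure `r = dR`. For a test
function `φ` this is the value `r(φ)`; for a function `u` locally integrable with respect to `|r|`,
`r.integral (u φ)` is the value at `φ` of the product `r u`. -/
noncomputable def integral (r : OrderZeroDist) (g : ℝ → ℂ) : ℂ :=
  (∫ x, g x ∂r.pos) - ∫ x, g x ∂r.neg

/-- The value of the local measure on a (bounded Borel) set. -/
noncomputable def val (r : OrderZeroDist) (E : Set ℝ) : ℝ := r.pos.real E - r.neg.real E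

/-- `ω` is a period of `r`: `r(φ) = r(φ(· + ω))` for every test function `φ`. -/
def HasPeriod (r : OrderZeroDist) (ω : ℝ) : Prop :=
  ∀ φ : ℝ → ℂ, IsTest φ → r.integral φ = r.integral (fun x => φ (x + ω))

end OrderZeroDist

variable {n : ℕ}

/-- The matrix `r(E)` of the values of the entries on a (bounded Borel) set. -/
noncomputable def matVal (r : Matrix (Fin n) (Fin n) OrderZeroDist) (E : Set ℝ) :
    Matrix (Fin n) (Fin n) ℝ :=
  Matrix.of fun i j => (r i j).val E

/-- The jump `Δ_r(x) = R⁺(x) - R⁻(x)` of an antiderivative `R` of `r`, that is, the mass of the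
one-point set `{x}`. -/
noncomputable def jump (r : Matrix (Fin n) (Fin n) OrderZeroDist) (x : ℝ) :
    Matrix (Fin n) (Fin n) ℝ :=
  matVal r {x}

/-- A real matrix of distributions of order `0` is non-negative if `w(E)` is symmetric and positive
semidefinite for every bounded Borel set `E`. -/
def IsNonneg (w : Matrix (Fin n) (Fin n) OrderZeroDist) : Prop :=
  ∀ E : Set ℝ, MeasurableSet E → Bornology.IsBounded E → (matVal w E).PosSemidef

/-- The positive measure `tr w` of a non-negative matrix `w` (the diagonal entries of which have
vanishing negative parts). -/
noncomputable def traceMeasure (w : Matrix (Fin n) (Fin n) OrderZeroDist) : Measure ℝ :=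
  ∑ i, (w i i).pos

/-- The entrywise Radon-Nikodym derivative of `w` with respect to `tr w`. -/
noncomputable def rawDensity (w : Matrix (Fin n) (Fin n) OrderZeroDist) (x : ℝ) :
    Matrix (Fin n) (Fin n) ℂ :=
  Matrix.of fun i j =>
    ((((w i j).pos.rnDeriv (traceMeasure w) x).toReal
      - ((w i j).neg.rnDeriv (traceMeasure w) x).toReal : ℝ) : ℂ)

open Classical in
/-- The density of a non-negative `w` with respect to `tr w`. The Radon-Nikodym derivative is
positive semidefinite almost everywhere; we choose the version which is so everywhere. Thus
`w = density w · tr w`. -/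
noncomputable def density (w : Matrix (Fin n) (Fin n) OrderZeroDist) (x : ℝ) :
    Matrix (Fin n) (Fin n) ℂ :=
  if (rawDensity w x).PosSemidef then rawDensity w x else 0

theorem density_posSemidef (w : Matrix (Fin n) (Fin n) OrderZeroDist) (x : ℝ) :
    (density w x).PosSemidef := by
  unfold density
  split_ifs with h
  · exact h
  · exact Matrix.PosSemidef.zero

/-- The density of `f^* w f` with respect to `tr w`. -/
noncomputable def quadDensity (w : Matrix (Fin n) (Fin n) OrderZeroDist) (f : ℝ → Fin n → ℂ)
    (x : ℝ) : ℝ :=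
  (star (f x) ⬝ᵥ (density w x *ᵥ f x)).re

/-- The squared norm `‖f‖² = ∫ f^* w f` in `[0, ∞]`. -/
noncomputable def sqNorm (w : Matrix (Fin n) (Fin n) OrderZeroDist) (f : ℝ → Fin n → ℂ) :
    ENNReal :=
  ∫⁻ x, ENNReal.ofReal (quadDensity w f x) ∂(traceMeasure w)

theorem quadDensity_nonneg (w : Matrix (Fin n) (Fin n) OrderZeroDist) (f : ℝ → Fin n → ℂ)
    (x : ℝ) : 0 ≤ quadDensity w f x :=
  (Complex.le_def.1 ((density_posSemidef w x).dotProduct_mulVec_nonneg (f x))).1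

theorem quadDensity_add_le (w : Matrix (Fin n) (Fin n) OrderZeroDist) (f g : ℝ → Fin n → ℂ)
    (x : ℝ) : quadDensity w (f + g) x ≤ 2 * quadDensity w f x + 2 * quadDensity w g x := by
  have h := quadDensity_nonneg w (f - g) x
  have e : quadDensity w (f + g) x + quadDensity w (f - g) x
      = 2 * quadDensity w f x + 2 * quadDensity w g x := by
    simp only [quadDensity, Pi.add_apply, Pi.sub_apply, star_add, star_sub, mulVec_add,
      mulVec_sub, add_dotProduct, sub_dotProduct, dotProduct_add, dotProduct_sub, Complex.add_re,
      Complex.sub_re]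
    ring
  linarith

theorem quadDensity_smul (w : Matrix (Fin n) (Fin n) OrderZeroDist) (c : ℂ) (f : ℝ → Fin n → ℂ)
    (x : ℝ) : quadDensity w (c • f) x = ‖c‖ ^ 2 * quadDensity w f x := by
  have e : c * star c = ((‖c‖ ^ 2 : ℝ) : ℂ) := by
    rw [Complex.ofReal_pow]
    exact Complex.mul_conj' c
  simp only [quadDensity, Pi.smul_apply, star_smul, mulVec_smul, smul_dotProduct, dotProduct_smul,
    smul_eq_mul]
  rw [← mul_assoc, e, Complex.re_ofReal_mul]

theorem measurable_density (w : Matrix (Fin n) (Fin n) OrderZeroDist) (i j : Fin n) :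
    Measurable fun x => density w x i j := by
  classical
  have hm : Measurable fun x => (fun i j => rawDensity w x i j : Fin n → Fin n → ℂ) := by
    refine measurable_pi_lambda _ fun i => measurable_pi_lambda _ fun j => ?_
    exact Complex.measurable_ofReal.comp
      ((Measure.measurable_rnDeriv _ _).ennreal_toReal.sub
        (Measure.measurable_rnDeriv _ _).ennreal_toReal)
  have hc : IsClosed {M : Fin n → Fin n → ℂ | (Matrix.of M).PosSemidef} := by
    have e : {M : Fin n → Fin n → ℂ | (Matrix.of M).PosSemidef}
        = {M | (Matrix.of M)ᴴ = Matrix.of M}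
          ∩ ⋂ v : Fin n → ℂ, {M | 0 ≤ star v ⬝ᵥ (Matrix.of M *ᵥ v)} := by
      ext M
      simp [Matrix.posSemidef_iff_dotProduct_mulVec, Matrix.IsHermitian]
    rw [e]
    have hid : Continuous fun M : Fin n → Fin n → ℂ => (Matrix.of M : Matrix (Fin n) (Fin n) ℂ) :=
      continuous_id
    refine (isClosed_eq hid.matrix_conjTranspose hid).inter (isClosed_iInter fun v => ?_)
    exact isClosed_le continuous_const
      (continuous_const.dotProduct (hid.matrix_mulVec continuous_const))
  have hs : MeasurableSet {x | (rawDensity w x).PosSemidef} := hm hc.measurableSet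
  have e : (fun x => density w x i j)
      = fun x => if (rawDensity w x).PosSemidef then rawDensity w x i j else 0 := by
    funext x
    unfold density
    split_ifs <;> rfl
  rw [e]
  exact Measurable.ite hs ((measurable_pi_apply j).comp ((measurable_pi_apply i).comp hm))
    measurable_const

theorem aemeasurable_quadDensity (w : Matrix (Fin n) (Fin n) OrderZeroDist)
    {f : ℝ → Fin n → ℂ} (hf : AEMeasurable f (traceMeasure w)) :
    AEMeasurable (quadDensity w f) (traceMeasure w) := by
  have hi : ∀ i, AEMeasurable (fun x => f x i) (traceMeasure w) := fun i =>
    (measurable_pi_apply i).comp_aemeasurable hf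
  refine Complex.measurable_re.comp_aemeasurable ?_
  simp only [dotProduct, mulVec, Pi.star_apply]
  refine Finset.aemeasurable_fun_sum _ fun i _ => AEMeasurable.mul ?_ ?_
  · exact Complex.continuous_conj.measurable.comp_aemeasurable (hi i)
  · exact Finset.aemeasurable_fun_sum _ fun j _ =>
      (measurable_density w i j).aemeasurable.mul (hi j)

theorem sqNorm_add_le (w : Matrix (Fin n) (Fin n) OrderZeroDist) {f g : ℝ → Fin n → ℂ}
    (hf : AEMeasurable f (traceMeasure w)) :
    sqNorm w (f + g) ≤ 2 * sqNorm w f + 2 * sqNorm w g := by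
  have hq := (aemeasurable_quadDensity w hf).ennreal_ofReal
  unfold sqNorm
  rw [← lintegral_const_mul' 2 _ (by simp), ← lintegral_const_mul' 2 _ (by simp),
    ← lintegral_add_left' (hq.const_mul 2)]
  refine lintegral_mono fun x => (ENNReal.ofReal_le_ofReal (quadDensity_add_le w f g x)).trans ?_
  rw [ENNReal.ofReal_add (by have := quadDensity_nonneg w f x; positivity)
    (by have := quadDensity_nonneg w g x; positivity), ENNReal.ofReal_mul zero_le_two,
    ENNReal.ofReal_mul zero_le_two]
  simp

theorem sqNorm_smul (w : Matrix (Fin n) (Fin n) OrderZeroDist) (c : ℂ) (f : ℝ → Fin n → ℂ) :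
    sqNorm w (c • f) = ENNReal.ofReal (‖c‖ ^ 2) * sqNorm w f := by
  unfold sqNorm
  rw [← lintegral_const_mul' _ _ (by simp)]
  simp only [quadDensity_smul]
  refine lintegral_congr fun x => ENNReal.ofReal_mul (by positivity)

theorem sqNorm_zero (w : Matrix (Fin n) (Fin n) OrderZeroDist) : sqNorm w 0 = 0 := by
  simp [sqNorm, quadDensity]

/-- The space `𝓛²(w)` of `tr w`-measurable functions `f` with `∫ f^* w f < ∞`. -/
noncomputable def scriptL2 (w : Matrix (Fin n) (Fin n) OrderZeroDist) :
    Submodule ℂ (ℝ → Fin n → ℂ) where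
  carrier := {f | AEMeasurable f (traceMeasure w) ∧ sqNorm w f < ⊤}
  add_mem' {f g} hf hg := by
    refine ⟨hf.1.add hg.1, (sqNorm_add_le w hf.1).trans_lt ?_⟩
    exact ENNReal.add_lt_top.2 ⟨ENNReal.mul_lt_top (by simp) hf.2, ENNReal.mul_lt_top (by simp) hg.2⟩
  zero_mem' := ⟨aemeasurable_const, by simp [sqNorm_zero]⟩
  smul_mem' c f hf := by
    refine ⟨hf.1.const_smul c, ?_⟩
    rw [sqNorm_smul]
    exact ENNReal.mul_lt_top (by simp) hf.2

/-- The kernel of the seminorm of `𝓛²(w)`. -/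
noncomputable def normKer (w : Matrix (Fin n) (Fin n) OrderZeroDist) :
    Submodule ℂ (scriptL2 w) where
  carrier := {f | sqNorm w f = 0}
  add_mem' {f g} hf hg := by
    have h := sqNorm_add_le w (g := (g : ℝ → Fin n → ℂ)) f.2.1
    simp only [Set.mem_ofPred_eq] at hf hg ⊢
    rw [hf, hg] at h
    simpa using h
  zero_mem' := sqNorm_zero w
  smul_mem' c f hf := by
    simp only [Set.mem_ofPred_eq] at hf ⊢
    rw [Submodule.coe_smul, sqNorm_smul, hf, mul_zero]

/-- `L²(w)`, the quotient of `𝓛²(w)` by the kernel of `‖·‖`. -/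
abbrev L2 (w : Matrix (Fin n) (Fin n) OrderZeroDist) : Type := scriptL2 w ⧸ normKer w

/-- The class `[f]` in `L²(w)` of `f ∈ 𝓛²(w)`. -/
noncomputable def toL2 (w : Matrix (Fin n) (Fin n) OrderZeroDist) (f : scriptL2 w) : L2 w :=
  (normKer w).mkQ f

/-- Balanced functions of locally bounded variation on the line: `u = (u⁺ + u⁻) / 2`. -/
def IsBalancedBV (u : ℝ → Fin n → ℂ) : Prop :=
  LocallyBoundedVariationOn u Set.univ ∧
    ∀ x, u x = (1 / 2 : ℂ) • (Function.rightLim u x + Function.leftLim u x)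

/-- The `i`-th component of the distribution `J u'` at the test function `φ`, where
`u'(φ) = -∫ u φ'`. -/
noncomputable def derivTerm (J : Matrix (Fin n) (Fin n) ℝ) (u : ℝ → Fin n → ℂ) (i : Fin n)
    (φ : ℝ → ℂ) : ℂ :=
  ∑ j, (J i j : ℂ) * -∫ x, u x j * deriv φ x

/-- The `i`-th component of the distribution `q u` at the test function `φ`, for a locally bounded
Borel function `u`. -/
noncomputable def potentialTerm (q : Matrix (Fin n) (Fin n) OrderZeroDist) (u : ℝ → Fin n → ℂ)
    (i : Fin n) (φ : ℝ → ℂ) : ℂ :=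
  ∑ j, (q i j).integral fun x => u x j * φ x

/-- The `i`-th component of the distribution `w f` at the test function `φ`. For `f ∈ 𝓛²(w)` the
single products `w_ij f_j` need not make sense, but the function `(density w) f` is always locally
integrable with respect to `tr w`. -/
noncomputable def weightTerm (w : Matrix (Fin n) (Fin n) OrderZeroDist) (f : ℝ → Fin n → ℂ)
    (i : Fin n) (φ : ℝ → ℂ) : ℂ :=
  ∫ x, (density w x *ᵥ f x) i * φ x ∂(traceMeasure w)

/-- The equation `J u' + q u = w f` in the sense of distributions. -/
def Solves (J : Matrix (Fin n) (Fin n) ℝ) (q w : Matrix (Fin n) (Fin n) OrderZeroDist)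
    (u f : ℝ → Fin n → ℂ) : Prop :=
  ∀ φ : ℝ → ℂ, IsTest φ → ∀ i, derivTerm J u i φ + potentialTerm q u i φ = weightTerm w f i φ

/-- The space `𝓛₀` of balanced functions `u` of locally bounded variation with `J u' + q u = 0` and
`w u = 0`. -/
def scriptL0 (J : Matrix (Fin n) (Fin n) ℝ) (q w : Matrix (Fin n) (Fin n) OrderZeroDist) :
    Set (ℝ → Fin n → ℂ) :=
  {u | IsBalancedBV u ∧ Solves J q w u 0 ∧
    ∀ φ : ℝ → ℂ, IsTest φ → ∀ i, weightTerm w u i φ = 0}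

/-- The maximal relation `T_max` in `L²(w) × L²(w)`: all pairs `([u], [f])` with `u, f ∈ 𝓛²(w)`,
`u` balanced and of locally bounded variation, and `J u' + q u = w f`. -/
def Tmax (J : Matrix (Fin n) (Fin n) ℝ) (q w : Matrix (Fin n) (Fin n) OrderZeroDist) :
    Set (L2 w × L2 w) :=
  {p | ∃ u f : scriptL2 w, IsBalancedBV (u : ℝ → Fin n → ℂ) ∧
    Solves J q w (u : ℝ → Fin n → ℂ) (f : ℝ → Fin n → ℂ) ∧ p = (toL2 w u, toL2 w f)}

section Relation

variable {H : Type*} [AddCommGroup H] [Module ℂ H]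

/-- The relation `T - z`. -/
def relSub (T : Set (H × H)) (z : ℂ) : Set (H × H) := {p | ∃ g, (p.1, g) ∈ T ∧ p.2 = g - z • p.1}

/-- The resolvent set: `ker (T - z) = {0}` and `ran (T - z)` is everything. -/
def relResolventSet (T : Set (H × H)) : Set ℂ :=
  {z | {u | (u, (0 : H)) ∈ relSub T z} = {0} ∧ {f | ∃ u, (u, f) ∈ relSub T z} = Set.univ}

/-- The spectrum of a linear relation, the complement of the resolvent set. -/
def relSpectrum (T : Set (H × H)) : Set ℂ := (relResolventSet T)ᶜ

end Relation

end PeriodicSystem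

open PeriodicSystem

namespace PeriodicSystem

open MeasureTheory Matrix Set Filter Topology
open scoped ComplexOrder ENNReal

set_option linter.unusedSectionVars false

/-! Let `ν` be a positive local measure dominating the entries of `q` and the trace of `w`, and let
`Q`, `W` be the densities. Then `J u' + q u = w f` says that `u` is the balanced antiderivative
(`IsPrim`) of `h dν` with `h = G u + J⁻¹ W f` and `G = -J⁻¹ Q`; the one-sided limits of `u` at `x`
are `u ± d h` with `d = ν{x}/2`. Symmetry of `q` makes `G` trace-free, so `det (1 ± d G) = 1 + d²
det G`, and this number is nonzero at each atom by the hypothesis at `λ = 0`. Hence one-sided limits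
determine balanced values, initial value problems are uniquely solvable, and the homogeneous
solutions form a two-dimensional space.

The hypothesis for all real `λ` enters once more, at an atom where `W` is singular but not zero.
There the determinant of `J + (Δ_q - λ Δ_w)/2` is affine in `λ`; having no real zero, it is
constant. The vanishing of its slope (`mixed_det_eq_zero`) means that `W u = 0` implies `W G u = 0`
(`mulVec_sysCoeff_mulVec_eq_zero`). So at atoms the weight kills the one-sided limits of a
homogeneous solution as soon as it kills the balanced value.

Let `v ≠ 0` be a homogeneous solution with `W v = 0`. For every solution `u` of an inhomogeneous
equation, the Wronskian of `v` and `u` times the jump determinant is a constant `c`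
(`IsSystem.exists_wronskian_mul_eq`). Two consequences show that `T_max` is `{0} × L²(w)`. First,
variation of parameters gives, for every `f`, a solution built from `v` and `G v` that is killed by
`W` (`IsSystem.exists_isPrim_mulVec_eq_zero`). Secondly, every solution `u` of finite norm has norm
zero (`IsSystem.ae_mulVec_eq_zero`). Indeed, if `c = 0`, then `u` is pointwise a multiple of `v`. If
`c ≠ 0`, compare `v` with its translate by the period, which is again a solution killed by `W`. If
the two are independent, then `W = 0`. Otherwise the translate is `ρ v`, and `u* W u` equals `|c|²
tr W / (|v|² |k|²)` with `k` the jump determinant, a function which a translation multiplies by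
`|ρ|⁻²`. A function with this property and finite integral has integral zero, so `tr W = 0`.

Conversely, let `T_max = {0} × L²(w)`, suppose that no nonzero homogeneous solution is killed by
`W`, and take any homogeneous solution `v`. The pair `(0, [f])`, with `f` the conjugate of `v` cut
off to `(-n, n]`, lies in `T_max`, so some `u` with `W u = 0` solves the equation with right-hand
side `w f`. Outside the interval `u` agrees with homogeneous solutions killed by `W` on a half-line.
Translation by a period acts injectively, hence bijectively, on the finite-dimensional space of such
solutions, so they are killed on the whole line (`IsSystem.ae_mulVec_eq_zero_of_mem_annihilated`)
and vanish. Thus `u` vanishes at both ends, and Lagrange's identity gives `∫ v W v̄ = 0` over `(-n,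
n]`. Letting `n` grow gives `W v = 0`, so `v = 0`, which is absurd for a solution with nonzero
initial value. -/

/-- Fubini for the product of two integrals over a half-open interval, split along the diagonal. -/
theorem setIntegral_Ioc_mul_setIntegral_Ioc {μ ν : Measure ℝ} [SFinite μ] [SFinite ν] {a b : ℝ}
    {h k : ℝ → ℂ} (hh : IntegrableOn h (Ioc a b) ν) (hk : IntegrableOn k (Ioc a b) μ) :
    (∫ s in Ioc a b, h s ∂ν) * (∫ t in Ioc a b, k t ∂μ)
      = (∫ s in Ioc a b, h s * (∫ t in Ioo a s, k t ∂μ) ∂ν)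
        + ∫ t in Ioc a b, k t * (∫ s in Ioc a t, h s ∂ν) ∂μ := by
  have hf : Integrable (fun p : ℝ × ℝ => h p.1 * k p.2)
      ((ν.restrict (Ioc a b)).prod (μ.restrict (Ioc a b))) := hh.mul_prod hk
  have hS : MeasurableSet {p : ℝ × ℝ | p.2 < p.1} := measurableSet_lt measurable_snd measurable_fst
  rw [← integral_prod_mul, ← integral_add_compl hS hf, ← integral_indicator hS,
    ← integral_indicator hS.compl, integral_prod _ (hf.indicator hS),
    integral_prod_symm _ (hf.indicator hS.compl)]
  congr 1
  · refine setIntegral_congr_fun measurableSet_Ioc fun s hs => ?_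
    have : ∀ t, {p : ℝ × ℝ | p.2 < p.1}.indicator (fun p : ℝ × ℝ => h p.1 * k p.2) (s, t)
        = h s * (Iio s).indicator k t := by
      intro t
      by_cases hts : t < s <;> simp [indicator, hts]
    simp only [this]
    rw [integral_const_mul, integral_indicator measurableSet_Iio,
      Measure.restrict_restrict measurableSet_Iio]
    have e : Iio s ∩ Ioc a b = Ioo a s := by
      ext t
      simp only [mem_inter_iff, mem_Iio, mem_Ioc, mem_Ioo] at hs ⊢
      grind
    rw [e]
  · refine setIntegral_congr_fun measurableSet_Ioc fun t ht => ?_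
    have : ∀ s, {p : ℝ × ℝ | p.2 < p.1}ᶜ.indicator (fun p : ℝ × ℝ => h p.1 * k p.2) (s, t)
        = k t * (Iic t).indicator h s := by
      intro s
      by_cases hts : t < s <;> simp [indicator, hts, mul_comm, not_le.2, not_lt.1]
    simp only [this]
    rw [integral_const_mul, integral_indicator measurableSet_Iic,
      Measure.restrict_restrict measurableSet_Iic]
    have e : Iic t ∩ Ioc a b = Ioc a t := by
      ext s
      simp only [mem_inter_iff, mem_Iic, mem_Ioc] at ht ⊢
      grind
    rw [e]

/-! ### Balanced antiderivatives of local measures -/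

section Prim

variable {E : Type*} [NormedAddCommGroup E] [NormedSpace ℝ E]

theorem _root_.MeasureTheory.LocallyIntegrable.integrableOn_of_bounded {ν : Measure ℝ} {h : ℝ → E}
    (hh : LocallyIntegrable h ν) {s : Set ℝ} (hs : Bornology.IsBounded s) : IntegrableOn h s ν :=
  (hh.integrableOn_isCompact hs.isCompact_closure).mono_set subset_closure

theorem _root_.MeasureTheory.LocallyIntegrable.intervalIntegrable {ν : Measure ℝ} {h : ℝ → E}
    (hh : LocallyIntegrable h ν) (a b : ℝ) : IntervalIntegrable h ν a b :=
  ⟨hh.integrableOn_of_bounded (Metric.isBounded_Ioc a b),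
    hh.integrableOn_of_bounded (Metric.isBounded_Ioc b a)⟩

theorem _root_.MeasureTheory.LocallyIntegrable.norm_fun {ν : Measure ℝ} {h : ℝ → E}
    (hh : LocallyIntegrable h ν) : LocallyIntegrable (fun x => ‖h x‖) ν := fun x => by
  obtain ⟨s, hs, hi⟩ := hh x
  exact ⟨s, hs, hi.norm⟩

/-- The balanced antiderivative, vanishing to the right of `0`, of the local measure `h dν`. -/
noncomputable def balPrim (ν : Measure ℝ) (h : ℝ → E) (x : ℝ) : E :=
  (∫ t in (0 : ℝ)..x, h t ∂ν) - (ν.real {x} / 2) • h x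

variable {ν : Measure ℝ} [IsLocallyFiniteMeasure ν] {h : ℝ → E}

theorem balPrim_sub_eq (hh : LocallyIntegrable h ν) {x y : ℝ} (hxy : x ≤ y) :
    balPrim ν h y - balPrim ν h x
      = (∫ t in Ioc x y, h t ∂ν) - (ν.real {y} / 2) • h y + (ν.real {x} / 2) • h x := by
  rw [← intervalIntegral.integral_of_le hxy,
    ← intervalIntegral.integral_interval_sub_left (hh.intervalIntegrable 0 y)
      (hh.intervalIntegrable 0 x)]
  unfold balPrim
  abel

theorem setIntegral_Ioc_eq_Ioo_add [CompleteSpace E] (hh : LocallyIntegrable h ν) {x y : ℝ}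
    (hxy : x < y) : ∫ t in Ioc x y, h t ∂ν = (∫ t in Ioo x y, h t ∂ν) + ν.real {y} • h y := by
  rw [← Ioo_union_right hxy, setIntegral_union (by simp) (measurableSet_singleton y)
    (hh.integrableOn_of_bounded (Metric.isBounded_Ioo x y))
    (hh.integrableOn_of_bounded Bornology.isBounded_singleton), integral_singleton]

theorem setIntegral_Ico_eq_Ioo_add [CompleteSpace E] (hh : LocallyIntegrable h ν) {x y : ℝ}
    (hxy : x < y) : ∫ t in Ico x y, h t ∂ν = (∫ t in Ioo x y, h t ∂ν) + ν.real {x} • h x := by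
  rw [← Ioo_union_left hxy, setIntegral_union (by simp) (measurableSet_singleton x)
    (hh.integrableOn_of_bounded (Metric.isBounded_Ioo x y))
    (hh.integrableOn_of_bounded Bornology.isBounded_singleton), integral_singleton]

/-- The atom at `x` is already contained in the right-hand limit and only half of the atom at `y`
has been collected, so the increment is controlled by the mass of `(x, y]`, which shrinks to zero as
`y` decreases to `x`. -/
theorem norm_balPrim_sub_right_le [CompleteSpace E] (hh : LocallyIntegrable h ν) {x y : ℝ}
    (hxy : x < y) :
    ‖balPrim ν h y - (balPrim ν h x + (ν.real {x} / 2) • h x)‖ ≤ ∫ t in Ioc x y, ‖h t‖ ∂ν := by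
  have e : balPrim ν h y - (balPrim ν h x + (ν.real {x} / 2) • h x)
      = (∫ t in Ioo x y, h t ∂ν) + (ν.real {y} / 2) • h y := by
    rw [← sub_sub, balPrim_sub_eq hh hxy.le, setIntegral_Ioc_eq_Ioo_add hh hxy]
    module
  rw [e, setIntegral_Ioc_eq_Ioo_add hh.norm_fun hxy]
  refine (norm_add_le _ _).trans (add_le_add (norm_integral_le_integral_norm _) ?_)
  rw [norm_smul, smul_eq_mul, Real.norm_of_nonneg (by positivity)]
  gcongr
  linarith [measureReal_nonneg (μ := ν) (s := {y})]

theorem norm_balPrim_sub_left_le [CompleteSpace E] (hh : LocallyIntegrable h ν) {x y : ℝ}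
    (hxy : x < y) :
    ‖balPrim ν h x - (balPrim ν h y - (ν.real {y} / 2) • h y)‖ ≤ ∫ t in Ico x y, ‖h t‖ ∂ν := by
  have e : balPrim ν h x - (balPrim ν h y - (ν.real {y} / 2) • h y)
      = -((∫ t in Ioo x y, h t ∂ν) + (ν.real {x} / 2) • h x) := by
    have := balPrim_sub_eq hh hxy.le
    rw [setIntegral_Ioc_eq_Ioo_add hh hxy] at this
    rw [show balPrim ν h x = balPrim ν h y - (balPrim ν h y - balPrim ν h x) by abel, this]
    module
  rw [e, norm_neg, setIntegral_Ico_eq_Ioo_add hh.norm_fun hxy]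
  refine (norm_add_le _ _).trans (add_le_add (norm_integral_le_integral_norm _) ?_)
  rw [norm_smul, smul_eq_mul, Real.norm_of_nonneg (by positivity)]
  gcongr
  linarith [measureReal_nonneg (μ := ν) (s := {x})]

theorem norm_balPrim_sub_le [CompleteSpace E] (hh : LocallyIntegrable h ν) {x y : ℝ}
    (hxy : x ≤ y) :
    ‖balPrim ν h y - balPrim ν h x‖
      ≤ balPrim ν (fun t => ‖h t‖) y - balPrim ν (fun t => ‖h t‖) x := by
  rcases hxy.eq_or_lt with rfl | hxy
  · simp
  rw [balPrim_sub_eq hh hxy.le, balPrim_sub_eq hh.norm_fun hxy.le, setIntegral_Ioc_eq_Ioo_add hh hxy,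
    setIntegral_Ioc_eq_Ioo_add hh.norm_fun hxy]
  have e1 : (∫ t in Ioo x y, h t ∂ν) + ν.real {y} • h y - (ν.real {y} / 2) • h y
      + (ν.real {x} / 2) • h x
      = (∫ t in Ioo x y, h t ∂ν) + (ν.real {y} / 2) • h y + (ν.real {x} / 2) • h x := by module
  have e2 : (∫ t in Ioo x y, ‖h t‖ ∂ν) + ν.real {y} • ‖h y‖ - (ν.real {y} / 2) • ‖h y‖
      + (ν.real {x} / 2) • ‖h x‖
      = (∫ t in Ioo x y, ‖h t‖ ∂ν) + (ν.real {y} / 2) • ‖h y‖ + (ν.real {x} / 2) • ‖h x‖ := by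
    module
  rw [e1, e2]
  refine (norm_add₃_le).trans (add_le_add (add_le_add (norm_integral_le_integral_norm _) ?_) ?_)
  all_goals rw [norm_smul, smul_eq_mul, Real.norm_of_nonneg (by positivity)]

theorem tendsto_setIntegral_Ioc_zero {g : ℝ → ℝ} (hg : LocallyIntegrable g ν) (x : ℝ) :
    Tendsto (fun y => ∫ t in Ioc x y, g t ∂ν) (𝓝[>] x) (𝓝 0) := by
  simp_rw [← integral_indicator measurableSet_Ioc]
  rw [← integral_zero ℝ ℝ (μ := ν)]
  refine tendsto_integral_filter_of_dominated_convergence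
    ((Ioc x (x + 1)).indicator fun t => ‖g t‖) ?_ ?_ ?_ ?_
  · exact Eventually.of_forall fun y => hg.aestronglyMeasurable.indicator measurableSet_Ioc
  · filter_upwards [Ioo_mem_nhdsGT (show x < x + 1 by linarith)] with y hy
    refine Eventually.of_forall fun t => ?_
    rw [norm_indicator_eq_indicator_norm]
    exact indicator_le_indicator_of_subset (Ioc_subset_Ioc_right hy.2.le) (fun _ => norm_nonneg _) t
  · rw [integrable_indicator_iff measurableSet_Ioc]
    exact hg.norm_fun.integrableOn_of_bounded (Metric.isBounded_Ioc _ _)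
  · refine Eventually.of_forall fun t => tendsto_const_nhds.congr' ?_
    rcases le_or_gt t x with ht | ht
    · exact Eventually.of_forall fun y => by simp [indicator, not_lt.2 ht]
    · filter_upwards [Ioo_mem_nhdsGT ht] with y hy
      simp [indicator, hy.2]

theorem tendsto_setIntegral_Ico_zero {g : ℝ → ℝ} (hg : LocallyIntegrable g ν) (x : ℝ) :
    Tendsto (fun y => ∫ t in Ico y x, g t ∂ν) (𝓝[<] x) (𝓝 0) := by
  simp_rw [← integral_indicator measurableSet_Ico]
  rw [← integral_zero ℝ ℝ (μ := ν)]
  refine tendsto_integral_filter_of_dominated_convergence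
    ((Ico (x - 1) x).indicator fun t => ‖g t‖) ?_ ?_ ?_ ?_
  · exact Eventually.of_forall fun y => hg.aestronglyMeasurable.indicator measurableSet_Ico
  · filter_upwards [Ioo_mem_nhdsLT (show x - 1 < x by linarith)] with y hy
    refine Eventually.of_forall fun t => ?_
    rw [norm_indicator_eq_indicator_norm]
    exact indicator_le_indicator_of_subset (Ico_subset_Ico_left hy.1.le) (fun _ => norm_nonneg _) t
  · rw [integrable_indicator_iff measurableSet_Ico]
    exact hg.norm_fun.integrableOn_of_bounded (Metric.isBounded_Ico _ _)
  · refine Eventually.of_forall fun t => tendsto_const_nhds.congr' ?_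
    rcases le_or_gt x t with ht | ht
    · exact Eventually.of_forall fun y => by simp [indicator, not_lt.2 ht]
    · filter_upwards [Ioo_mem_nhdsLT ht] with y hy
      simp [indicator, hy.1]

variable [CompleteSpace E]

theorem tendsto_balPrim_right (hh : LocallyIntegrable h ν) (x : ℝ) :
    Tendsto (balPrim ν h) (𝓝[>] x) (𝓝 (balPrim ν h x + (ν.real {x} / 2) • h x)) := by
  rw [tendsto_iff_norm_sub_tendsto_zero]
  refine squeeze_zero' (Eventually.of_forall fun _ => norm_nonneg _) ?_
    (tendsto_setIntegral_Ioc_zero hh.norm_fun x)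
  filter_upwards [self_mem_nhdsWithin] with y hy using norm_balPrim_sub_right_le hh hy

theorem tendsto_balPrim_left (hh : LocallyIntegrable h ν) (x : ℝ) :
    Tendsto (balPrim ν h) (𝓝[<] x) (𝓝 (balPrim ν h x - (ν.real {x} / 2) • h x)) := by
  rw [tendsto_iff_norm_sub_tendsto_zero]
  refine squeeze_zero' (Eventually.of_forall fun _ => norm_nonneg _) ?_
    (tendsto_setIntegral_Ico_zero hh.norm_fun x)
  filter_upwards [self_mem_nhdsWithin] with y hy using norm_balPrim_sub_left_le hh hy

/-- The estimate forces `g` to be monotone, and the variation of `u` is then at most that of `g`. -/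
theorem locallyBoundedVariationOn_of_norm_sub_le {u : ℝ → E} {g : ℝ → ℝ}
    (hug : ∀ x y, x ≤ y → ‖u y - u x‖ ≤ g y - g x) : LocallyBoundedVariationOn u univ := by
  have hg : Monotone g := fun x y hxy => by
    linarith [(norm_nonneg _).trans (hug x y hxy)]
  have hbv : LocallyBoundedVariationOn g univ := (hg.monotoneOn univ).locallyBoundedVariationOn
  intro a b ha hb
  refine ne_top_of_le_ne_top (hbv a b ha hb) (iSup_le fun p => ?_)
  refine le_trans (Finset.sum_le_sum fun i _ => ?_) (eVariationOn.sum_le p.2.2.1 p.2.2.2)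
  have hm := p.2.2.1 (Nat.le_succ i)
  rw [edist_dist, edist_dist, dist_eq_norm, Real.dist_eq,
    abs_of_nonneg (sub_nonneg.2 (hg hm))]
  exact ENNReal.ofReal_le_ofReal (hug _ _ hm)

theorem locallyBoundedVariationOn_balPrim (hh : LocallyIntegrable h ν) (c : E) :
    LocallyBoundedVariationOn (fun x => c + balPrim ν h x) univ :=
  locallyBoundedVariationOn_of_norm_sub_le (g := balPrim ν fun t => ‖h t‖) fun x y hxy => by
    simpa using norm_balPrim_sub_le hh hxy

end Prim

/-! ### One-sided limits, measurability and local boundedness of functions of bounded variation -/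

section BV

variable {E : Type*} [NormedAddCommGroup E] [CompleteSpace E]

theorem tendsto_rightLim_of_locallyBoundedVariationOn {u : ℝ → E}
    (hu : LocallyBoundedVariationOn u univ) (x : ℝ) :
    Tendsto u (𝓝[>] x) (𝓝 (Function.rightLim u x)) := by
  apply tendsto_rightLim_of_tendsto
  obtain ⟨l, hl⟩ := (hu x (x + 1) (mem_univ _) (mem_univ _)).exists_tendsto_right x
  refine ⟨l, hl.mono_left ?_⟩
  rw [nhdsWithin_le_iff]
  filter_upwards [Ioo_mem_nhdsGT (show x < x + 1 by linarith)] with y hy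
  exact ⟨⟨mem_univ _, hy.1.le, hy.2.le⟩, hy.1⟩

theorem tendsto_leftLim_of_locallyBoundedVariationOn {u : ℝ → E}
    (hu : LocallyBoundedVariationOn u univ) (x : ℝ) :
    Tendsto u (𝓝[<] x) (𝓝 (Function.leftLim u x)) := by
  apply tendsto_leftLim_of_tendsto
  obtain ⟨l, hl⟩ := (hu (x - 1) x (mem_univ _) (mem_univ _)).exists_tendsto_left x
  refine ⟨l, hl.mono_left ?_⟩
  rw [nhdsWithin_le_iff]
  filter_upwards [Ioo_mem_nhdsLT (show x - 1 < x by linarith)] with y hy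
  exact ⟨⟨mem_univ _, hy.1.le, hy.2.le⟩, hy.2⟩

end BV

theorem measurable_of_locallyBoundedVariationOn_real {u : ℝ → ℝ}
    (hu : LocallyBoundedVariationOn u univ) : Measurable u := by
  obtain ⟨p, q, hp, hq, rfl⟩ := hu.exists_monotoneOn_sub_monotoneOn
  exact (monotoneOn_univ.1 hp).measurable.sub (monotoneOn_univ.1 hq).measurable

theorem measurable_of_locallyBoundedVariationOn_complex {u : ℝ → ℂ}
    (hu : LocallyBoundedVariationOn u univ) : Measurable u := by
  have hre := measurable_of_locallyBoundedVariationOn_real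
    (Complex.reCLM.lipschitz.comp_locallyBoundedVariationOn hu)
  have him := measurable_of_locallyBoundedVariationOn_real
    (Complex.imCLM.lipschitz.comp_locallyBoundedVariationOn hu)
  exact Complex.measurable_ofReal.comp hre |>.add
    ((Complex.measurable_ofReal.comp him).mul_const Complex.I) |> fun h => by
      convert h using 1
      funext x
      simp [Complex.re_add_im]

theorem locallyBoundedVariationOn_apply {n : ℕ} {u : ℝ → Fin n → ℂ}
    (hu : LocallyBoundedVariationOn u univ) (i : Fin n) :
    LocallyBoundedVariationOn (fun x => u x i) univ :=
  (LipschitzWith.eval i).comp_locallyBoundedVariationOn hu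

theorem measurable_of_locallyBoundedVariationOn {n : ℕ} {u : ℝ → Fin n → ℂ}
    (hu : LocallyBoundedVariationOn u univ) : Measurable u :=
  measurable_pi_lambda _ fun i =>
    measurable_of_locallyBoundedVariationOn_complex (locallyBoundedVariationOn_apply hu i)

theorem exists_norm_le_of_locallyBoundedVariationOn {E : Type*} [NormedAddCommGroup E]
    {u : ℝ → E} (hu : LocallyBoundedVariationOn u univ) (R : ℝ) :
    ∃ C, 0 ≤ C ∧ ∀ x ∈ Icc (-R) R, ‖u x‖ ≤ C := by
  refine ⟨‖u 0‖ + (eVariationOn u (univ ∩ Icc (-R) R)).toReal, by positivity, fun x hx => ?_⟩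
  have hR : 0 ≤ R := by linarith [hx.1, hx.2]
  have := (hu (-R) R (mem_univ _) (mem_univ _)).dist_le (x := x) (y := 0) ⟨mem_univ _, hx⟩
    ⟨mem_univ _, by linarith, hR⟩
  rw [dist_eq_norm] at this
  linarith [norm_le_norm_add_norm_sub' (u x) (u 0)]

theorem isBounded_iff_subset_Icc_neg {s : Set ℝ} :
    Bornology.IsBounded s ↔ ∃ R : ℝ, s ⊆ Icc (-R) R := by
  constructor
  · intro h
    obtain ⟨R, hR⟩ := h.subset_closedBall 0
    refine ⟨R, hR.trans ?_⟩
    rw [Real.closedBall_eq_Icc]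
    simp
  · rintro ⟨R, hR⟩
    exact (Metric.isBounded_Icc _ _).subset hR

theorem locallyIntegrable_iff_integrableOn_Icc {E : Type*} [NormedAddCommGroup E] {ν : Measure ℝ}
    {h : ℝ → E} : LocallyIntegrable h ν ↔ ∀ R : ℝ, IntegrableOn h (Icc (-R) R) ν := by
  constructor
  · intro hh R
    exact hh.integrableOn_isCompact isCompact_Icc
  · intro hh x
    refine ⟨Icc (-(|x| + 1)) (|x| + 1), ?_, hh _⟩
    exact Icc_mem_nhds (by linarith [neg_abs_le x]) (by linarith [le_abs_self x])

/-- A function of locally bounded variation times a locally integrable one. -/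
theorem locallyIntegrable_mul_of_bounded {ν : Measure ℝ} {u g : ℝ → ℂ} (hum : Measurable u)
    (hub : ∀ R : ℝ, ∃ C, ∀ x ∈ Icc (-R) R, ‖u x‖ ≤ C) (hg : LocallyIntegrable g ν) :
    LocallyIntegrable (fun x => u x * g x) ν := by
  rw [locallyIntegrable_iff_integrableOn_Icc] at hg ⊢
  intro R
  obtain ⟨C, hC⟩ := hub R
  refine (hg R).bdd_mul (c := C) hum.aestronglyMeasurable ?_
  filter_upwards [ae_restrict_mem measurableSet_Icc] with x hx using hC x hx

theorem locallyIntegrable_of_locallyBoundedVariationOn {ν : Measure ℝ} [IsLocallyFiniteMeasure ν]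
    {u : ℝ → ℂ} (hu : LocallyBoundedVariationOn u univ) : LocallyIntegrable u ν := by
  have := locallyIntegrable_mul_of_bounded (ν := ν)
    (measurable_of_locallyBoundedVariationOn_complex hu)
    (fun R => by
      obtain ⟨C, -, hC⟩ := exists_norm_le_of_locallyBoundedVariationOn hu R
      exact ⟨C, hC⟩) (locallyIntegrable_const (1 : ℂ))
  simpa using this

/-! ### Test functions and distributional derivatives -/

theorem IsTest.continuous {φ : ℝ → ℂ} (hφ : IsTest φ) : Continuous φ := hφ.1.continuous

theorem IsTest.hasDerivAt {φ : ℝ → ℂ} (hφ : IsTest φ) (x : ℝ) : HasDerivAt φ (deriv φ x) x :=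
  (hφ.1.differentiable (by simp) x).hasDerivAt

theorem IsTest.continuous_deriv {φ : ℝ → ℂ} (hφ : IsTest φ) : Continuous (deriv φ) :=
  hφ.1.continuous_deriv (by simp)

theorem IsTest.hasCompactSupport_deriv {φ : ℝ → ℂ} (hφ : IsTest φ) :
    HasCompactSupport (deriv φ) := hφ.2.deriv

theorem exists_support_subset_Ioo {E : Type*} [Zero E] {φ : ℝ → E} (hφ : HasCompactSupport φ) :
    ∃ R : ℝ, 0 < R ∧ ∀ x, x ∉ Ioo (-R) R → φ x = 0 := by
  obtain ⟨R, hR⟩ := isBounded_iff_subset_Icc_neg.1 hφ.isBounded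
  refine ⟨|R| + 1, by positivity, fun x hx => ?_⟩
  by_contra h
  have := hR (subset_tsupport _ h)
  refine hx ⟨?_, ?_⟩
  · linarith [this.1, le_abs_self R]
  · linarith [this.2, le_abs_self R]

theorem integrable_mul_of_hasCompactSupport {ν : Measure ℝ} {g φ : ℝ → ℂ}
    (hg : LocallyIntegrable g ν) (hφ : Continuous φ) (hs : HasCompactSupport φ) :
    Integrable (fun x => g x * φ x) ν := by
  have := hg.integrable_smul_left_of_hasCompactSupport hφ hs
  simpa [mul_comm] using this

theorem integral_eq_setIntegral_Ioc {ν : Measure ℝ} {f : ℝ → ℂ} {R : ℝ}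
    (hf : ∀ x, x ∉ Ioo (-R) R → f x = 0) : ∫ x, f x ∂ν = ∫ x in Ioc (-R) R, f x ∂ν := by
  rw [setIntegral_eq_integral_of_forall_compl_eq_zero]
  intro x hx
  exact hf x fun h => hx ⟨h.1, h.2.le⟩

theorem IsTest.setIntegral_deriv {φ : ℝ → ℂ} (hφ : IsTest φ) {a b : ℝ} (hab : a ≤ b) :
    ∫ t in Ioc a b, deriv φ t = φ b - φ a := by
  rw [← intervalIntegral.integral_of_le hab]
  exact intervalIntegral.integral_eq_sub_of_hasDerivAt (fun x _ => hφ.hasDerivAt x)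
    (hφ.continuous_deriv.intervalIntegrable _ _)

theorem IsTest.integral_deriv {φ : ℝ → ℂ} (hφ : IsTest φ) : ∫ t, deriv φ t = 0 := by
  obtain ⟨R, hR0, hR⟩ := exists_support_subset_Ioo hφ.2
  obtain ⟨R', hR0', hR'⟩ := exists_support_subset_Ioo hφ.hasCompactSupport_deriv
  rw [integral_eq_setIntegral_Ioc (R := max R R') (fun x hx => hR' x fun h => hx
    ⟨by linarith [h.1, le_max_right R R'], lt_max_of_lt_right h.2⟩),
    hφ.setIntegral_deriv (by linarith [le_max_left R R']),
    hR _ (by simp), hR _ (by simp), sub_zero]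

/-- The distributional derivative of a balanced antiderivative of `h dν` is `h dν`. -/
theorem integral_balPrim_mul_deriv {ν : Measure ℝ} [IsLocallyFiniteMeasure ν] {h : ℝ → ℂ}
    (hh : LocallyIntegrable h ν) (c : ℂ) {φ : ℝ → ℂ} (hφ : IsTest φ) :
    ∫ x, (c + balPrim ν h x) * deriv φ x = -∫ x, h x * φ x ∂ν := by
  obtain ⟨R, hR0, hR⟩ := exists_support_subset_Ioo hφ.2
  have hR' : ∀ x, x ∉ Ioo (-(R + 1)) (R + 1) → deriv φ x = 0 := by
    intro x hx
    have : φ =ᶠ[𝓝 x] fun _ => 0 := by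
      have hx' : x ∈ (Icc (-R) R)ᶜ := fun h => hx ⟨by linarith [h.1], by linarith [h.2]⟩
      filter_upwards [isClosed_Icc.isOpen_compl.mem_nhds hx'] with y hy
      exact hR y fun h => hy (Ioo_subset_Icc_self h)
    rw [this.deriv_eq]
    simp
  have hRb : ∀ x, x ∉ Ioo (-(R + 1)) (R + 1) → φ x = 0 := fun x hx => hR x fun h => hx
    ⟨by linarith [h.1], by linarith [h.2]⟩
  -- The margin is needed because `φ'` is known to vanish only outside the closed interval `[-R,
  -- R]`.
  set S := R + 1 with hS
  set C : ℂ := balPrim ν h (-S) + (ν.real {-S} / 2) • h (-S) + c with hC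
  have key := setIntegral_Ioc_mul_setIntegral_Ioc (μ := volume)
    (hh.integrableOn_of_bounded (Metric.isBounded_Ioc (-S) S))
    (hφ.continuous_deriv.locallyIntegrable.integrableOn_of_bounded (Metric.isBounded_Ioc (-S) S))
  rw [hφ.setIntegral_deriv (by linarith), hRb S (by simp), hRb (-S) (by simp), sub_zero,
    mul_zero] at key
  have e1 : ∫ s in Ioc (-S) S, h s * (∫ t in Ioo (-S) s, deriv φ t) ∂ν = ∫ x, h x * φ x ∂ν := by
    rw [integral_eq_setIntegral_Ioc (f := fun x => h x * φ x) (R := S)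
      (fun x hx => by rw [hRb x hx, mul_zero])]
    refine setIntegral_congr_fun measurableSet_Ioc fun s hs => ?_
    rw [← integral_Ioc_eq_integral_Ioo, hφ.setIntegral_deriv hs.1.le, hRb (-S) (by simp), sub_zero]
  have hi : Integrable (fun x => (c + balPrim ν h x) * deriv φ x) :=
    integrable_mul_of_hasCompactSupport
      (locallyIntegrable_of_locallyBoundedVariationOn (locallyBoundedVariationOn_balPrim hh c))
      hφ.continuous_deriv hφ.hasCompactSupport_deriv
  have hi' : Integrable (fun x => C * deriv φ x) :=
    (hφ.continuous_deriv.integrable_of_hasCompactSupport hφ.hasCompactSupport_deriv).const_mul C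
  have e2 : ∫ t in Ioc (-S) S, deriv φ t * (∫ s in Ioc (-S) t, h s ∂ν)
      = ∫ x, (c + balPrim ν h x) * deriv φ x := by
    -- Atoms are countable, hence Lebesgue-null; off them the balanced antiderivative differs from
    -- the plain integral by a constant, which drops out because `∫ φ' = 0`.
    have hc : {x : ℝ | 0 < ν {x}}.Countable :=
      Measure.countable_meas_pos_of_disjoint_iUnion (fun x => measurableSet_singleton x)
        fun i j hij => by simpa using hij
    rw [← sub_zero (∫ x, (c + balPrim ν h x) * deriv φ x), ← mul_zero C, ← hφ.integral_deriv,
      ← integral_const_mul, ← integral_sub hi hi', integral_eq_setIntegral_Ioc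
        (f := fun x => (c + balPrim ν h x) * deriv φ x - C * deriv φ x) (R := S)
        (fun x hx => by rw [hR' x hx]; simp)]
    refine setIntegral_congr_ae measurableSet_Ioc ?_
    filter_upwards [hc.ae_notMem volume] with t ht hts
    have h0 : ν.real {t} = 0 := by
      simp only [not_lt, nonpos_iff_eq_zero] at ht
      simp [Measure.real, ht]
    have := balPrim_sub_eq hh hts.1.le
    rw [h0] at this
    rw [show ∫ s in Ioc (-S) t, h s ∂ν = balPrim ν h t - balPrim ν h (-S)
      - (ν.real {-S} / 2) • h (-S) by rw [this]; simp]
    rw [hC]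
    ring
  rw [e1, e2] at key
  linear_combination -key

open scoped ContDiff in
/-- A test function with vanishing integral is the derivative of a test function. -/
theorem exists_isTest_deriv_eq {g : ℝ → ℂ} (hg : IsTest g) (h0 : ∫ x, g x = 0) :
    ∃ ψ, IsTest ψ ∧ deriv ψ = g := by
  obtain ⟨R, hR0, hR⟩ := exists_support_subset_Ioo hg.2
  have hd : ∀ x, HasDerivAt (fun x => ∫ t in (-R)..x, g t) (g x) x := fun x =>
    intervalIntegral.integral_hasDerivAt_right (hg.continuous.intervalIntegrable _ _)
      hg.continuous.aestronglyMeasurable.stronglyMeasurableAtFilter hg.continuous.continuousAt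
  have hderiv : deriv (fun x => ∫ t in (-R)..x, g t) = g := funext fun x => (hd x).deriv
  refine ⟨fun x => ∫ t in (-R)..x, g t, ⟨?_, ?_⟩, hderiv⟩
  · rw [contDiff_infty_iff_deriv, hderiv]
    exact ⟨fun x => (hd x).differentiableAt, hg.1⟩
  · refine HasCompactSupport.of_support_subset_isCompact (isCompact_Icc (a := -R) (b := R)) ?_
    intro x hx
    by_contra hxs
    apply hx
    rcases lt_or_ge x (-R) with h | h
    · refine (intervalIntegral.integral_congr (g := fun _ => (0 : ℂ)) fun t ht => ?_).trans
        (by simp)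
      rw [uIcc_of_ge h.le] at ht
      exact hR t fun h' => by linarith [h'.1, ht.2]
    · have hx' : R < x := by
        by_contra hc
        exact hxs ⟨h, not_lt.1 hc⟩
      have h1 : ∫ t in (-R)..R, g t = 0 := by
        rw [intervalIntegral.integral_of_le (by linarith), ← integral_eq_setIntegral_Ioc hR, h0]
      have h2 : ∫ t in R..x, g t = 0 := by
        refine (intervalIntegral.integral_congr (g := fun _ => (0 : ℂ)) fun t ht => ?_).trans
          (by simp)
        rw [uIcc_of_le hx'.le] at ht
        exact hR t fun h' => by linarith [h'.2, ht.1]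
      simp only
      rw [← intervalIntegral.integral_add_adjacent_intervals
        (hg.continuous.intervalIntegrable (-R) R) (hg.continuous.intervalIntegrable R x), h1, h2,
        add_zero]

open scoped ContDiff in
theorem exists_isTest_integral_eq_one : ∃ ρ : ℝ → ℂ, IsTest ρ ∧ ∫ x, ρ x = 1 := by
  let b : ContDiffBump (0 : ℝ) := default
  refine ⟨fun x => (b.normed volume x : ℂ), ⟨?_, ?_⟩, ?_⟩
  · exact Complex.ofRealCLM.contDiff.comp b.contDiff_normed
  · exact b.hasCompactSupport_normed.comp_left (g := fun x : ℝ => (x : ℂ)) (by simp)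
  · rw [integral_complex_ofReal, b.integral_normed]
    simp

theorem isTest_ofReal {g : ℝ → ℝ} (hg : ContDiff ℝ (⊤ : ℕ∞) g) (hs : HasCompactSupport g) :
    IsTest fun x => (g x : ℂ) :=
  ⟨Complex.ofRealCLM.contDiff.comp hg, hs.comp_left (g := fun x : ℝ => (x : ℂ)) (by simp)⟩

/-- A locally integrable function which vanishes as a distribution vanishes almost everywhere. -/
theorem ae_eq_zero_of_integral_mul_isTest {ν : Measure ℝ} {v : ℝ → ℂ} (hv : LocallyIntegrable v ν)
    (h : ∀ φ, IsTest φ → ∫ x, v x * φ x ∂ν = 0) : ∀ᵐ x ∂ν, v x = 0 := by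
  refine ae_eq_zero_of_integral_contDiff_smul_eq_zero hv fun g hg hs => ?_
  rw [← h _ (isTest_ofReal hg hs)]
  simp [mul_comm]

/-- The lemma of du Bois-Reymond. -/
theorem ae_eq_const_of_integral_mul_deriv {v : ℝ → ℂ} (hv : LocallyIntegrable v)
    (h : ∀ φ, IsTest φ → ∫ x, v x * deriv φ x = 0) : ∃ c, ∀ᵐ x, v x = c := by
  obtain ⟨ρ, hρ, hρ1⟩ := exists_isTest_integral_eq_one
  set c := ∫ x, v x * ρ x with hc
  refine ⟨c, ?_⟩
  have key : ∀ᵐ x, v x - c = 0 := by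
    refine ae_eq_zero_of_integral_mul_isTest (hv.sub (locallyIntegrable_const c)) fun φ hφ => ?_
    set m := ∫ x, φ x with hm
    have hφi := hφ.continuous.integrable_of_hasCompactSupport (μ := volume) hφ.2
    have hρi := hρ.continuous.integrable_of_hasCompactSupport (μ := volume) hρ.2
    -- Subtracting `m ρ` makes the integral zero, so the difference is the derivative of a test
    -- function and the hypothesis applies to it.
    have hg : IsTest fun x => φ x - m * ρ x :=
      ⟨hφ.1.sub (contDiff_const.mul hρ.1), hφ.2.sub (hρ.2.mul_left (f := fun _ => m))⟩
    obtain ⟨ψ, hψ, hψd⟩ := exists_isTest_deriv_eq hg (by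
      rw [integral_sub hφi (hρi.const_mul m), integral_const_mul, hρ1, hm]
      ring)
    have h1 := h ψ hψ
    have i1 := integrable_mul_of_hasCompactSupport hv hφ.continuous hφ.2
    have i2 := integrable_mul_of_hasCompactSupport hv hρ.continuous hρ.2
    rw [hψd] at h1
    have e1 : ∫ x, v x * (φ x - m * ρ x) = (∫ x, v x * φ x) - m * c := by
      rw [hc, ← integral_const_mul, ← integral_sub i1 (i2.const_mul m)]
      congr 1
      funext x
      ring
    have e2 : ∫ x, (v x - c) * φ x = (∫ x, v x * φ x) - c * m := by
      rw [hm, ← integral_const_mul, ← integral_sub i1 (hφi.const_mul c)]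
      congr 1
      funext x
      ring
    rw [e2]
    rw [e1] at h1
    linear_combination h1
  filter_upwards [key] with x hx using sub_eq_zero.1 hx

/-- Functions which agree almost everywhere have the same right-hand limits. -/
theorem tendsto_right_unique_of_ae {E : Type*} [TopologicalSpace E] [T2Space E] {u v : ℝ → E}
    (huv : ∀ᵐ x, u x = v x) {x : ℝ} {l m : E} (hu : Tendsto u (𝓝[>] x) (𝓝 l))
    (hv : Tendsto v (𝓝[>] x) (𝓝 m)) : l = m := by
  have hd : Dense {x | u x = v x} := Measure.dense_of_ae huv
  have hx : x ∈ closure (Ioi x ∩ {x | u x = v x}) := by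
    have h1 := closure_mono (hd.open_subset_closure_inter (isOpen_Ioi (a := x)))
    rw [closure_closure, closure_Ioi] at h1
    exact h1 self_mem_Ici
  have := mem_closure_iff_nhdsWithin_neBot.1 hx
  refine tendsto_nhds_unique (l := 𝓝[Ioi x ∩ {x | u x = v x}] x)
    (hu.mono_left (nhdsWithin_mono x inter_subset_left)) ?_
  refine (hv.mono_left (nhdsWithin_mono x inter_subset_left)).congr' ?_
  filter_upwards [self_mem_nhdsWithin] with y hy using hy.2.symm

/-- Functions which agree almost everywhere have the same left-hand limits. -/
theorem tendsto_left_unique_of_ae {E : Type*} [TopologicalSpace E] [T2Space E] {u v : ℝ → E}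
    (huv : ∀ᵐ x, u x = v x) {x : ℝ} {l m : E} (hu : Tendsto u (𝓝[<] x) (𝓝 l))
    (hv : Tendsto v (𝓝[<] x) (𝓝 m)) : l = m := by
  have hd : Dense {x | u x = v x} := Measure.dense_of_ae huv
  have hx : x ∈ closure (Iio x ∩ {x | u x = v x}) := by
    have h1 := closure_mono (hd.open_subset_closure_inter (isOpen_Iio (a := x)))
    rw [closure_closure, closure_Iio] at h1
    exact h1 self_mem_Iic
  have := mem_closure_iff_nhdsWithin_neBot.1 hx
  refine tendsto_nhds_unique (l := 𝓝[Iio x ∩ {x | u x = v x}] x)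
    (hu.mono_left (nhdsWithin_mono x inter_subset_left)) ?_
  refine (hv.mono_left (nhdsWithin_mono x inter_subset_left)).congr' ?_
  filter_upwards [self_mem_nhdsWithin] with y hy using hy.2.symm

/-! ### Iterated integrals along a strict order and a Gronwall argument -/

section Iterated

/-- Iterated integrals of `1` along an order relation. -/
noncomputable def iterInt (μ : Measure ℝ) (r : ℝ → ℝ → Prop) : ℕ → ℝ → ℝ≥0∞
  | 0, _ => 1
  | n + 1, x => ∫⁻ t in {t | r t x}, iterInt μ r n t ∂μ

variable {μ : Measure ℝ} [SFinite μ] {r : ℝ → ℝ → Prop}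

theorem measurableSet_rel_left (hr : MeasurableSet {p : ℝ × ℝ | r p.1 p.2}) (x : ℝ) :
    MeasurableSet {t | r t x} := by
  have : Measurable fun t : ℝ => (t, x) := measurable_id.prodMk measurable_const
  exact this hr

theorem measurable_iterInt (hr : MeasurableSet {p : ℝ × ℝ | r p.1 p.2}) (n : ℕ) :
    Measurable (iterInt μ r n) := by
  induction n with
  | zero => exact measurable_const
  | succ n ih =>
    have e : iterInt μ r (n + 1)
        = fun x => ∫⁻ t, {p : ℝ × ℝ | r p.2 p.1}.indicator (fun p => iterInt μ r n p.2) (x, t) ∂μ := by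
      funext x
      rw [iterInt, ← lintegral_indicator (measurableSet_rel_left hr x)]
      rfl
    rw [e]
    have hs : MeasurableSet {p : ℝ × ℝ | r p.2 p.1} := measurable_swap hr
    exact Measurable.lintegral_prod_right' (f := {p : ℝ × ℝ | r p.2 p.1}.indicator
      (fun p => iterInt μ r n p.2)) ((ih.comp measurable_snd).indicator hs)

theorem iterInt_one (x : ℝ) : iterInt μ r 1 x = μ {t | r t x} := by
  simp [iterInt]

/-- The shuffle inequality for iterated integrals. -/
theorem succ_mul_iterInt_le (hr : MeasurableSet {p : ℝ × ℝ | r p.1 p.2})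
    (htrans : ∀ x y z, r x y → r y z → r x z) (hasymm : ∀ x y, r x y → ¬ r y x) (n : ℕ) (x : ℝ) :
    ((n : ℝ≥0∞) + 1) * iterInt μ r (n + 1) x ≤ iterInt μ r 1 x * iterInt μ r n x := by
  induction n generalizing x with
  | zero => simp [iterInt]
  | succ n ih =>
    have hm := measurable_iterInt (μ := μ) hr
    have hx := measurableSet_rel_left hr x
    set κ := μ.restrict {t | r t x} with hκ
    -- `hA` and `hB` are integrals of the same function of `t` over the pairs with `s` before `t`
    -- and with `t` before `s`. By asymmetry these regions are disjoint. For the orders `<` and `>`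
    -- used later, the pairs left over form the diagonal, which carries mass when there are atoms;
    -- hence only an inequality.
    have hA : ∫⁻ t, iterInt μ r 1 t * iterInt μ r n t ∂κ
        = ∫⁻ t, ∫⁻ s, {p : ℝ × ℝ | r p.1 p.2}.indicator (fun p => iterInt μ r n p.2) (s, t)
          ∂κ ∂κ := by
      refine setLIntegral_congr_fun hx fun t ht => ?_
      have e : (fun s => {p : ℝ × ℝ | r p.1 p.2}.indicator (fun p => iterInt μ r n p.2) (s, t))
          = {s | r s t}.indicator fun _ => iterInt μ r n t := by
        funext s
        simp [indicator]
      rw [e, lintegral_indicator (measurableSet_rel_left hr t), hκ,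
        Measure.restrict_restrict (measurableSet_rel_left hr t), lintegral_const,
        Measure.restrict_apply_univ, iterInt_one, mul_comm]
      congr 2
      ext s
      simp only [mem_ofPred_eq, mem_inter_iff]
      exact ⟨fun h => ⟨h, htrans _ _ _ h ht⟩, fun h => h.1⟩
    have hB : ∫⁻ s, iterInt μ r (n + 1) s ∂κ
        = ∫⁻ t, ∫⁻ s, {p : ℝ × ℝ | r p.2 p.1}.indicator (fun p => iterInt μ r n p.2) (s, t)
          ∂κ ∂κ := by
      rw [lintegral_lintegral_swap (f := fun t s =>
        {p : ℝ × ℝ | r p.2 p.1}.indicator (fun p => iterInt μ r n p.2) (s, t))]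
      · refine setLIntegral_congr_fun hx fun s hs => ?_
        have e : (fun t => {p : ℝ × ℝ | r p.2 p.1}.indicator (fun p => iterInt μ r n p.2) (s, t))
            = {t | r t s}.indicator fun t => iterInt μ r n t := by
          funext t
          simp [indicator]
        rw [e, lintegral_indicator (measurableSet_rel_left hr s), hκ,
          Measure.restrict_restrict (measurableSet_rel_left hr s), iterInt]
        congr 2
        ext t
        simp only [mem_ofPred_eq, mem_inter_iff]
        exact ⟨fun h => ⟨h, htrans _ _ _ h hs⟩, fun h => h.1⟩
      · have hs : MeasurableSet {p : ℝ × ℝ | r p.2 p.1} := measurable_swap hr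
        exact ((((hm n).comp measurable_snd).indicator hs).comp measurable_swap).aemeasurable
    calc ((n + 1 : ℕ) + 1 : ℝ≥0∞) * iterInt μ r (n + 1 + 1) x
        = ∫⁻ t, ((n : ℝ≥0∞) + 1) * iterInt μ r (n + 1) t ∂κ + ∫⁻ s, iterInt μ r (n + 1) s ∂κ := by
          rw [lintegral_const_mul _ (hm _), add_mul, one_mul]
          push_cast
          rfl
      _ ≤ ∫⁻ t, iterInt μ r 1 t * iterInt μ r n t ∂κ + ∫⁻ s, iterInt μ r (n + 1) s ∂κ := by
          exact add_le_add (lintegral_mono fun t => ih t) le_rfl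
      _ = ∫⁻ t, ((∫⁻ s, {p : ℝ × ℝ | r p.1 p.2}.indicator (fun p => iterInt μ r n p.2) (s, t) ∂κ)
            + ∫⁻ s, {p : ℝ × ℝ | r p.2 p.1}.indicator (fun p => iterInt μ r n p.2) (s, t) ∂κ) ∂κ := by
          rw [hA, hB, lintegral_add_left]
          exact Measurable.lintegral_prod_left' (f := {p : ℝ × ℝ | r p.1 p.2}.indicator
            (fun p => iterInt μ r n p.2)) (((hm n).comp measurable_snd).indicator hr)
      _ ≤ ∫⁻ t, ∫⁻ _, iterInt μ r n t ∂κ ∂κ := by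
          gcongr with t
          rw [← lintegral_add_left]
          · refine lintegral_mono fun s => ?_
            by_cases h1 : r s t
            · simp [indicator, h1, hasymm _ _ h1]
            · by_cases h2 : r t s <;> simp [indicator, h1, h2]
          · have : Measurable fun s : ℝ => (s, t) := measurable_id.prodMk measurable_const
            exact (((hm n).comp measurable_snd).indicator hr).comp this
      _ = iterInt μ r 1 x * iterInt μ r (n + 1) x := by
          simp only [lintegral_const]
          rw [lintegral_mul_const _ (hm n), iterInt_one, hκ, Measure.restrict_apply_univ, mul_comm]
          rfl

theorem factorial_mul_iterInt_le (hr : MeasurableSet {p : ℝ × ℝ | r p.1 p.2})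
    (htrans : ∀ x y z, r x y → r y z → r x z) (hasymm : ∀ x y, r x y → ¬ r y x) (n : ℕ) (x : ℝ) :
    (n.factorial : ℝ≥0∞) * iterInt μ r n x ≤ μ {t | r t x} ^ n := by
  induction n with
  | zero => simp [iterInt]
  | succ n ih =>
    calc ((n + 1).factorial : ℝ≥0∞) * iterInt μ r (n + 1) x
        = n.factorial * (((n : ℝ≥0∞) + 1) * iterInt μ r (n + 1) x) := by
          rw [Nat.factorial_succ]
          push_cast
          ring
      _ ≤ n.factorial * (iterInt μ r 1 x * iterInt μ r n x) := by
          exact mul_le_mul' le_rfl (succ_mul_iterInt_le hr htrans hasymm n x)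
      _ = μ {t | r t x} * (n.factorial * iterInt μ r n x) := by
          rw [iterInt_one]
          ring
      _ ≤ μ {t | r t x} * μ {t | r t x} ^ n := by gcongr
      _ = μ {t | r t x} ^ (n + 1) := by rw [pow_succ']

theorem iterInt_lt_top (hr : MeasurableSet {p : ℝ × ℝ | r p.1 p.2})
    (htrans : ∀ x y z, r x y → r y z → r x z) (hasymm : ∀ x y, r x y → ¬ r y x) (n : ℕ) {x : ℝ}
    (hx : μ {t | r t x} < ∞) : iterInt μ r n x < ∞ := by
  have h := factorial_mul_iterInt_le (μ := μ) hr htrans hasymm n x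
  have h1 : (1 : ℝ≥0∞) ≤ (n.factorial : ℝ≥0∞) := by exact_mod_cast Nat.factorial_pos n
  calc iterInt μ r n x = 1 * iterInt μ r n x := (one_mul _).symm
    _ ≤ n.factorial * iterInt μ r n x := by gcongr
    _ ≤ _ := h
    _ < ∞ := ENNReal.pow_lt_top hx

theorem toReal_iterInt_le (hr : MeasurableSet {p : ℝ × ℝ | r p.1 p.2})
    (htrans : ∀ x y z, r x y → r y z → r x z) (hasymm : ∀ x y, r x y → ¬ r y x) (n : ℕ) {x : ℝ}
    (hx : μ {t | r t x} < ∞) :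
    (iterInt μ r n x).toReal ≤ μ.real {t | r t x} ^ n / n.factorial := by
  have h := factorial_mul_iterInt_le (μ := μ) hr htrans hasymm n x
  have h2 := ENNReal.toReal_mono (ENNReal.pow_lt_top hx).ne h
  rw [ENNReal.toReal_mul, ENNReal.toReal_pow, ENNReal.toReal_natCast] at h2
  rw [le_div_iff₀ (by positivity), mul_comm]
  exact h2

/-- A bounded function dominated by its own integral along an order relation vanishes. -/
theorem eq_zero_of_le_lintegral (hr : MeasurableSet {p : ℝ × ℝ | r p.1 p.2})
    (htrans : ∀ x y z, r x y → r y z → r x z) (hasymm : ∀ x y, r x y → ¬ r y x)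
    {f : ℝ → ℝ≥0∞} {C : ℝ≥0∞} (hC : C ≠ ∞) (hfC : ∀ x, f x ≤ C)
    (hf : ∀ x, f x ≤ ∫⁻ t in {t | r t x}, f t ∂μ) {x : ℝ} (hx : μ {t | r t x} < ∞) : f x = 0 := by
  have hn : ∀ n y, f y ≤ C * iterInt μ r n y := by
    intro n
    induction n with
    | zero => simpa [iterInt] using hfC
    | succ n ih =>
      intro y
      refine (hf y).trans ?_
      rw [iterInt, ← lintegral_const_mul' _ _ hC]
      gcongr with t
      exact ih t
  have hle : ∀ n : ℕ, (f x).toReal ≤ C.toReal * (μ.real {t | r t x} ^ n / n.factorial) := by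
    intro n
    refine (ENNReal.toReal_mono (ENNReal.mul_ne_top hC
      (iterInt_lt_top hr htrans hasymm n hx).ne) (hn n x)).trans ?_
    rw [ENNReal.toReal_mul]
    gcongr
    exact toReal_iterInt_le hr htrans hasymm n hx
  have hlim := (FloorSemiring.tendsto_pow_div_factorial_atTop (μ.real {t | r t x})).const_mul
    C.toReal
  rw [mul_zero] at hlim
  have h0 : (f x).toReal = 0 := le_antisymm (ge_of_tendsto' hlim hle) ENNReal.toReal_nonneg
  rcases (ENNReal.toReal_eq_zero_iff _).1 h0 with h | h
  · exact h
  · exact absurd (hfC x) (by rw [h]; simpa using hC)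

end Iterated

/-! ### Volterra equations with respect to a measure -/

section Volterra

variable {n : ℕ}

/-- The sum of the absolute values of the entries of a matrix. -/
noncomputable def entrySum (M : Matrix (Fin n) (Fin n) ℂ) : ℝ := ∑ i, ∑ j, ‖M i j‖

theorem entrySum_nonneg (M : Matrix (Fin n) (Fin n) ℂ) : 0 ≤ entrySum M :=
  Finset.sum_nonneg fun _ _ => Finset.sum_nonneg fun _ _ => norm_nonneg _

theorem norm_entry_le (M : Matrix (Fin n) (Fin n) ℂ) (i j : Fin n) : ‖M i j‖ ≤ entrySum M :=
  (Finset.single_le_sum (f := fun j => ‖M i j‖) (fun _ _ => norm_nonneg _)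
    (Finset.mem_univ j)).trans
    (Finset.single_le_sum (f := fun i => ∑ j, ‖M i j‖)
      (fun _ _ => Finset.sum_nonneg fun _ _ => norm_nonneg _) (Finset.mem_univ i))

theorem norm_mulVec_le (M : Matrix (Fin n) (Fin n) ℂ) (v : Fin n → ℂ) :
    ‖M *ᵥ v‖ ≤ entrySum M * ‖v‖ := by
  rw [pi_norm_le_iff_of_nonneg (mul_nonneg (entrySum_nonneg M) (norm_nonneg v))]
  intro i
  calc ‖(M *ᵥ v) i‖ ≤ ∑ j, ‖M i j * v j‖ := by
        rw [mulVec, dotProduct]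
        exact norm_sum_le _ _
    _ ≤ ∑ j, ‖M i j‖ * ‖v‖ := by
        gcongr with j
        rw [norm_mul]
        gcongr
        exact norm_le_pi_norm v j
    _ = (∑ j, ‖M i j‖) * ‖v‖ := by rw [Finset.sum_mul]
    _ ≤ entrySum M * ‖v‖ := by
        gcongr
        exact Finset.single_le_sum (f := fun i => ∑ j, ‖M i j‖)
          (fun _ _ => Finset.sum_nonneg fun _ _ => norm_nonneg _) (Finset.mem_univ i)

theorem measurable_mulVec {A : ℝ → Matrix (Fin n) (Fin n) ℂ}
    (hA : ∀ i j, Measurable fun x => A x i j) {v : ℝ → Fin n → ℂ} (hv : Measurable v) :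
    Measurable fun x => A x *ᵥ v x := by
  refine measurable_pi_lambda _ fun i => ?_
  simp only [mulVec, dotProduct]
  exact Finset.measurable_fun_sum _ fun j _ => (hA i j).mul ((measurable_pi_apply j).comp hv)

theorem measurable_entrySum {A : ℝ → Matrix (Fin n) (Fin n) ℂ}
    (hA : ∀ i j, Measurable fun x => A x i j) : Measurable fun x => entrySum (A x) :=
  Finset.measurable_fun_sum _ fun i _ => Finset.measurable_fun_sum _ fun j _ => (hA i j).norm

/-- The iterates of the Volterra operator with kernel `A dν`. -/
noncomputable def volterraIter (ν : Measure ℝ) (r : ℝ → ℝ → Prop)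
    (A : ℝ → Matrix (Fin n) (Fin n) ℂ) (c : Fin n → ℂ) : ℕ → ℝ → Fin n → ℂ
  | 0, _ => c
  | m + 1, x => ∫ t in {t | r t x}, A t *ᵥ volterraIter ν r A c m t ∂ν

variable {ν : Measure ℝ} [SFinite ν] {r : ℝ → ℝ → Prop} {A : ℝ → Matrix (Fin n) (Fin n) ℂ}

theorem measurable_volterraIter (hr : MeasurableSet {p : ℝ × ℝ | r p.1 p.2})
    (hA : ∀ i j, Measurable fun x => A x i j) (c : Fin n → ℂ) (m : ℕ) :
    Measurable (volterraIter ν r A c m) := by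
  induction m with
  | zero => exact measurable_const
  | succ m ih =>
    have e : volterraIter ν r A c (m + 1) = fun x => ∫ t, {p : ℝ × ℝ | r p.2 p.1}.indicator
        (fun p => A p.2 *ᵥ volterraIter ν r A c m p.2) (x, t) ∂ν := by
      funext x
      rw [volterraIter, ← integral_indicator (measurableSet_rel_left hr x)]
      rfl
    rw [e]
    have hs : MeasurableSet {p : ℝ × ℝ | r p.2 p.1} := measurable_swap hr
    have hm := (((measurable_mulVec hA ih).comp measurable_snd).indicator hs)
    exact (hm.stronglyMeasurable.integral_prod_right').measurable

/-- Each application of the kernel costs a factor `entrySum (A t)`, so the iterates are dominated by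
scalar iterated integrals for the measure with this density; the factorial in their bound makes the
Neumann series converge. -/
theorem enorm_volterraIter_le (hA : ∀ i j, Measurable fun x => A x i j) (c : Fin n → ℂ) (m : ℕ)
    (x : ℝ) : ‖volterraIter ν r A c m x‖ₑ
      ≤ ‖c‖ₑ * iterInt (ν.withDensity fun t => ENNReal.ofReal (entrySum (A t))) r m x := by
  induction m generalizing x with
  | zero => simp [iterInt, volterraIter]
  | succ m ih =>
    have hd : Measurable fun t => ENNReal.ofReal (entrySum (A t)) :=
      (measurable_entrySum hA).ennreal_ofReal
    rw [volterraIter, iterInt, ← lintegral_const_mul' _ _ (by simp), restrict_withDensity',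
      lintegral_withDensity_eq_lintegral_mul_non_measurable _ hd (by simp)]
    refine (enorm_integral_le_lintegral_enorm _).trans ?_
    refine lintegral_mono fun t => ?_
    refine le_trans ?_ (mul_le_mul_right (ih t) _)
    rw [← ofReal_norm, ← ofReal_norm, ← ENNReal.ofReal_mul (entrySum_nonneg _)]
    exact ENNReal.ofReal_le_ofReal (norm_mulVec_le _ _)

/-- Solvability of the Volterra equation `v(x) = c + ∫_{t before x} A v dν`. -/
theorem exists_volterra (hr : MeasurableSet {p : ℝ × ℝ | r p.1 p.2})
    (htrans : ∀ x y z, r x y → r y z → r x z) (hasymm : ∀ x y, r x y → ¬ r y x)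
    (hA : ∀ i j, Measurable fun x => A x i j)
    (hint : ∀ x, IntegrableOn (fun t => entrySum (A t)) {t | r t x} ν) (c : Fin n → ℂ) :
    ∃ v : ℝ → Fin n → ℂ, Measurable v ∧
      (∀ x, v x = c + ∫ t in {t | r t x}, A t *ᵥ v t ∂ν) ∧
      ∀ x, ‖v x‖ ≤ ‖c‖ * Real.exp (∫ t in {t | r t x}, entrySum (A t) ∂ν) := by
  set μ := ν.withDensity fun t => ENNReal.ofReal (entrySum (A t)) with hμ
  set K : ℝ → ℝ := fun x => ∫ t in {t | r t x}, entrySum (A t) ∂ν with hK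
  have hμx : ∀ x, μ {t | r t x} = ENNReal.ofReal (K x) := by
    intro x
    rw [hμ, withDensity_apply _ (measurableSet_rel_left hr x), hK,
      ofReal_integral_eq_lintegral_ofReal (hint x) (Eventually.of_forall fun t => entrySum_nonneg _)]
  have hK0 : ∀ x, 0 ≤ K x := fun x => integral_nonneg fun t => entrySum_nonneg _
  have hfin : ∀ x, μ {t | r t x} < ∞ := fun x => by rw [hμx]; exact ENNReal.ofReal_lt_top
  set V := volterraIter ν r A c with hV
  have hVm : ∀ m, Measurable (V m) := measurable_volterraIter hr hA c
  have hVn : ∀ m x, ‖V m x‖ ≤ ‖c‖ * (K x ^ m / m.factorial) := by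
    intro m x
    have h := enorm_volterraIter_le (ν := ν) (r := r) hA c m x
    have h2 := ENNReal.toReal_mono (ENNReal.mul_ne_top (by simp)
      (iterInt_lt_top hr htrans hasymm m (hfin x)).ne) h
    rw [toReal_enorm, ENNReal.toReal_mul, toReal_enorm] at h2
    refine h2.trans ?_
    gcongr
    have := toReal_iterInt_le (μ := μ) hr htrans hasymm m (hfin x)
    rwa [Measure.real, hμx, ENNReal.toReal_ofReal (hK0 x)] at this
  have hsum : ∀ x, HasSum (fun m : ℕ => ‖c‖ * (K x ^ m / m.factorial)) (‖c‖ * Real.exp (K x)) := by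
    intro x
    have := NormedSpace.expSeries_div_hasSum_exp (𝔸 := ℝ) (K x)
    rw [← Real.exp_eq_exp_ℝ] at this
    exact this.mul_left _
  have hVs : ∀ x, Summable fun m => V m x := fun x =>
    Summable.of_norm_bounded (hsum x).summable fun m => hVn m x
  refine ⟨fun x => ∑' m, V m x, ?_, ?_, ?_⟩
  · exact measurable_of_tendsto_metrizable (fun N : ℕ => Finset.measurable_fun_sum
      (Finset.range N) fun m _ => hVm m)
      (tendsto_pi_nhds.2 fun x => (hVs x).hasSum.tendsto_sum_nat)
  · intro x
    -- By transitivity `K` is monotone along `r`, so the bounds at `x` serve for all `t` before `x`;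
    -- this legitimates exchanging sum and integral.
    have hin : ∀ m t, r t x → ‖A t *ᵥ V m t‖ ≤ entrySum (A t) * (‖c‖ * (K x ^ m / m.factorial)) := by
      intro m t ht
      refine (norm_mulVec_le _ _).trans ?_
      refine mul_le_mul_of_nonneg_left ((hVn m t).trans ?_) (entrySum_nonneg _)
      have : K t ≤ K x := setIntegral_mono_set (hint x)
        (Eventually.of_forall fun t => entrySum_nonneg _)
        (Eventually.of_forall fun s hs => htrans _ _ _ hs ht)
      have := hK0 t
      gcongr
    have hbi : ∀ m, Integrable (fun t => entrySum (A t) * (‖c‖ * (K x ^ m / m.factorial)))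
        (ν.restrict {t | r t x}) := fun m => (hint x).mul_const _
    have hi : ∀ m, Integrable (fun t => A t *ᵥ V m t) (ν.restrict {t | r t x}) := fun m =>
      (hbi m).mono' (measurable_mulVec hA (hVm m)).aestronglyMeasurable
        (by filter_upwards [ae_restrict_mem (measurableSet_rel_left hr x)] with t ht
            using hin m t ht)
    have hs : Summable fun m => ∫ t in {t | r t x}, ‖A t *ᵥ V m t‖ ∂ν := by
      refine Summable.of_nonneg_of_le (fun m => integral_nonneg fun t => norm_nonneg _)
        (fun m => ?_) ((hsum x).summable.mul_left (K x))
      rw [hK, ← integral_mul_const]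
      refine integral_mono_ae (hi m).norm (hbi m) ?_
      filter_upwards [ae_restrict_mem (measurableSet_rel_left hr x)] with t ht using hin m t ht
    have key := hasSum_integral_of_summable_integral_norm hi hs
    have e : ∀ t, ∑' m, A t *ᵥ V m t = A t *ᵥ ∑' m, V m t := by
      intro t
      have := (Matrix.mulVecLin (A t)).toContinuousLinearMap.map_tsum (hVs t)
      simpa using this.symm
    simp only [e] at key
    simp only
    rw [(hVs x).tsum_eq_zero_add]
    congr 1
    exact key.tsum_eq
  · intro x
    exact tsum_of_norm_bounded (hsum x) fun m => hVn m x

end Volterra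

/-! ### Calculus of balanced antiderivatives -/

section IsPrim

variable {E : Type*} [NormedAddCommGroup E] [NormedSpace ℝ E] [CompleteSpace E]

/-- `u` is a balanced antiderivative of the local measure `h dν`. -/
def IsPrim (ν : Measure ℝ) (u h : ℝ → E) : Prop :=
  LocallyIntegrable h ν ∧ ∃ c, ∀ x, u x = c + balPrim ν h x

variable {ν : Measure ℝ} [IsLocallyFiniteMeasure ν] {u h : ℝ → E}

theorem IsPrim.sub_eq (H : IsPrim ν u h) {x y : ℝ} (hxy : x ≤ y) :
    u y - u x = (∫ t in Ioc x y, h t ∂ν) - (ν.real {y} / 2) • h y + (ν.real {x} / 2) • h x := by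
  obtain ⟨hh, c, hc⟩ := H
  rw [hc, hc, add_sub_add_left_eq_sub, balPrim_sub_eq hh hxy]

/-- Increments between right-hand limits. -/
theorem IsPrim.right_sub_right (H : IsPrim ν u h) {x y : ℝ} (hxy : x ≤ y) :
    (u y + (ν.real {y} / 2) • h y) - (u x + (ν.real {x} / 2) • h x) = ∫ t in Ioc x y, h t ∂ν := by
  have := H.sub_eq hxy
  rw [add_sub_add_comm, this]
  abel

/-- Increments from a right-hand limit to a left-hand limit. -/
theorem IsPrim.left_sub_right (H : IsPrim ν u h) {x y : ℝ} (hxy : x < y) :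
    (u y - (ν.real {y} / 2) • h y) - (u x + (ν.real {x} / 2) • h x) = ∫ t in Ioo x y, h t ∂ν := by
  have h1 := H.right_sub_right hxy.le
  rw [setIntegral_Ioc_eq_Ioo_add H.1 hxy] at h1
  rw [← add_right_cancel_iff (a := ν.real {y} • h y), ← h1]
  module

theorem IsPrim.sub {v k : ℝ → E} (H : IsPrim ν u h) (K : IsPrim ν v k) :
    IsPrim ν (fun x => u x - v x) fun x => h x - k x := by
  obtain ⟨hh, c, hc⟩ := H
  obtain ⟨hk, d, hd⟩ := K
  refine ⟨hh.sub hk, c - d, fun x => ?_⟩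
  show u x - v x = _
  rw [hc, hd, balPrim, balPrim, balPrim, intervalIntegral.integral_sub (hh.intervalIntegrable 0 x)
    (hk.intervalIntegrable 0 x)]
  module

theorem IsPrim.add {v k : ℝ → E} (H : IsPrim ν u h) (K : IsPrim ν v k) :
    IsPrim ν (fun x => u x + v x) fun x => h x + k x := by
  obtain ⟨hh, c, hc⟩ := H
  obtain ⟨hk, d, hd⟩ := K
  refine ⟨hh.add hk, c + d, fun x => ?_⟩
  show u x + v x = _
  rw [hc, hd, balPrim, balPrim, balPrim, intervalIntegral.integral_add (hh.intervalIntegrable 0 x)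
    (hk.intervalIntegrable 0 x)]
  module

/-- The pointwise term in the balanced antiderivative is harmless: at an atom almost everywhere
equality is equality, and elsewhere the term carries the factor zero. -/
theorem IsPrim.congr_ae {k : ℝ → E} (H : IsPrim ν u h) (hk : h =ᵐ[ν] k) : IsPrim ν u k := by
  obtain ⟨hh, c, hc⟩ := H
  refine ⟨fun x => (hh x).congr hk, c, fun x => ?_⟩
  rw [hc, balPrim, balPrim]
  congr 2
  · exact intervalIntegral.integral_congr_ae (hk.mono fun t ht _ => ht)
  · by_cases h0 : ν {x} = 0
    · simp [Measure.real, h0]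
    · congr 1
      by_contra hne
      exact h0 (measure_mono_null (by simpa using hne) (ae_iff.1 hk))

theorem IsPrim.locallyBoundedVariationOn (H : IsPrim ν u h) :
    LocallyBoundedVariationOn u univ := by
  obtain ⟨hh, c, hc⟩ := H
  rw [show u = fun x => c + balPrim ν h x from funext hc]
  exact locallyBoundedVariationOn_balPrim hh c

theorem IsPrim.tendsto_right (H : IsPrim ν u h) (x : ℝ) :
    Tendsto u (𝓝[>] x) (𝓝 (u x + (ν.real {x} / 2) • h x)) := by
  obtain ⟨hh, c, hc⟩ := H
  rw [show u = fun x => c + balPrim ν h x from funext hc, add_assoc]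
  exact (tendsto_balPrim_right hh x).const_add c

theorem IsPrim.tendsto_left (H : IsPrim ν u h) (x : ℝ) :
    Tendsto u (𝓝[<] x) (𝓝 (u x - (ν.real {x} / 2) • h x)) := by
  obtain ⟨hh, c, hc⟩ := H
  rw [show u = fun x => c + balPrim ν h x from funext hc, add_sub_assoc]
  exact (tendsto_balPrim_left hh x).const_add c

end IsPrim

/-! ### Passing from one-sided limits to balanced values at atoms -/

section Cayley

/-- The determinant of `1 ± ½ ν{x} G(x)` for a trace-free `G(x)`. -/
noncomputable def jumpDet (ν : Measure ℝ) (G : ℝ → Matrix (Fin 2) (Fin 2) ℂ) (x : ℝ) : ℂ :=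
  1 + ((ν.real {x} / 2 : ℝ) : ℂ) ^ 2 * (G x).det

/-- The inverse of `1 - ½ s ν{x} G(x)`, for `s = ±1` and a trace-free `G(x)`. -/
noncomputable def cayley (ν : Measure ℝ) (G : ℝ → Matrix (Fin 2) (Fin 2) ℂ) (s : ℝ) (x : ℝ) :
    Matrix (Fin 2) (Fin 2) ℂ :=
  (jumpDet ν G x)⁻¹ • (1 + ((s * (ν.real {x} / 2) : ℝ) : ℂ) • G x)

/-- Coefficients of a trace-free system `u' = G u dν` for which the transfer across each atom is
invertible. -/
structure IsRegularCoeff (ν : Measure ℝ) (G : ℝ → Matrix (Fin 2) (Fin 2) ℂ) : Prop where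
  measurable : ∀ i j, Measurable fun x => G x i j
  locallyIntegrable : ∀ i j, LocallyIntegrable (fun x => G x i j) ν
  trace_eq_zero : ∀ x, G x 1 1 = -G x 0 0
  jumpDet_ne_zero : ∀ x, jumpDet ν G x ≠ 0

variable {ν : Measure ℝ} {G : ℝ → Matrix (Fin 2) (Fin 2) ℂ}

/-- A trace-free `2 × 2` matrix satisfies `G² = -det G`, whence `(1 - s d G)(1 + s d G) = 1 + d² det
G` for `s² = 1`. -/
theorem cayley_mulVec_sub (hG : IsRegularCoeff ν G) {s : ℝ} (hs : s ^ 2 = 1) (x : ℝ)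
    (u : Fin 2 → ℂ) :
    cayley ν G s x *ᵥ (u - (s * (ν.real {x} / 2)) • (G x *ᵥ u)) = u := by
  have hk := hG.jumpDet_ne_zero x
  have ht := hG.trace_eq_zero x
  have hs' : (s : ℂ) ^ 2 = 1 := by exact_mod_cast hs
  rw [cayley, smul_mulVec, inv_smul_eq_iff₀ hk]
  ext i
  fin_cases i <;>
  · simp [jumpDet, mulVec, dotProduct, Fin.sum_univ_two, det_fin_two, ht]
    ring_nf
    simp only [hs']
    ring

theorem sub_cayley_mulVec (hG : IsRegularCoeff ν G) {s : ℝ} (hs : s ^ 2 = 1) (x : ℝ)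
    (v : Fin 2 → ℂ) :
    cayley ν G s x *ᵥ v - (s * (ν.real {x} / 2)) • (G x *ᵥ (cayley ν G s x *ᵥ v)) = v := by
  have hk := hG.jumpDet_ne_zero x
  have ht := hG.trace_eq_zero x
  have hs' : (s : ℂ) ^ 2 = 1 := by exact_mod_cast hs
  rw [cayley, smul_mulVec, mulVec_smul, smul_comm _ (jumpDet ν G x)⁻¹, ← smul_sub,
    inv_smul_eq_iff₀ hk]
  ext i
  fin_cases i <;>
  · simp [jumpDet, det_fin_two, ht, add_mulVec, smul_mulVec, vecHead, vecTail]
    ring_nf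
    simp only [hs']
    ring

theorem entrySum_mul_le {n : ℕ} (A B : Matrix (Fin n) (Fin n) ℂ) :
    entrySum (A * B) ≤ entrySum A * (n * entrySum B) := by
  unfold entrySum
  rw [Finset.sum_mul]
  refine Finset.sum_le_sum fun i _ => ?_
  calc ∑ j, ‖(A * B) i j‖ ≤ ∑ j : Fin n, ∑ k, ‖A i k‖ * entrySum B := by
        refine Finset.sum_le_sum fun j _ => ?_
        rw [mul_apply]
        refine (norm_sum_le _ _).trans (Finset.sum_le_sum fun k _ => ?_)
        rw [norm_mul]
        gcongr
        exact norm_entry_le B k j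
    _ = (∑ k, ‖A i k‖) * (n * entrySum B) := by
        rw [← Finset.sum_mul, Finset.sum_const, Finset.card_univ, Fintype.card_fin, nsmul_eq_mul]
        ring

theorem entrySum_smul {n : ℕ} (c : ℂ) (A : Matrix (Fin n) (Fin n) ℂ) :
    entrySum (c • A) = ‖c‖ * entrySum A := by
  simp [entrySum, Finset.mul_sum]

theorem entrySum_add_le {n : ℕ} (A B : Matrix (Fin n) (Fin n) ℂ) :
    entrySum (A + B) ≤ entrySum A + entrySum B := by
  simp only [entrySum, ← Finset.sum_add_distrib]
  exact Finset.sum_le_sum fun i _ => Finset.sum_le_sum fun j _ => norm_add_le _ _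

theorem norm_det_le (A : Matrix (Fin 2) (Fin 2) ℂ) : ‖A.det‖ ≤ 2 * entrySum A ^ 2 := by
  rw [det_fin_two]
  refine (norm_sub_le _ _).trans ?_
  rw [norm_mul, norm_mul]
  have h := norm_entry_le A
  have h0 := entrySum_nonneg A
  nlinarith [mul_le_mul (h 0 0) (h 1 1) (norm_nonneg _) h0,
    mul_le_mul (h 0 1) (h 1 0) (norm_nonneg _) h0]

/-- A small atom keeps the jump determinant away from zero: with `N = ν{x}/2` the product `N ·
entrySum G` is at most `1/2`, so the determinant term is at most `1/2` in modulus. Thus the inverse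
determinant is at most `2`, while the numerator is at most `2 + 1/2`. -/
theorem entrySum_cayley_le {s : ℝ} (hs : s ^ 2 = 1) {x : ℝ}
    (hx : ν.real {x} * entrySum (G x) ≤ 1) : entrySum (cayley ν G s x) ≤ 5 := by
  set N := ν.real {x} / 2 with hN
  have hN0 : 0 ≤ N := by positivity
  have hG0 := entrySum_nonneg (G x)
  have hNG : N * entrySum (G x) ≤ 1 / 2 := by
    rw [hN]
    linarith
  have habs : |s| = 1 :=
    (pow_eq_one_iff_of_nonneg (abs_nonneg s) two_ne_zero).1 (by rwa [sq_abs])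
  have hdet : ‖(N : ℂ) ^ 2 * (G x).det‖ ≤ 1 / 2 := by
    rw [norm_mul, norm_pow, Complex.norm_real, Real.norm_of_nonneg hN0]
    have := norm_det_le (G x)
    have h2 : N ^ 2 * ‖(G x).det‖ ≤ N ^ 2 * (2 * entrySum (G x) ^ 2) := by gcongr
    nlinarith [mul_nonneg hN0 hG0]
  have hk : 1 / 2 ≤ ‖jumpDet ν G x‖ := by
    have := norm_sub_norm_le (1 : ℂ) (-((N : ℂ) ^ 2 * (G x).det))
    rw [norm_neg, sub_neg_eq_add, norm_one] at this
    rw [jumpDet]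
    linarith
  rw [cayley, entrySum_smul, norm_inv]
  have h1 : entrySum (1 + ((s * N : ℝ) : ℂ) • G x) ≤ 5 / 2 := by
    refine (entrySum_add_le _ _).trans ?_
    rw [entrySum_smul, Complex.norm_real, norm_mul, Real.norm_eq_abs, habs, one_mul,
      Real.norm_of_nonneg hN0]
    have : entrySum (1 : Matrix (Fin 2) (Fin 2) ℂ) = 2 := by
      norm_num [entrySum, Fin.sum_univ_two]
    linarith
  have h2 : ‖jumpDet ν G x‖⁻¹ ≤ 2 := by
    rw [inv_le_comm₀ (by linarith) (by norm_num)]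
    linarith
  calc _ ≤ 2 * (5 / 2 : ℝ) := mul_le_mul h2 h1 (entrySum_nonneg _) (by norm_num)
    _ = 5 := by norm_num

variable [IsLocallyFiniteMeasure ν]

theorem measurable_real_singleton : Measurable fun x : ℝ => ν.real {x} := by
  have h := measurable_measure_prodMk_left (ν := ν) (measurableSet_diagonal (α := ℝ))
  refine Measurable.ennreal_toReal ?_
  convert h using 3 with x
  ext y
  simp [eq_comm]

theorem measurable_jumpDet (hG : ∀ i j, Measurable fun x => G x i j) :
    Measurable (jumpDet ν G) := by
  unfold jumpDet
  simp only [det_fin_two]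
  have := measurable_real_singleton (ν := ν)
  exact measurable_const.add (((Complex.measurable_ofReal.comp (this.div_const 2)).pow_const 2).mul
    (((hG 0 0).mul (hG 1 1)).sub ((hG 0 1).mul (hG 1 0))))

theorem measurable_cayley (hG : ∀ i j, Measurable fun x => G x i j) (s : ℝ) (i j : Fin 2) :
    Measurable fun x => cayley ν G s x i j := by
  have := measurable_real_singleton (ν := ν)
  simp only [cayley, Matrix.smul_apply, Matrix.add_apply, smul_eq_mul]
  exact (measurable_jumpDet hG).inv.mul (measurable_const.add
    ((Complex.measurable_ofReal.comp ((this.div_const 2).const_mul s)).mul (hG i j)))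

/-- On a compact interval `g dν` is a finite measure, so only finitely many points can have mass
above `1`. -/
theorem finite_atoms {g : ℝ → ℝ} (hg0 : ∀ x, 0 ≤ g x) (hg : LocallyIntegrable g ν) (R : ℝ) :
    {x ∈ Icc (-R) R | 1 < ν.real {x} * g x}.Finite := by
  have hgR := hg.integrableOn_isCompact (isCompact_Icc (a := -R) (b := R))
  set μ := (ν.restrict (Icc (-R) R)).withDensity fun x => ENNReal.ofReal (g x) with hμ
  have hfin : μ univ ≠ ∞ := by
    rw [hμ, withDensity_apply _ MeasurableSet.univ, Measure.restrict_univ]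
    exact (lintegral_ofReal_le_lintegral_enorm _).trans_lt hgR.2 |>.ne
  have hf := Measure.finite_const_le_meas_of_disjoint_iUnion μ (ε := 1) one_pos
    (As := fun x : ℝ => {x}) (fun x => measurableSet_singleton x) (fun i j hij => by simpa using hij)
    (ne_top_of_le_ne_top hfin (measure_mono (subset_univ _)))
  refine hf.subset fun x hx => ?_
  have hxR : ({x} : Set ℝ) ∩ Icc (-R) R = {x} := by
    simpa using hx.1
  simp only [mem_ofPred_eq]
  rw [hμ, withDensity_apply _ (measurableSet_singleton x),
    Measure.restrict_restrict (measurableSet_singleton x), hxR, lintegral_singleton]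
  have hνx : ν {x} = ENNReal.ofReal (ν.real {x}) := by
    rw [ofReal_measureReal measure_singleton_lt_top.ne]
  rw [hνx, ← ENNReal.ofReal_mul (hg0 x), ENNReal.one_le_ofReal, mul_comm]
  exact hx.2.le

theorem locallyIntegrable_of_le_off_finite {m g : ℝ → ℝ} (hm : Measurable m)
    (hg : LocallyIntegrable g ν)
    (hmg : ∀ R : ℝ, ∃ F : Set ℝ, F.Finite ∧ ∀ x ∈ Icc (-R) R, x ∉ F → ‖m x‖ ≤ g x) :
    LocallyIntegrable m ν := by
  rw [locallyIntegrable_iff_integrableOn_Icc]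
  intro R
  obtain ⟨F, hF, hFm⟩ := hmg R
  have h1 : IntegrableOn m (Icc (-R) R \ F) ν := by
    refine Integrable.mono' ((hg.integrableOn_isCompact isCompact_Icc).mono_set sdiff_subset)
      hm.aestronglyMeasurable ?_
    filter_upwards [ae_restrict_mem (measurableSet_Icc.diff hF.measurableSet)] with x hx
      using hFm x hx.1 hx.2
  have h2 : IntegrableOn m F ν := by
    rw [← biUnion_of_singleton F]
    exact (integrableOn_finite_biUnion hF).2 fun x _ =>
      integrableOn_singleton (hx := measure_singleton_lt_top)
  exact (h1.union h2).mono_set fun x hx => by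
    by_cases hxF : x ∈ F
    · exact Or.inr hxF
    · exact Or.inl ⟨hx, hxF⟩

theorem IsRegularCoeff.locallyIntegrable_entrySum (hG : IsRegularCoeff ν G) :
    LocallyIntegrable (fun x => entrySum (G x)) ν := by
  simp only [entrySum, Fin.sum_univ_two]
  have h := fun i j => (hG.locallyIntegrable i j).norm_fun
  exact ((h 0 0).add (h 0 1)).add ((h 1 0).add (h 1 1))

/-- Written for one-sided limits, the system has the coefficient `G * cayley`, so this is what the
Volterra theory needs. Off finitely many atoms of a compact interval the Cayley factor is bounded by
`5`, giving the bound `10` with the dimension; at the exceptional points any value is integrable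
since point masses are finite. -/
theorem IsRegularCoeff.locallyIntegrable_mul_cayley (hG : IsRegularCoeff ν G) {s : ℝ}
    (hs : s ^ 2 = 1) :
    LocallyIntegrable (fun x => entrySum (G x * cayley ν G s x)) ν := by
  have hm : Measurable fun x => entrySum (G x * cayley ν G s x) := by
    refine measurable_entrySum fun i j => ?_
    simp only [mul_apply]
    exact Finset.measurable_fun_sum _ fun k _ =>
      (hG.measurable i k).mul (measurable_cayley hG.measurable s k j)
  refine locallyIntegrable_of_le_off_finite (g := fun x => entrySum (G x) * 10) hm
    ?_ fun R => ⟨_, finite_atoms (fun x => entrySum_nonneg (G x)) hG.locallyIntegrable_entrySum R,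
      fun x hx hxF => ?_⟩
  · intro x
    obtain ⟨s, hs, hi⟩ := hG.locallyIntegrable_entrySum x
    exact ⟨s, hs, hi.mul_const 10⟩
  · have hx1 : ν.real {x} * entrySum (G x) ≤ 1 := by
      by_contra hc
      exact hxF ⟨hx, not_le.1 hc⟩
    rw [Real.norm_of_nonneg (entrySum_nonneg _)]
    refine (entrySum_mul_le _ _).trans ?_
    have := entrySum_cayley_le (ν := ν) (G := G) hs hx1
    refine mul_le_mul_of_nonneg_left ?_ (entrySum_nonneg _)
    push_cast
    linarith

end Cayley

/-! ### Uniqueness for one-sided initial values -/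

section Uniqueness

variable {ν : Measure ℝ} [IsLocallyFiniteMeasure ν] {G : ℝ → Matrix (Fin 2) (Fin 2) ℂ}

/-- On `S` the norm of `v` is bounded by `∫ ‖h‖` and dominated by its own integral against `entrySum
(A t) dν` along `r`; the Gronwall argument, applied to this norm extended by zero, gives the claim.
-/
theorem eq_zero_of_homogeneous_volterra {r : ℝ → ℝ → Prop}
    (hr : MeasurableSet {p : ℝ × ℝ | r p.1 p.2})
    (htrans : ∀ x y z, r x y → r y z → r x z) (hasymm : ∀ x y, r x y → ¬ r y x)
    {S : Set ℝ} (hS : MeasurableSet S) {A : ℝ → Matrix (Fin 2) (Fin 2) ℂ}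
    (hAm : ∀ i j, Measurable fun x => A x i j) (hA : IntegrableOn (fun t => entrySum (A t)) S ν)
    {v h : ℝ → Fin 2 → ℂ} (hh : IntegrableOn h S ν) (hhv : ∀ t ∈ S, h t = A t *ᵥ v t)
    (hv : ∀ x ∈ S, ‖v x‖ = ‖∫ t in S ∩ {t | r t x}, h t ∂ν‖) : ∀ x ∈ S, v x = 0 := by
  classical
  set μ := (ν.restrict S).withDensity fun t => ENNReal.ofReal (entrySum (A t)) with hμ
  have hd : Measurable fun t => ENNReal.ofReal (entrySum (A t)) :=
    (measurable_entrySum hAm).ennreal_ofReal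
  have hfin : μ univ ≠ ∞ := by
    rw [hμ, withDensity_apply _ MeasurableSet.univ, Measure.restrict_univ]
    exact (lintegral_ofReal_le_lintegral_enorm _).trans_lt hA.2 |>.ne
  set f : ℝ → ℝ≥0∞ := S.indicator fun x => ‖v x‖ₑ with hf
  have hvS : ∀ x ∈ S, ‖v x‖ₑ ≤ ∫⁻ t in S ∩ {t | r t x}, ‖h t‖ₑ ∂ν := by
    intro x hx
    rw [← ofReal_norm, hv x hx, ofReal_norm]
    exact enorm_integral_le_lintegral_enorm _
  intro x hx
  have h0 : f x = 0 := by
    refine eq_zero_of_le_lintegral (μ := μ) hr htrans hasymm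
      (C := ∫⁻ t in S, ‖h t‖ₑ ∂ν) hh.2.ne (fun y => ?_) (fun y => ?_)
      ((measure_mono (subset_univ _)).trans_lt hfin.lt_top)
    · by_cases hy : y ∈ S
      · simp only [hf, indicator_of_mem hy]
        exact (hvS y hy).trans (lintegral_mono_set inter_subset_left)
      · simp [hf, hy]
    · by_cases hy : y ∈ S
      · have hry := measurableSet_rel_left hr y
        rw [hμ, restrict_withDensity', Measure.restrict_restrict hry,
          lintegral_withDensity_eq_lintegral_mul_non_measurable _ hd (by simp), inter_comm]
        simp only [hf, indicator_of_mem hy]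
        refine (hvS y hy).trans (setLIntegral_mono' (hS.inter hry) fun t ht => ?_)
        rw [hhv t ht.1, Pi.mul_apply, indicator_of_mem ht.1, ← ofReal_norm, ← ofReal_norm,
          ← ENNReal.ofReal_mul (entrySum_nonneg _)]
        exact ENNReal.ofReal_le_ofReal (norm_mulVec_le _ _)
      · simp [hf, hy]
  simpa [hf, hx] using h0

theorem measurable_mul_cayley (hG : IsRegularCoeff ν G) (s : ℝ) (i j : Fin 2) :
    Measurable fun x => (G x * cayley ν G s x) i j := by
  simp only [mul_apply]
  exact Finset.measurable_fun_sum _ fun k _ =>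
    (hG.measurable i k).mul (measurable_cayley hG.measurable s k j)

/-- A solution of the homogeneous equation to the right of `a` which starts at `0` vanishes. -/
theorem IsPrim.eq_zero_of_right {d h : ℝ → Fin 2 → ℂ} (hG : IsRegularCoeff ν G)
    (H : IsPrim ν d h) {a : ℝ} (ha : d a + (ν.real {a} / 2) • h a = 0)
    (hh : ∀ t, a < t → h t = G t *ᵥ d t) {x : ℝ} (hx : a < x) : d x = 0 := by
  -- The left-hand limit determines the balanced value. In terms of left-hand limits the equation
  -- integrates over the open interval `(a, y)`, which is the strict order required by the Gronwall
  -- argument.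
  have hd : ∀ t, a < t → d t = cayley ν G 1 t *ᵥ (d t - (ν.real {t} / 2) • h t) := by
    intro t ht
    rw [hh t ht]
    have := cayley_mulVec_sub hG (one_pow 2) t (d t)
    rw [one_mul] at this
    exact this.symm
  have key := eq_zero_of_homogeneous_volterra (ν := ν) (r := (· < ·))
    (measurableSet_lt measurable_fst measurable_snd) (fun _ _ _ => lt_trans)
    (fun _ _ => lt_asymm) (measurableSet_Ioc (a := a) (b := x)) (measurable_mul_cayley hG 1)
    ((hG.locallyIntegrable_mul_cayley (one_pow 2)).integrableOn_of_bounded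
      (Metric.isBounded_Ioc a x))
    (v := fun t => d t - (ν.real {t} / 2) • h t) (h := h)
    (H.1.integrableOn_of_bounded (Metric.isBounded_Ioc a x))
    (fun t ht => by rw [← mulVec_mulVec, ← hd t ht.1, hh t ht.1])
    (fun y hy => by
      have := H.left_sub_right hy.1
      rw [ha, sub_zero] at this
      rw [this]
      congr 3
      ext t
      simp only [mem_Ioo, mem_inter_iff, mem_Ioc, mem_ofPred_eq]
      have := hy.2
      constructor
      · rintro ⟨h1, h2⟩
        exact ⟨⟨h1, by linarith⟩, h2⟩
      · rintro ⟨⟨h1, _⟩, h2⟩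
        exact ⟨h1, h2⟩) x ⟨hx, le_rfl⟩
  rw [hd x hx, key, mulVec_zero]

/-- A solution of the homogeneous equation to the left of `a` which ends at `0` vanishes. -/
theorem IsPrim.eq_zero_of_left {d h : ℝ → Fin 2 → ℂ} (hG : IsRegularCoeff ν G)
    (H : IsPrim ν d h) {a : ℝ} (ha : d a - (ν.real {a} / 2) • h a = 0)
    (hh : ∀ t, t < a → h t = G t *ᵥ d t) {x : ℝ} (hx : x < a) : d x = 0 := by
  have hs : (-1 : ℝ) ^ 2 = 1 := by norm_num
  have hd : ∀ t, t < a → d t = cayley ν G (-1) t *ᵥ (d t + (ν.real {t} / 2) • h t) := by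
    intro t ht
    rw [hh t ht]
    have := cayley_mulVec_sub hG hs t (d t)
    rw [neg_one_mul, neg_smul, sub_neg_eq_add] at this
    exact this.symm
  have key := eq_zero_of_homogeneous_volterra (ν := ν) (r := (· > ·))
    (measurableSet_lt measurable_snd measurable_fst) (fun _ _ _ => gt_trans)
    (fun _ _ => lt_asymm) (measurableSet_Ico (a := x) (b := a)) (measurable_mul_cayley hG (-1))
    ((hG.locallyIntegrable_mul_cayley hs).integrableOn_of_bounded
      (Metric.isBounded_Ico x a))
    (v := fun t => d t + (ν.real {t} / 2) • h t) (h := h)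
    (H.1.integrableOn_of_bounded (Metric.isBounded_Ico x a))
    (fun t ht => by rw [← mulVec_mulVec, ← hd t ht.2, hh t ht.2])
    (fun y hy => by
      have := H.left_sub_right hy.2
      rw [ha, zero_sub] at this
      rw [← norm_neg, this]
      congr 3
      ext t
      simp only [mem_Ioo, mem_inter_iff, mem_Ico, mem_ofPred_eq]
      have := hy.1
      constructor
      · rintro ⟨h1, h2⟩
        exact ⟨⟨by linarith, h2⟩, h1⟩
      · rintro ⟨⟨h1, h2⟩, h3⟩
        exact ⟨h3, h2⟩) x ⟨le_rfl, hx⟩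
  rw [hd x hx, key, mulVec_zero]

end Uniqueness

/-! ### Existence of homogeneous solutions -/

section Existence

variable {ν : Measure ℝ} [IsLocallyFiniteMeasure ν] {G : ℝ → Matrix (Fin 2) (Fin 2) ℂ}

/-- Restricting the measure to `S` makes the set of points before `x` bounded, locally uniformly in
`x`. This yields integrability of the kernel and a locally bounded solution. -/
theorem exists_volterra_bounded {r : ℝ → ℝ → Prop} (hr : MeasurableSet {p : ℝ × ℝ | r p.1 p.2})
    (htrans : ∀ x y z, r x y → r y z → r x z) (hasymm : ∀ x y, r x y → ¬ r y x)
    {S : Set ℝ}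
    (hrS : ∀ R : ℝ, ∃ R' : ℝ, ∀ x ∈ Icc (-R) R, {t | r t x} ∩ S ⊆ Icc (-R') R')
    {A : ℝ → Matrix (Fin 2) (Fin 2) ℂ} (hAm : ∀ i j, Measurable fun x => A x i j)
    (hA : LocallyIntegrable (fun t => entrySum (A t)) ν) (c : Fin 2 → ℂ) :
    ∃ v : ℝ → Fin 2 → ℂ, Measurable v ∧
      (∀ x, v x = c + ∫ t in {t | r t x} ∩ S, A t *ᵥ v t ∂ν) ∧
      ∀ R : ℝ, ∃ C, ∀ x ∈ Icc (-R) R, ‖v x‖ ≤ C := by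
  have hrm := measurableSet_rel_left hr
  have hint : ∀ x, IntegrableOn (fun t => entrySum (A t)) {t | r t x} (ν.restrict S) := by
    intro x
    obtain ⟨R', hR'⟩ := hrS |x|
    rw [IntegrableOn, Measure.restrict_restrict (hrm x)]
    exact (hA.integrableOn_isCompact isCompact_Icc).mono_set (hR' x ⟨neg_abs_le x, le_abs_self x⟩)
  obtain ⟨v, hvm, hv, hvb⟩ := exists_volterra hr htrans hasymm hAm hint c
  refine ⟨v, hvm, fun x => ?_, fun R => ?_⟩
  · rw [hv x, Measure.restrict_restrict (hrm x)]
  · obtain ⟨R', hR'⟩ := hrS R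
    refine ⟨‖c‖ * Real.exp (∫ t in Icc (-R') R', entrySum (A t) ∂ν), fun x hx => ?_⟩
    refine (hvb x).trans ?_
    refine mul_le_mul_of_nonneg_left (Real.exp_le_exp.2 ?_) (norm_nonneg c)
    rw [Measure.restrict_restrict (hrm x)]
    exact setIntegral_mono_set (hA.integrableOn_isCompact isCompact_Icc)
      (Eventually.of_forall fun t => entrySum_nonneg _) (hR' x hx).eventuallyLE

/-- Solvability on the whole line of the initial value problem for `u' = G u dν`. -/
theorem exists_isPrim_homogeneous (hG : IsRegularCoeff ν G) (c : Fin 2 → ℂ) :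
    ∃ u : ℝ → Fin 2 → ℂ, IsPrim ν u (fun t => G t *ᵥ u t) ∧
      u 0 - (ν.real {0} / 2) • (G 0 *ᵥ u 0) = c := by
  have hs : (-1 : ℝ) ^ 2 = 1 := by norm_num
  -- On `[0, ∞)` the unknown `v` is the left-hand limit of `u`, and on `(-∞, 0)` the unknown `y`
  -- below is the right-hand limit. The atom at `0` belongs to the right half, so both halves start
  -- from `c`, the left-hand limit at `0`.
  obtain ⟨v, hvm, hv, hvb⟩ := exists_volterra_bounded (ν := ν) (r := (· < ·))
    (measurableSet_lt measurable_fst measurable_snd) (fun _ _ _ => lt_trans)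
    (fun _ _ => lt_asymm) (S := Ici 0)
    (fun R => ⟨|R|, fun x hx t ht => ⟨by
      have : (0 : ℝ) ≤ t := ht.2
      linarith [abs_nonneg R], by
      have : t < x := ht.1
      linarith [hx.2, le_abs_self R]⟩⟩)
    (measurable_mul_cayley hG 1) (hG.locallyIntegrable_mul_cayley (one_pow 2)) c
  obtain ⟨y, hym, hy, hyb⟩ := exists_volterra_bounded (ν := ν) (r := (· > ·))
    (A := fun x => -(G x * cayley ν G (-1) x))
    (measurableSet_lt measurable_snd measurable_fst) (fun _ _ _ => gt_trans)
    (fun _ _ => lt_asymm) (S := Iio 0)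
    (fun R => ⟨|R|, fun x hx t ht => ⟨by
      have : t > x := ht.1
      linarith [hx.1, le_abs_self R], by
      have : t < 0 := ht.2
      linarith [abs_nonneg R]⟩⟩)
    (fun i j => (measurable_mul_cayley hG (-1) i j).neg)
    (by
      have := hG.locallyIntegrable_mul_cayley hs
      simpa [entrySum] using this) c
  set u : ℝ → Fin 2 → ℂ := fun x =>
    if 0 ≤ x then cayley ν G 1 x *ᵥ v x else cayley ν G (-1) x *ᵥ y x with hu
  have hum : Measurable u := Measurable.ite measurableSet_Ici
    (measurable_mulVec (measurable_cayley hG.measurable 1) hvm)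
    (measurable_mulVec (measurable_cayley hG.measurable (-1)) hym)
  have hpos : ∀ x, 0 ≤ x → u x = cayley ν G 1 x *ᵥ v x := fun x hx => by simp [hu, hx]
  have hneg : ∀ x, x < 0 → u x = cayley ν G (-1) x *ᵥ y x := fun x hx => by
    simp [hu, not_le.2 hx]
  have hvx : ∀ x, 0 ≤ x → u x - (ν.real {x} / 2) • (G x *ᵥ u x) = v x := fun x hx => by
    have := sub_cayley_mulVec hG (one_pow 2) x (v x)
    rw [one_mul] at this
    rw [hpos x hx, this]
  have hyx : ∀ x, x < 0 → u x + (ν.real {x} / 2) • (G x *ᵥ u x) = y x := fun x hx => by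
    have := sub_cayley_mulVec hG hs x (y x)
    rw [neg_one_mul, neg_smul, sub_neg_eq_add] at this
    rw [hneg x hx, this]
  have hh : LocallyIntegrable (fun t => G t *ᵥ u t) ν := by
    rw [locallyIntegrable_iff_integrableOn_Icc]
    intro R
    obtain ⟨C, hC⟩ := hvb R
    obtain ⟨D, hD⟩ := hyb R
    have i1 := (hG.locallyIntegrable_mul_cayley (one_pow 2)).integrableOn_isCompact
      (isCompact_Icc (a := -R) (b := R))
    have i2 := (hG.locallyIntegrable_mul_cayley hs).integrableOn_isCompact
      (isCompact_Icc (a := -R) (b := R))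
    refine Integrable.mono' ((i1.mul_const |C|).add (i2.mul_const |D|))
      (measurable_mulVec hG.measurable hum).aestronglyMeasurable ?_
    filter_upwards [ae_restrict_mem measurableSet_Icc] with t ht
    have n1 := entrySum_nonneg (G t * cayley ν G 1 t)
    have n2 := entrySum_nonneg (G t * cayley ν G (-1) t)
    simp only [Pi.add_apply]
    rcases le_or_gt 0 t with h0 | h0
    · rw [hpos t h0, mulVec_mulVec]
      refine (norm_mulVec_le _ _).trans ?_
      have := mul_le_mul_of_nonneg_left ((hC t ht).trans (le_abs_self C)) n1
      linarith [mul_nonneg n2 (abs_nonneg D)]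
    · rw [hneg t h0, mulVec_mulVec]
      refine (norm_mulVec_le _ _).trans ?_
      have := mul_le_mul_of_nonneg_left ((hD t ht).trans (le_abs_self D)) n2
      linarith [mul_nonneg n1 (abs_nonneg C)]
  have hv0 : v 0 = c := by
    have := hv 0
    have e : {t : ℝ | t < 0} ∩ Ici 0 = ∅ := by
      ext t
      simp
    rw [e] at this
    simpa using this
  -- `balPrim` vanishes to the right of `0`, so the constant must be the right-hand limit of `u` at
  -- `0`: the left-hand limit `c` plus the full jump.
  refine ⟨u, ⟨hh, c + ν.real {0} • (G 0 *ᵥ u 0), fun x => ?_⟩, by rw [hvx 0 le_rfl, hv0]⟩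
  rcases lt_trichotomy x 0 with hx | rfl | hx
  · have h1 : u x = y x - (ν.real {x} / 2) • (G x *ᵥ u x) := by rw [← hyx x hx]; abel
    have h2 : y x = c - ∫ t in Ioo x 0, G t *ᵥ u t ∂ν := by
      rw [hy x, sub_eq_add_neg, ← integral_neg]
      congr 1
      have e : {t : ℝ | t > x} ∩ Iio 0 = Ioo x 0 := rfl
      rw [e]
      refine setIntegral_congr_fun measurableSet_Ioo fun t ht => ?_
      rw [neg_mulVec, ← mulVec_mulVec, hneg t ht.2]
    have h3 := setIntegral_Ioc_eq_Ioo_add hh hx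
    rw [balPrim, intervalIntegral.integral_symm, intervalIntegral.integral_of_le hx.le, h3]
    nth_rewrite 1 [h1]
    rw [h2]
    module
  · have h1 : u 0 = v 0 + (ν.real {0} / 2) • (G 0 *ᵥ u 0) := by rw [← hvx 0 le_rfl]; abel
    rw [balPrim, intervalIntegral.integral_same]
    nth_rewrite 1 [h1]
    rw [hv0]
    module
  · have h1 : u x = v x + (ν.real {x} / 2) • (G x *ᵥ u x) := by rw [← hvx x hx.le]; abel
    have h2 : v x = c + ∫ t in Ico 0 x, G t *ᵥ u t ∂ν := by
      rw [hv x]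
      congr 1
      have e : {t : ℝ | t < x} ∩ Ici 0 = Ico 0 x := by
        ext t
        exact and_comm
      rw [e]
      refine setIntegral_congr_fun measurableSet_Ico fun t ht => ?_
      rw [← mulVec_mulVec, hpos t ht.1]
    have h3 := setIntegral_Ioc_eq_Ioo_add hh hx
    have h4 := setIntegral_Ico_eq_Ioo_add hh hx
    rw [balPrim, intervalIntegral.integral_of_le hx.le, h3]
    nth_rewrite 1 [h1]
    rw [h2, h4]
    module

end Existence

/-! ### The two-dimensional space of homogeneous solutions -/

section Uniqueness

variable {ν : Measure ℝ} [IsLocallyFiniteMeasure ν] {G : ℝ → Matrix (Fin 2) (Fin 2) ℂ}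

/-- A solution of the homogeneous equation which vanishes somewhere is identically zero. -/
theorem IsPrim.eq_zero_of_apply_eq_zero {u : ℝ → Fin 2 → ℂ} (hG : IsRegularCoeff ν G)
    (H : IsPrim ν u fun t => G t *ᵥ u t) {a : ℝ} (ha : u a = 0) (x : ℝ) : u x = 0 := by
  rcases lt_trichotomy x a with hx | rfl | hx
  · exact H.eq_zero_of_left hG (by simp [ha]) (fun _ _ => rfl) hx
  · exact ha
  · exact H.eq_zero_of_right hG (by simp [ha]) (fun _ _ => rfl) hx

theorem IsPrim.const_smul {u h : ℝ → Fin 2 → ℂ} (H : IsPrim ν u h) (c : ℂ) :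
    IsPrim ν (fun x => c • u x) fun x => c • h x := by
  obtain ⟨hh, d, hd⟩ := H
  refine ⟨hh.smul c, c • d, fun x => ?_⟩
  show c • u x = _
  rw [hd, balPrim, balPrim, intervalIntegral.integral_smul, smul_add, smul_sub, smul_comm]

/-- The space of solutions of the homogeneous equation `u' = G u dν`. -/
def solSpace (ν : Measure ℝ) [IsLocallyFiniteMeasure ν] (G : ℝ → Matrix (Fin 2) (Fin 2) ℂ) :
    Submodule ℂ (ℝ → Fin 2 → ℂ) where
  carrier := {u | IsPrim ν u fun t => G t *ᵥ u t}
  add_mem' {u v} hu hv := by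
    have := IsPrim.add hu hv
    simp only [← mulVec_add] at this
    exact this
  zero_mem' := by
    refine ⟨by simpa using locallyIntegrable_zero, 0, fun x => ?_⟩
    simp [balPrim]
  smul_mem' c u hu := by
    have := IsPrim.const_smul hu c
    simp only [← mulVec_smul] at this
    exact this

/-- Evaluation of solutions at a point. -/
def evalSol (ν : Measure ℝ) [IsLocallyFiniteMeasure ν] (G : ℝ → Matrix (Fin 2) (Fin 2) ℂ) (a : ℝ) :
    solSpace ν G →ₗ[ℂ] (Fin 2 → ℂ) :=
  (LinearMap.proj a).comp (solSpace ν G).subtype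

theorem evalSol_injective (hG : IsRegularCoeff ν G) (a : ℝ) :
    Function.Injective (evalSol ν G a) := by
  rw [injective_iff_map_eq_zero]
  intro u hu
  ext1
  funext x
  exact IsPrim.eq_zero_of_apply_eq_zero hG u.2 hu x

theorem finiteDimensional_solSpace (hG : IsRegularCoeff ν G) :
    FiniteDimensional ℂ (solSpace ν G) :=
  FiniteDimensional.of_injective (evalSol ν G 0) (evalSol_injective hG 0)

/-- At `0` one prescribes the left-hand limit corresponding to the wanted balanced value. This fixes
the dimension of the solution space, and at any other point injectivity then implies surjectivity.
-/
theorem evalSol_surjective (hG : IsRegularCoeff ν G) (a : ℝ) :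
    Function.Surjective (evalSol ν G a) := by
  have := finiteDimensional_solSpace hG
  have hsurj : Function.Surjective (evalSol ν G 0) := by
    intro c
    obtain ⟨u, hu, h0⟩ := exists_isPrim_homogeneous hG (c - (ν.real {0} / 2) • (G 0 *ᵥ c))
    refine ⟨⟨u, hu⟩, ?_⟩
    have h1 := cayley_mulVec_sub hG (s := 1) (by norm_num) 0 (u 0)
    rw [one_mul, h0] at h1
    have h2 := cayley_mulVec_sub hG (s := 1) (by norm_num) 0 c
    rw [one_mul, h1] at h2
    exact h2
  have hdim := (LinearEquiv.ofBijective _ ⟨evalSol_injective hG 0, hsurj⟩).finrank_eq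
  exact (LinearMap.injective_iff_surjective_of_finrank_eq_finrank hdim).1 (evalSol_injective hG a)

/-- Solvability of the initial value problem with a prescribed balanced value at a point. -/
theorem exists_isPrim_homogeneous_apply (hG : IsRegularCoeff ν G) (a : ℝ) (c : Fin 2 → ℂ) :
    ∃ u : ℝ → Fin 2 → ℂ, IsPrim ν u (fun t => G t *ᵥ u t) ∧ u a = c := by
  obtain ⟨u, hu⟩ := evalSol_surjective hG a c
  exact ⟨u, u.2, hu⟩

end Uniqueness

/-! ### The product rule -/

section Product

variable {ν : Measure ℝ} [IsLocallyFiniteMeasure ν]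

/-- The product rule for balanced antiderivatives. -/
theorem IsPrim.mul_sub_mul {u h v k : ℝ → ℂ} (H : IsPrim ν u h) (K : IsPrim ν v k) {a b : ℝ}
    (hab : a ≤ b) :
    (u b + (ν.real {b} / 2 : ℝ) * h b) * (v b + (ν.real {b} / 2 : ℝ) * k b)
      - (u a + (ν.real {a} / 2 : ℝ) * h a) * (v a + (ν.real {a} / 2 : ℝ) * k a)
      = ∫ t in Ioc a b, (u t * k t + h t * v t) ∂ν := by
  set U := u a + (ν.real {a} / 2 : ℝ) * h a with hU
  set V := v a + (ν.real {a} / 2 : ℝ) * k a with hV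
  have hub : u b + (ν.real {b} / 2 : ℝ) * h b = U + ∫ t in Ioc a b, h t ∂ν := by
    have := H.right_sub_right hab
    simp only [Complex.real_smul] at this
    rw [← this]
    ring
  have hvb : v b + (ν.real {b} / 2 : ℝ) * k b = V + ∫ t in Ioc a b, k t ∂ν := by
    have := K.right_sub_right hab
    simp only [Complex.real_smul] at this
    rw [← this]
    ring
  have hhI := H.1.integrableOn_of_bounded (Metric.isBounded_Ioc a b)
  have hkI := K.1.integrableOn_of_bounded (Metric.isBounded_Ioc a b)
  have key1 := setIntegral_Ioc_mul_setIntegral_Ioc hhI hkI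
  have bd : ∀ {f g : ℝ → ℂ}, IsPrim ν f g → ∀ R : ℝ, ∃ C, ∀ x ∈ Icc (-R) R, ‖f x‖ ≤ C :=
    fun F R => (exists_norm_le_of_locallyBoundedVariationOn F.locallyBoundedVariationOn R).imp
      fun C hC => hC.2
  have iuk : IntegrableOn (fun t => u t * k t) (Ioc a b) ν :=
    (locallyIntegrable_mul_of_bounded
      (measurable_of_locallyBoundedVariationOn_complex H.locallyBoundedVariationOn) (bd H)
      K.1).integrableOn_of_bounded (Metric.isBounded_Ioc a b)
  have ihv : IntegrableOn (fun t => h t * v t) (Ioc a b) ν := by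
    have := (locallyIntegrable_mul_of_bounded
      (measurable_of_locallyBoundedVariationOn_complex K.locallyBoundedVariationOn) (bd K)
      H.1).integrableOn_of_bounded (Metric.isBounded_Ioc a b)
    simpa only [mul_comm] using this
  have hIoc : ∀ {f g : ℝ → ℂ}, IsPrim ν f g → ∀ t, t ∈ Ioc a b → ∫ s in Ioc a t, g s ∂ν
      = f t + (ν.real {t} / 2 : ℝ) * g t - (f a + (ν.real {a} / 2 : ℝ) * g a) :=
    fun F t ht => by
      have := F.right_sub_right ht.1.le
      simp only [Complex.real_smul] at this
      rw [← this]
  have hIoo : ∀ {f g : ℝ → ℂ}, IsPrim ν f g → ∀ t, t ∈ Ioc a b → ∫ s in Ioo a t, g s ∂ν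
      = f t - (ν.real {t} / 2 : ℝ) * g t - (f a + (ν.real {a} / 2 : ℝ) * g a) :=
    fun F t ht => by
      have := F.left_sub_right ht.1
      simp only [Complex.real_smul] at this
      rw [← this]
  set d : ℝ → ℂ := fun t => (ν.real {t} / 2 : ℝ) with hd
  have hdm : Measurable d :=
    Complex.measurable_ofReal.comp ((measurable_real_singleton (ν := ν)).div_const 2)
  have hvm := measurable_of_locallyBoundedVariationOn_complex K.locallyBoundedVariationOn
  -- The bracket is the integral of `k` over an open subinterval, hence bounded.
  have i3 : IntegrableOn (fun t => (v t - d t * k t - V) * h t) (Ioc a b) ν := by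
    refine Integrable.bdd_mul (c := ∫ s in Ioc a b, ‖k s‖ ∂ν) hhI
      ((hvm.aestronglyMeasurable.sub (hdm.aestronglyMeasurable.mul hkI.1)).sub
        aestronglyMeasurable_const) ?_
    filter_upwards [ae_restrict_mem measurableSet_Ioc] with t ht
    rw [← hIoo K t ht]
    exact (norm_integral_le_integral_norm _).trans (setIntegral_mono_set hkI.norm
      (Eventually.of_forall fun s => norm_nonneg _)
      (Ioo_subset_Ioc_self.trans (Ioc_subset_Ioc_right ht.2)).eventuallyLE)
  -- This diagonal term enters the two halves of Fubini's formula with opposite signs and cancels.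
  -- Its integrability is not evident directly and is obtained as a difference of integrable
  -- functions.
  have i5 : IntegrableOn (fun t => d t * k t * h t) (Ioc a b) ν := by
    refine ((ihv.sub i3).sub (hhI.const_mul V)).congr (Eventually.of_forall fun t => ?_)
    simp only [Pi.sub_apply]
    ring
  have i6 : IntegrableOn (fun t => h t * v t - d t * k t * h t) (Ioc a b) ν := ihv.sub i5
  have i7 : IntegrableOn (fun t => u t * k t + d t * k t * h t) (Ioc a b) ν := iuk.add i5
  have e1 : ∫ s in Ioc a b, h s * (∫ t in Ioo a s, k t ∂ν) ∂ν
      = (∫ t in Ioc a b, h t * v t ∂ν) - (∫ t in Ioc a b, d t * k t * h t ∂ν)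
        - V * ∫ t in Ioc a b, h t ∂ν := by
    rw [← integral_const_mul, ← integral_sub ihv i5, ← integral_sub i6 (hhI.const_mul V)]
    refine setIntegral_congr_fun measurableSet_Ioc fun t ht => ?_
    simp only [hIoo K t ht, ← hV]
    ring
  have e2 : ∫ t in Ioc a b, k t * (∫ s in Ioc a t, h s ∂ν) ∂ν
      = (∫ t in Ioc a b, u t * k t ∂ν) + (∫ t in Ioc a b, d t * k t * h t ∂ν)
        - U * ∫ t in Ioc a b, k t ∂ν := by
    rw [← integral_const_mul, ← integral_add iuk i5, ← integral_sub i7 (hkI.const_mul U)]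
    refine setIntegral_congr_fun measurableSet_Ioc fun t ht => ?_
    simp only [hIoc H t ht, ← hU]
    ring
  rw [integral_add iuk ihv, hub, hvb]
  rw [e1, e2] at key1
  linear_combination key1

end Product

/-! ### Densities and equality of local measures -/

section RadonNikodym

variable {μ ν : Measure ℝ} [IsLocallyFiniteMeasure μ] [IsLocallyFiniteMeasure ν]

theorem locallyIntegrable_rnDeriv (μ ν : Measure ℝ) [IsLocallyFiniteMeasure μ] :
    LocallyIntegrable (fun x => (μ.rnDeriv ν x).toReal) ν := by
  rw [locallyIntegrable_iff_integrableOn_Icc]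
  intro R
  refine integrable_toReal_of_lintegral_ne_top
    (Measure.measurable_rnDeriv _ _).aemeasurable ?_
  exact ((Measure.setLIntegral_rnDeriv_le _).trans_lt isCompact_Icc.measure_lt_top).ne

theorem locallyIntegrable_rnDeriv_mul (hμ : μ ≪ ν) {g : ℝ → ℂ} (hg : LocallyIntegrable g μ) :
    LocallyIntegrable (fun x => ((μ.rnDeriv ν x).toReal : ℂ) * g x) ν := by
  rw [locallyIntegrable_iff_integrableOn_Icc] at hg ⊢
  intro R
  have h := (integrable_indicator_iff measurableSet_Icc).2 (hg R)
  rw [← integrable_rnDeriv_smul_iff hμ] at h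
  rw [← integrable_indicator_iff measurableSet_Icc]
  refine h.congr (Eventually.of_forall fun x => ?_)
  by_cases hx : x ∈ Icc (-R) R <;> simp [hx]

theorem integral_rnDeriv_mul (hμ : μ ≪ ν) (g : ℝ → ℂ) :
    ∫ x, ((μ.rnDeriv ν x).toReal : ℂ) * g x ∂ν = ∫ x, g x ∂μ := by
  rw [← integral_rnDeriv_smul hμ]
  simp

/-- At an atom of `ν` the Radon-Nikodym derivative is the quotient of the masses. -/
theorem real_singleton_mul_rnDeriv {x : ℝ} (hx : ν {x} ≠ 0) :
    ν.real {x} * (μ.rnDeriv ν x).toReal = μ.real {x} := by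
  have h := congrArg (fun m : Measure ℝ => m {x}) (μ.haveLebesgueDecomposition_add ν)
  simp only [Measure.add_apply] at h
  obtain ⟨s, hs, h1, h2⟩ := μ.mutuallySingular_singularPart ν
  have hxs : x ∈ s := by
    by_contra hc
    exact hx (measure_mono_null (by simpa using hc) h2)
  have h3 : μ.singularPart ν {x} = 0 := measure_mono_null (by simpa using hxs) h1
  rw [h3, zero_add, withDensity_apply _ (measurableSet_singleton x), lintegral_singleton] at h
  rw [Measure.real, Measure.real, h, ENNReal.toReal_mul, mul_comm]

/-- Both measures have locally integrable densities with respect to their sum, and smooth test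
functions separate such densities. -/
theorem measure_ext_of_isTest (h : ∀ φ, IsTest φ → ∫ x, φ x ∂μ = ∫ x, φ x ∂ν) : μ = ν := by
  set σ := μ + ν with hσ
  have hσl : IsLocallyFiniteMeasure σ := ⟨fun x => by
    refine ⟨Icc (x - 1) (x + 1), Icc_mem_nhds (by linarith) (by linarith), ?_⟩
    rw [hσ, Measure.add_apply]
    exact ENNReal.add_lt_top.2 ⟨isCompact_Icc.measure_lt_top, isCompact_Icc.measure_lt_top⟩⟩
  have hμ : μ ≪ σ := Measure.absolutelyContinuous_of_le (Measure.le_add_right le_rfl)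
  have hν : ν ≪ σ := Measure.absolutelyContinuous_of_le (Measure.le_add_left le_rfl)
  have lμ := (locallyIntegrable_rnDeriv μ σ)
  have lν := (locallyIntegrable_rnDeriv ν σ)
  have key : ∀ᵐ x ∂σ, (μ.rnDeriv σ x).toReal = (ν.rnDeriv σ x).toReal := by
    refine ae_eq_of_integral_contDiff_smul_eq lμ lν fun g hg hs => ?_
    have h1 := h _ (isTest_ofReal hg hs)
    rw [integral_complex_ofReal, integral_complex_ofReal] at h1
    have h2 : ∫ x, g x ∂μ = ∫ x, g x ∂ν := by exact_mod_cast h1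
    rw [← integral_rnDeriv_smul hμ, ← integral_rnDeriv_smul hν] at h2
    simpa [mul_comm] using h2
  rw [← Measure.withDensity_rnDeriv_eq μ σ hμ, ← Measure.withDensity_rnDeriv_eq ν σ hν]
  refine withDensity_congr_ae ?_
  filter_upwards [key, μ.rnDeriv_lt_top σ, ν.rnDeriv_lt_top σ] with x hx h1 h2
  exact (ENNReal.toReal_eq_toReal_iff' h1.ne h2.ne).1 hx

/-- Half of the uniqueness of the Jordan decomposition: restricted to a set carrying `μ` and null
for `ν`, the identity reads `μ + ν' = μ'`. -/
theorem le_of_add_eq_add {μ ν μ' ν' : Measure ℝ} (h : μ + ν' = μ' + ν) (hs : μ ⟂ₘ ν) : μ ≤ μ' := by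
  obtain ⟨s, hms, h1, h2⟩ := hs
  refine Measure.le_iff.2 fun t ht => ?_
  have e1 : μ t = μ (t \ s) := by
    refine le_antisymm ?_ (measure_mono sdiff_subset)
    calc μ t ≤ μ (t ∩ s) + μ (t \ s) := measure_le_inter_add_sdiff μ t s
      _ ≤ 0 + μ (t \ s) := by
          gcongr
          exact (measure_mono inter_subset_right).trans h1.le
      _ = μ (t \ s) := zero_add _
  have e2 : ν (t \ s) = 0 := measure_mono_null (fun x hx => hx.2) h2
  have e3 := congrArg (fun m : Measure ℝ => m (t \ s)) h
  simp only [Measure.add_apply, e2, add_zero] at e3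
  rw [e1]
  calc μ (t \ s) ≤ μ (t \ s) + ν' (t \ s) := le_self_add
    _ = μ' (t \ s) := e3
    _ ≤ μ' t := measure_mono sdiff_subset

end RadonNikodym

/-! ### Periodicity of the measures -/

section Periodic

theorem IsTest.comp_add_right {φ : ℝ → ℂ} (hφ : IsTest φ) (ω : ℝ) : IsTest fun x => φ (x + ω) :=
  ⟨hφ.1.comp (contDiff_id.add contDiff_const),
    hφ.2.comp_homeomorph (Homeomorph.addRight ω)⟩

theorem OrderZeroDist.HasPeriod.neg {r : OrderZeroDist} {ω : ℝ} (h : r.HasPeriod ω) :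
    r.HasPeriod (-ω) := by
  intro φ hφ
  have := h _ (hφ.comp_add_right (-ω))
  simp only [add_neg_cancel_right] at this
  exact this.symm

theorem isLocallyFiniteMeasure_map_add {μ : Measure ℝ} [IsLocallyFiniteMeasure μ] (ω : ℝ) :
    IsLocallyFiniteMeasure (μ.map (· + ω)) := ⟨fun x => by
  refine ⟨Icc (x - 1) (x + 1), Icc_mem_nhds (by linarith) (by linarith), ?_⟩
  rw [(measurableEmbedding_addRight ω).map_apply, preimage_add_const_Icc]
  exact isCompact_Icc.measure_lt_top⟩

/-- A translate of a Jordan decomposition is again one, and periodicity says that it decomposes the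
same distribution; uniqueness identifies the parts. This turns a condition on test functions into
invariance of measures. -/
theorem OrderZeroDist.HasPeriod.map_pos_neg {r : OrderZeroDist} {ω : ℝ} (h : r.HasPeriod ω) :
    r.pos.map (· + ω) = r.pos ∧ r.neg.map (· + ω) = r.neg := by
  have := r.pos_locallyFinite
  have := r.neg_locallyFinite
  have := isLocallyFiniteMeasure_map_add (μ := r.pos) ω
  have := isLocallyFiniteMeasure_map_add (μ := r.neg) ω
  have hemb := measurableEmbedding_addRight ω
  have hadd : ∀ (μ ν : Measure ℝ) [IsLocallyFiniteMeasure μ] [IsLocallyFiniteMeasure ν],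
      IsLocallyFiniteMeasure (μ + ν) := fun μ ν _ _ => ⟨fun x => by
    refine ⟨Icc (x - 1) (x + 1), Icc_mem_nhds (by linarith) (by linarith), ?_⟩
    rw [Measure.add_apply]
    exact ENNReal.add_lt_top.2 ⟨isCompact_Icc.measure_lt_top, isCompact_Icc.measure_lt_top⟩⟩
  have key : r.pos + r.neg.map (· + ω) = r.pos.map (· + ω) + r.neg := by
    have := hadd r.pos (r.neg.map (· + ω))
    have := hadd (r.pos.map (· + ω)) r.neg
    refine measure_ext_of_isTest fun φ hφ => ?_
    have hi : ∀ (μ : Measure ℝ) [IsLocallyFiniteMeasure μ], Integrable φ μ := fun μ _ =>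
      hφ.continuous.integrable_of_hasCompactSupport hφ.2
    rw [integral_add_measure (hi _) (hi _), integral_add_measure (hi _) (hi _), hemb.integral_map,
      hemb.integral_map]
    have := h φ hφ
    simp only [OrderZeroDist.integral] at this
    linear_combination this
  have hsing : r.pos.map (· + ω) ⟂ₘ r.neg.map (· + ω) := by
    obtain ⟨s, hs, h1, h2⟩ := r.mutuallySingular
    refine ⟨(· + -ω) ⁻¹' s, (measurable_add_const _) hs, ?_, ?_⟩
    · rw [hemb.map_apply, ← preimage_comp]
      convert h1 using 2
      ext x
      simp
    · rw [hemb.map_apply, ← preimage_compl, ← preimage_comp]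
      convert h2 using 2
      ext x
      simp
  constructor
  · exact le_antisymm (le_of_add_eq_add (by rw [← key]) hsing)
      (le_of_add_eq_add key r.mutuallySingular)
  · refine le_antisymm (le_of_add_eq_add (ν := r.pos.map (· + ω)) (ν' := r.pos) ?_ hsing.symm)
      (le_of_add_eq_add (ν := r.pos) (ν' := r.pos.map (· + ω)) ?_ r.mutuallySingular.symm)
    · rw [add_comm, key, add_comm]
    · rw [add_comm, ← key, add_comm]

theorem rnDeriv_add_period {μ ν : Measure ℝ} [IsLocallyFiniteMeasure μ] [IsLocallyFiniteMeasure ν]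
    {ω : ℝ} (hμ : μ.map (· + ω) = μ) (hν : ν.map (· + ω) = ν) :
    ∀ᵐ x ∂ν, μ.rnDeriv ν (x + ω) = μ.rnDeriv ν x := by
  have := (measurableEmbedding_addRight ω).rnDeriv_map μ ν
  rw [hμ, hν] at this
  exact this

end Periodic

/-! ### Densities of the coefficients with respect to one base measure -/

section Data

instance (r : OrderZeroDist) : IsLocallyFiniteMeasure r.pos := r.pos_locallyFinite

instance (r : OrderZeroDist) : IsLocallyFiniteMeasure r.neg := r.neg_locallyFinite

theorem isLocallyFiniteMeasure_of_Icc {μ : Measure ℝ} (h : ∀ a b : ℝ, μ (Icc a b) < ∞) :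
    IsLocallyFiniteMeasure μ :=
  ⟨fun x => ⟨Icc (x - 1) (x + 1), Icc_mem_nhds (by linarith) (by linarith), h _ _⟩⟩

variable {n : ℕ}

instance (w : Matrix (Fin n) (Fin n) OrderZeroDist) : IsLocallyFiniteMeasure (traceMeasure w) :=
  isLocallyFiniteMeasure_of_Icc fun a b => by
    rw [traceMeasure, Measure.finsetSum_apply]
    exact ENNReal.sum_lt_top.2 fun i _ => isCompact_Icc.measure_lt_top

/-- A local measure dominating all entries of `q` and the trace of `w`. -/
noncomputable def baseMeasure (q w : Matrix (Fin n) (Fin n) OrderZeroDist) : Measure ℝ :=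
  (∑ i, ∑ j, ((q i j).pos + (q i j).neg)) + traceMeasure w

instance (q w : Matrix (Fin n) (Fin n) OrderZeroDist) : IsLocallyFiniteMeasure (baseMeasure q w) :=
  isLocallyFiniteMeasure_of_Icc fun a b => by
    simp only [baseMeasure, Measure.add_apply, Measure.finsetSum_apply]
    refine ENNReal.add_lt_top.2 ⟨?_, isCompact_Icc.measure_lt_top⟩
    exact ENNReal.sum_lt_top.2 fun i _ => ENNReal.sum_lt_top.2 fun j _ =>
      ENNReal.add_lt_top.2 ⟨isCompact_Icc.measure_lt_top, isCompact_Icc.measure_lt_top⟩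

variable (q w : Matrix (Fin n) (Fin n) OrderZeroDist)

theorem pos_add_neg_le_baseMeasure (i j : Fin n) :
    (q i j).pos + (q i j).neg ≤ baseMeasure q w := by
  refine le_trans ?_ (Measure.le_add_right le_rfl)
  refine le_trans ?_ (Finset.single_le_sum (f := fun i => ∑ j, ((q i j).pos + (q i j).neg))
    (fun _ _ => Measure.zero_le _) (Finset.mem_univ i))
  exact Finset.single_le_sum (f := fun j => (q i j).pos + (q i j).neg)
    (fun _ _ => Measure.zero_le _) (Finset.mem_univ j)

theorem pos_absolutelyContinuous (i j : Fin n) : (q i j).pos ≪ baseMeasure q w :=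
  Measure.absolutelyContinuous_of_le
    ((Measure.le_add_right le_rfl).trans (pos_add_neg_le_baseMeasure q w i j))

theorem neg_absolutelyContinuous (i j : Fin n) : (q i j).neg ≪ baseMeasure q w :=
  Measure.absolutelyContinuous_of_le
    ((Measure.le_add_left le_rfl).trans (pos_add_neg_le_baseMeasure q w i j))

theorem traceMeasure_absolutelyContinuous : traceMeasure w ≪ baseMeasure q w :=
  Measure.absolutelyContinuous_of_le (Measure.le_add_left le_rfl)

/-- The density of a local measure with respect to a positive one. -/
noncomputable def distDensity (r : OrderZeroDist) (ν : Measure ℝ) (x : ℝ) : ℝ :=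
  (r.pos.rnDeriv ν x).toReal - (r.neg.rnDeriv ν x).toReal

theorem measurable_distDensity (r : OrderZeroDist) (ν : Measure ℝ) :
    Measurable (distDensity r ν) :=
  (Measure.measurable_rnDeriv _ _).ennreal_toReal.sub
    (Measure.measurable_rnDeriv _ _).ennreal_toReal

theorem locallyIntegrable_distDensity (r : OrderZeroDist) (ν : Measure ℝ) :
    LocallyIntegrable (distDensity r ν) ν :=
  (locallyIntegrable_rnDeriv _ _).sub (locallyIntegrable_rnDeriv _ _)

theorem locallyIntegrable_ofReal {ν : Measure ℝ} {g : ℝ → ℝ} (hg : LocallyIntegrable g ν) :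
    LocallyIntegrable (fun x => (g x : ℂ)) ν := fun x => by
  obtain ⟨s, hs, hi⟩ := hg x
  exact ⟨s, hs, hi.ofReal⟩

theorem val_singleton {r : OrderZeroDist} {ν : Measure ℝ} [IsLocallyFiniteMeasure ν]
    {x : ℝ} (hx : ν {x} ≠ 0) : ν.real {x} * distDensity r ν x = r.val {x} := by
  rw [distDensity, mul_sub, real_singleton_mul_rnDeriv hx, real_singleton_mul_rnDeriv hx]
  rfl

theorem integral_distDensity {r : OrderZeroDist} {ν : Measure ℝ} [IsLocallyFiniteMeasure ν]
    (hp : r.pos ≪ ν) (hn : r.neg ≪ ν) {u φ : ℝ → ℂ} (hum : Measurable u)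
    (hub : ∀ R : ℝ, ∃ C, ∀ x ∈ Icc (-R) R, ‖u x‖ ≤ C) (hφ : IsTest φ) :
    r.integral (fun x => u x * φ x) = ∫ x, (distDensity r ν x : ℂ) * u x * φ x ∂ν := by
  have key : ∀ μ : Measure ℝ, IsLocallyFiniteMeasure μ →
      Integrable (fun x => ((μ.rnDeriv ν x).toReal : ℂ) * (u x * φ x)) ν := by
    intro μ _
    have := integrable_mul_of_hasCompactSupport (locallyIntegrable_mul_of_bounded hum hub
      (locallyIntegrable_ofReal (locallyIntegrable_rnDeriv μ ν))) hφ.continuous hφ.2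
    refine this.congr (Eventually.of_forall fun x => ?_)
    simp only
    ring
  rw [OrderZeroDist.integral, ← integral_rnDeriv_mul hp, ← integral_rnDeriv_mul hn,
    ← integral_sub (key _ inferInstance) (key _ inferInstance)]
  congr 1
  funext x
  rw [distDensity]
  push_cast
  ring

/-- The density of `q` with respect to the base measure. -/
noncomputable def potDensity (x : ℝ) : Matrix (Fin n) (Fin n) ℂ :=
  Matrix.of fun i j => (distDensity (q i j) (baseMeasure q w) x : ℂ)

/-- The density of `w` with respect to the base measure. -/
noncomputable def weightDensity (x : ℝ) : Matrix (Fin n) (Fin n) ℂ :=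
  (((traceMeasure w).rnDeriv (baseMeasure q w) x).toReal : ℂ) • density w x

theorem weightDensity_posSemidef (x : ℝ) : (weightDensity q w x).PosSemidef :=
  (density_posSemidef w x).smul (by exact_mod_cast ENNReal.toReal_nonneg)

theorem density_im (x : ℝ) (i j : Fin n) : (density w x i j).im = 0 := by
  unfold density
  split_ifs
  · simp [rawDensity]
  · simp

theorem weightDensity_im (x : ℝ) (i j : Fin n) : (weightDensity q w x i j).im = 0 := by
  simp [weightDensity, density_im]

theorem weightDensity_symm (x : ℝ) (i j : Fin n) :
    weightDensity q w x i j = weightDensity q w x j i := by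
  have h := (weightDensity_posSemidef q w x).1.apply i j
  rw [← h]
  exact Complex.conj_eq_iff_im.2 (weightDensity_im q w x j i)

theorem norm_density_le (x : ℝ) (i j : Fin n) :
    ‖density w x i j‖ ≤ ((w i j).pos.rnDeriv (traceMeasure w) x).toReal
      + ((w i j).neg.rnDeriv (traceMeasure w) x).toReal := by
  unfold density
  split_ifs
  · simp only [rawDensity, of_apply, Complex.norm_real]
    refine (norm_sub_le _ _).trans ?_
    rw [Real.norm_of_nonneg ENNReal.toReal_nonneg, Real.norm_of_nonneg ENNReal.toReal_nonneg]
  · simp only [Matrix.zero_apply, norm_zero]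
    positivity

theorem locallyIntegrable_density (i j : Fin n) :
    LocallyIntegrable (fun x => density w x i j) (traceMeasure w) := by
  have h := (locallyIntegrable_rnDeriv (w i j).pos (traceMeasure w)).add
    (locallyIntegrable_rnDeriv (w i j).neg (traceMeasure w))
  refine h.mono (measurable_density w i j).aestronglyMeasurable (Eventually.of_forall fun x => ?_)
  refine (norm_density_le w x i j).trans ?_
  exact le_abs_self _

theorem locallyIntegrable_weightDensity (i j : Fin n) :
    LocallyIntegrable (fun x => weightDensity q w x i j) (baseMeasure q w) :=
  locallyIntegrable_rnDeriv_mul (traceMeasure_absolutelyContinuous q w)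
    (locallyIntegrable_density w i j)

theorem measurable_weightDensity (i j : Fin n) :
    Measurable fun x => weightDensity q w x i j :=
  (Complex.measurable_ofReal.comp (Measure.measurable_rnDeriv _ _).ennreal_toReal).mul
    (measurable_density w i j)

theorem jump_eq_smul_potDensity {x : ℝ} (hx : baseMeasure q w {x} ≠ 0) (i j : Fin n) :
    ((jump q x i j : ℝ) : ℂ) = (baseMeasure q w).real {x} * potDensity q w x i j := by
  rw [jump, matVal, of_apply, ← val_singleton (ν := baseMeasure q w) hx, potDensity, of_apply]
  push_cast
  rfl

/-- The assumption `weightDensity ≠ 0` cannot be read off from the atom: `density` is replaced by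
`0` wherever the raw derivative fails to be positive semidefinite. A nonzero value shows both that
no replacement took place and that `x` is an atom of the trace. -/
theorem jump_eq_smul_weightDensity {x : ℝ} (hx : baseMeasure q w {x} ≠ 0)
    (hW : weightDensity q w x ≠ 0) (i j : Fin n) :
    ((jump w x i j : ℝ) : ℂ) = (baseMeasure q w).real {x} * weightDensity q w x i j := by
  have hd : density w x ≠ 0 := fun h => hW (by rw [weightDensity, h, smul_zero])
  have hd' : density w x = rawDensity w x := by
    unfold density at hd ⊢
    split_ifs with h
    · rfl
    · simp [h] at hd
  have ht := real_singleton_mul_rnDeriv (μ := traceMeasure w) hx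
  have ht0 : traceMeasure w {x} ≠ 0 := by
    intro h0
    apply hW
    have : ((traceMeasure w).rnDeriv (baseMeasure q w) x).toReal = 0 := by
      rw [Measure.real, Measure.real, h0, ENNReal.toReal_zero, mul_eq_zero] at ht
      refine ht.resolve_left fun h => ?_
      rcases (ENNReal.toReal_eq_zero_iff _).1 h with h | h
      · exact hx h
      · exact measure_singleton_lt_top.ne h
    rw [weightDensity, this]
    simp
  rw [jump, matVal, of_apply, ← val_singleton (ν := traceMeasure w) ht0, weightDensity, hd',
    Matrix.smul_apply, ← ht, rawDensity, of_apply, smul_eq_mul, distDensity]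
  push_cast
  ring

theorem weightTerm_eq (f : ℝ → Fin n → ℂ) (i : Fin n) (φ : ℝ → ℂ) :
    weightTerm w f i φ = ∫ x, (weightDensity q w x *ᵥ f x) i * φ x ∂(baseMeasure q w) := by
  rw [weightTerm, ← integral_rnDeriv_mul (traceMeasure_absolutelyContinuous q w)]
  congr 1
  funext x
  rw [weightDensity, smul_mulVec, Pi.smul_apply, smul_eq_mul]
  ring

theorem potentialTerm_eq {u : ℝ → Fin n → ℂ} (hum : Measurable u)
    (hub : ∀ R : ℝ, ∃ C, ∀ x ∈ Icc (-R) R, ‖u x‖ ≤ C) (i : Fin n) {φ : ℝ → ℂ} (hφ : IsTest φ) :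
    potentialTerm q u i φ = ∫ x, (potDensity q w x *ᵥ u x) i * φ x ∂(baseMeasure q w) := by
  have hm : ∀ j, Measurable fun x => u x j := fun j => (measurable_pi_apply j).comp hum
  have hb : ∀ j, ∀ R : ℝ, ∃ C, ∀ x ∈ Icc (-R) R, ‖u x j‖ ≤ C := fun j R =>
    (hub R).imp fun C hC x hx => (norm_le_pi_norm _ j).trans (hC x hx)
  have hi : ∀ j, Integrable (fun x => potDensity q w x i j * u x j * φ x) (baseMeasure q w) := by
    intro j
    have := integrable_mul_of_hasCompactSupport (locallyIntegrable_mul_of_bounded (hm j) (hb j)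
      (locallyIntegrable_ofReal (locallyIntegrable_distDensity (q i j) (baseMeasure q w))))
      hφ.continuous hφ.2
    refine this.congr (Eventually.of_forall fun x => ?_)
    simp only [potDensity, of_apply]
    ring
  rw [potentialTerm]
  simp only [mulVec, dotProduct, Finset.sum_mul]
  rw [integral_finsetSum _ fun j _ => hi j]
  refine Finset.sum_congr rfl fun j _ => ?_
  exact integral_distDensity (pos_absolutelyContinuous q w i j) (neg_absolutelyContinuous q w i j)
    (hm j) (hb j) hφ

theorem locallyIntegrable_potDensity (i j : Fin n) :
    LocallyIntegrable (fun x => potDensity q w x i j) (baseMeasure q w) :=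
  locallyIntegrable_ofReal (locallyIntegrable_distDensity _ _)

theorem measurable_potDensity (i j : Fin n) : Measurable fun x => potDensity q w x i j :=
  Complex.measurable_ofReal.comp (measurable_distDensity _ _)

end Data

/-! ### The seminorm of the weighted space in terms of the density -/

section Seminorm

variable {n : ℕ} (q w : Matrix (Fin n) (Fin n) OrderZeroDist)

/-- Positivity of the form at `f - θ eᵢ`, where `θ` is the phase of `(D f)ᵢ`, makes the cross terms
equal to `-2 |(D f)ᵢ|`. The estimate yields local integrability of `w f` when only `f* w f` is
integrable. -/
theorem two_mul_norm_mulVec_le {D : Matrix (Fin n) (Fin n) ℂ} (hD : D.PosSemidef) (f : Fin n → ℂ)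
    (i : Fin n) : 2 * ‖(D *ᵥ f) i‖ ≤ (D i i).re + (star f ⬝ᵥ (D *ᵥ f)).re := by
  set z := (D *ᵥ f) i with hz
  obtain ⟨θ, hθ, hzθ⟩ : ∃ θ : ℂ, ‖θ‖ = 1 ∧ star θ * z = ‖z‖ := by
    by_cases h : z = 0
    · exact ⟨1, by simp, by simp [h]⟩
    · refine ⟨z / ‖z‖, by simp [h], ?_⟩
      have h0 : (‖z‖ : ℂ) ≠ 0 := by exact_mod_cast norm_ne_zero_iff.2 h
      rw [Complex.star_def, map_div₀, Complex.conj_ofReal, div_mul_eq_mul_div, Complex.conj_mul']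
      field_simp
  have h := (Complex.le_def.1 (hD.dotProduct_mulVec_nonneg (f - Pi.single i θ))).1
  have hs : star f ⬝ᵥ (D *ᵥ Pi.single i θ) = star (star θ * z) := by
    have e : star f ⬝ᵥ (D *ᵥ Pi.single i θ) = star (star (Pi.single i θ) ⬝ᵥ (D *ᵥ f)) := by
      rw [star_dotProduct, star_mulVec, hD.1, dotProduct_mulVec]
    rw [e]
    congr 1
    rw [← Pi.single_star, single_dotProduct]
  have hs2 : star (Pi.single i θ : Fin n → ℂ) ⬝ᵥ (D *ᵥ f) = star θ * z := by
    rw [← Pi.single_star, single_dotProduct]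
  have hs3 : star (Pi.single i θ : Fin n → ℂ) ⬝ᵥ (D *ᵥ Pi.single i θ) = D i i := by
    rw [← Pi.single_star, single_dotProduct, mulVec_single, Pi.smul_apply]
    simp only [MulOpposite.smul_eq_mul_unop, MulOpposite.unop_op, col_apply]
    have : star θ * θ = 1 := by
      rw [Complex.star_def, Complex.conj_mul', hθ]
      simp
    linear_combination D i i * this
  rw [star_sub, mulVec_sub, sub_dotProduct, dotProduct_sub, dotProduct_sub, hs, hs2, hs3, hzθ] at h
  simp only [Complex.zero_re, Complex.sub_re, Complex.star_def, Complex.conj_ofReal,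
    Complex.ofReal_re] at h
  linarith

theorem integrable_quadDensity {f : ℝ → Fin n → ℂ} (hf : f ∈ scriptL2 w) :
    Integrable (quadDensity w f) (traceMeasure w) := by
  refine ⟨(aemeasurable_quadDensity w hf.1).aestronglyMeasurable, ?_⟩
  rw [hasFiniteIntegral_iff_ofReal (Eventually.of_forall fun x => quadDensity_nonneg w f x)]
  exact hf.2

theorem aemeasurable_density_mulVec {f : ℝ → Fin n → ℂ} (hf : AEMeasurable f (traceMeasure w))
    (i : Fin n) : AEMeasurable (fun x => (density w x *ᵥ f x) i) (traceMeasure w) := by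
  simp only [mulVec, dotProduct]
  exact Finset.aemeasurable_fun_sum _ fun j _ => (measurable_density w i j).aemeasurable.mul
    ((measurable_pi_apply j).comp_aemeasurable hf)

/-- The function `w f` is locally integrable for `f ∈ 𝓛²(w)`. -/
theorem locallyIntegrable_weightDensity_mulVec {f : ℝ → Fin n → ℂ} (hf : f ∈ scriptL2 w)
    (i : Fin n) :
    LocallyIntegrable (fun x => (weightDensity q w x *ᵥ f x) i) (baseMeasure q w) := by
  have h : LocallyIntegrable (fun x => (density w x *ᵥ f x) i) (traceMeasure w) := by
    have h1 := (locallyIntegrable_density w i i).norm_fun.add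
      (integrable_quadDensity w hf).locallyIntegrable
    refine h1.mono (aemeasurable_density_mulVec w hf.1 i).aestronglyMeasurable
      (Eventually.of_forall fun x => ?_)
    have h2 := two_mul_norm_mulVec_le (density_posSemidef w x) (f x) i
    have h3 : (density w x i i).re ≤ ‖density w x i i‖ := Complex.re_le_norm _
    have h4 := quadDensity_nonneg w f x
    have h5 : (star (f x) ⬝ᵥ (density w x *ᵥ f x)).re = quadDensity w f x := rfl
    rw [h5] at h2
    rw [Pi.add_apply, Real.norm_of_nonneg (by positivity)]
    linarith [norm_nonneg ((density w x *ᵥ f x) i)]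
  have := locallyIntegrable_rnDeriv_mul (traceMeasure_absolutelyContinuous q w) h
  simpa [weightDensity, smul_mulVec] using this

theorem sqNorm_eq (f : ℝ → Fin n → ℂ) :
    sqNorm w f = ∫⁻ x, ENNReal.ofReal (star (f x) ⬝ᵥ (weightDensity q w x *ᵥ f x)).re
      ∂(baseMeasure q w) := by
  rw [sqNorm]
  nth_rewrite 1 [← Measure.withDensity_rnDeriv_eq _ _ (traceMeasure_absolutelyContinuous q w)]
  rw [lintegral_withDensity_eq_lintegral_mul_non_measurable₀ _
    (Measure.measurable_rnDeriv _ _).aemeasurable (Measure.rnDeriv_lt_top _ _)]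
  refine lintegral_congr_ae ?_
  filter_upwards [(traceMeasure w).rnDeriv_lt_top (baseMeasure q w)] with x hx
  rw [weightDensity, smul_mulVec, dotProduct_smul, smul_eq_mul, Complex.re_ofReal_mul,
    ENNReal.ofReal_mul ENNReal.toReal_nonneg, ENNReal.ofReal_toReal hx.ne, Pi.mul_apply]
  rfl

theorem ae_traceMeasure_iff {p : ℝ → Prop} :
    (∀ᵐ x ∂(traceMeasure w), p x) ↔ ∀ᵐ x ∂(baseMeasure q w),
      ((traceMeasure w).rnDeriv (baseMeasure q w) x).toReal ≠ 0 → p x := by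
  nth_rewrite 1 [← Measure.withDensity_rnDeriv_eq _ _ (traceMeasure_absolutelyContinuous q w)]
  rw [ae_withDensity_iff (Measure.measurable_rnDeriv _ _)]
  have hfin := (traceMeasure w).rnDeriv_lt_top (baseMeasure q w)
  constructor
  · intro h
    filter_upwards [h, hfin] with x hx h1 h2
    exact hx fun h0 => h2 (by simp [h0])
  · intro h
    filter_upwards [h, hfin] with x hx h1 h2
    exact hx fun h0 => by
      rcases (ENNReal.toReal_eq_zero_iff _).1 h0 with h | h
      · exact h2 h
      · exact h1.ne h

/-- For a positive semidefinite matrix the zeros of the quadratic form are the kernel vectors, so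
vanishing of the norm becomes a linear condition that holds almost everywhere for the base measure.
-/
theorem sqNorm_eq_zero_iff {f : ℝ → Fin n → ℂ} (hf : AEMeasurable f (traceMeasure w)) :
    sqNorm w f = 0 ↔ ∀ᵐ x ∂(baseMeasure q w), weightDensity q w x *ᵥ f x = 0 := by
  have h1 : sqNorm w f = 0 ↔ ∀ᵐ x ∂(traceMeasure w), density w x *ᵥ f x = 0 := by
    rw [sqNorm, lintegral_eq_zero_iff' (aemeasurable_quadDensity w hf).ennreal_ofReal]
    refine eventually_congr (Eventually.of_forall fun x => ?_)
    rw [Pi.zero_apply, ENNReal.ofReal_eq_zero]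
    have hn := (density_posSemidef w x).dotProduct_mulVec_nonneg (f x)
    rw [← (density_posSemidef w x).dotProduct_mulVec_zero_iff]
    constructor
    · intro h
      have h0 := le_antisymm h (quadDensity_nonneg w f x)
      exact Complex.ext h0 (Complex.le_def.1 hn).2.symm
    · intro h
      rw [quadDensity, h]
      simp
  rw [h1, ae_traceMeasure_iff q w]
  refine eventually_congr (Eventually.of_forall fun x => ?_)
  rw [weightDensity, smul_mulVec, smul_eq_zero, Complex.ofReal_eq_zero]
  tauto

theorem toL2_eq_zero_iff (f : scriptL2 w) :
    toL2 w f = 0 ↔ ∀ᵐ x ∂(baseMeasure q w), weightDensity q w x *ᵥ (f : ℝ → Fin n → ℂ) x = 0 := by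
  rw [← sqNorm_eq_zero_iff q w f.2.1, toL2, Submodule.mkQ_apply, Submodule.Quotient.mk_eq_zero]
  rfl

theorem toL2_eq_iff (f g : scriptL2 w) :
    toL2 w f = toL2 w g ↔ ∀ᵐ x ∂(baseMeasure q w),
      weightDensity q w x *ᵥ (f : ℝ → Fin n → ℂ) x
        = weightDensity q w x *ᵥ (g : ℝ → Fin n → ℂ) x := by
  rw [← sub_eq_zero, toL2, toL2, ← map_sub]
  refine (toL2_eq_zero_iff q w (f - g)).trans ?_
  refine eventually_congr (Eventually.of_forall fun x => ?_)
  rw [Submodule.coe_sub, Pi.sub_apply, mulVec_sub, sub_eq_zero]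

end Seminorm

/-! ### Structure of the coefficients at atoms -/

section Equation

/-- The inverse of the skew-symmetric matrix with upper right entry `a`. -/
noncomputable def skewInv (a : ℂ) (v : Fin 2 → ℂ) : Fin 2 → ℂ := ![-v 1 / a, v 0 / a]

/-- The coefficient `-J⁻¹ Q` of the system in explicit form. -/
noncomputable def sysCoeff (a : ℂ) (Q : Matrix (Fin 2) (Fin 2) ℂ) : Matrix (Fin 2) (Fin 2) ℂ :=
  !![Q 1 0 / a, Q 1 1 / a; -Q 0 0 / a, -Q 0 1 / a]

theorem sysCoeff_mulVec (a : ℂ) (Q : Matrix (Fin 2) (Fin 2) ℂ) (u : Fin 2 → ℂ) :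
    sysCoeff a Q *ᵥ u = -skewInv a (Q *ᵥ u) := by
  ext i
  fin_cases i <;> simp [sysCoeff, skewInv, mulVec, dotProduct, Fin.sum_univ_two]
  all_goals ring

variable {J : Matrix (Fin 2) (Fin 2) ℝ}

theorem skew_entries (hJ : J.transpose = -J) (hJinv : IsUnit J) :
    J 0 0 = 0 ∧ J 1 1 = 0 ∧ J 1 0 = -J 0 1 ∧ J 0 1 ≠ 0 := by
  have h := fun i j => congrFun (congrFun hJ i) j
  simp only [transpose_apply, Matrix.neg_apply] at h
  have h00 := h 0 0
  have h11 := h 1 1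
  have h01 := h 0 1
  have hd := (Matrix.isUnit_iff_isUnit_det J).1 hJinv
  rw [det_fin_two, isUnit_iff_ne_zero] at hd
  refine ⟨by linarith, by linarith, h01, fun h0 => hd ?_⟩
  rw [h0, show J 0 0 = 0 by linarith]
  ring

variable (q w : Matrix (Fin 2) (Fin 2) OrderZeroDist)

theorem potDensity_symm (hq : q.transpose = q) (x : ℝ) :
    potDensity q w x 1 0 = potDensity q w x 0 1 := by
  have : q 1 0 = q 0 1 := congrFun (congrFun hq 0) 1
  simp [potDensity, this]

theorem jump_symm (hq : q.transpose = q) (x : ℝ) : jump q x 1 0 = jump q x 0 1 := by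
  have : q 1 0 = q 0 1 := congrFun (congrFun hq 0) 1
  simp [jump, matVal, this]

/-- At an atom the squared entry `(J 0 1)²` times the jump determinant equals `det (J + Δ_q / 2)`,
which is nonzero by the hypothesis at `λ = 0`; away from atoms the jump determinant is `1`. -/
theorem isRegularCoeff_sysCoeff (hJ : J.transpose = -J) (hJinv : IsUnit J) (hq : q.transpose = q)
    (hB : ∀ l x : ℝ, IsUnit (J + (1 / 2 : ℝ) • (jump q x - l • jump w x))) :
    IsRegularCoeff (baseMeasure q w) fun x => sysCoeff (J 0 1) (potDensity q w x) := by
  obtain ⟨h00, h11, h10, ha⟩ := skew_entries hJ hJinv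
  have ha' : ((J 0 1 : ℝ) : ℂ) ≠ 0 := by exact_mod_cast ha
  refine ⟨fun i j => ?_, fun i j => ?_, fun x => ?_, fun x => ?_⟩
  · have h := measurable_potDensity q w
    fin_cases i <;> fin_cases j <;> simp [sysCoeff] <;>
      first
        | exact (h _ _).div_const _
        | exact (h _ _).neg.div_const _
  · have h : ∀ (c : ℂ) (i j : Fin 2),
        LocallyIntegrable (fun x => c * potDensity q w x i j) (baseMeasure q w) := fun c i j =>
      (locallyIntegrable_potDensity q w i j).smul c
    have h1 := h (J 0 1 : ℂ)⁻¹
    have h2 := h (-(J 0 1 : ℂ)⁻¹)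
    fin_cases i <;> fin_cases j
    · convert h1 1 0 using 2
      simp [sysCoeff]
      ring
    · convert h1 1 1 using 2
      simp [sysCoeff]
      ring
    · convert h2 0 0 using 2
      simp [sysCoeff]
      ring
    · convert h2 0 1 using 2
      simp [sysCoeff]
      ring
  · simp [sysCoeff, potDensity_symm q w hq]
    ring
  · by_cases hx : baseMeasure q w {x} = 0
    · simp [jumpDet, Measure.real, hx]
    · have hu := hB 0 x
      rw [zero_smul, sub_zero, Matrix.isUnit_iff_isUnit_det, isUnit_iff_ne_zero, det_fin_two] at hu
      simp only [Matrix.add_apply, Matrix.smul_apply, smul_eq_mul, h00, h11, h10,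
        jump_symm q hq] at hu
      have hj := jump_eq_smul_potDensity q w hx
      intro h0
      apply hu
      rw [jumpDet, det_fin_two] at h0
      simp [sysCoeff, potDensity_symm q w hq] at h0
      have h1 : 4 * ((J 0 1 : ℝ) : ℂ) ^ 2 + (((baseMeasure q w).real {x} *
          potDensity q w x 0 0) * ((baseMeasure q w).real {x} * potDensity q w x 1 1)
          - ((baseMeasure q w).real {x} * potDensity q w x 0 1) ^ 2) = 0 := by
        field_simp at h0
        linear_combination h0
      rw [← hj, ← hj, ← hj] at h1
      have h2 : 4 * (J 0 1) ^ 2 + (jump q x 0 0 * jump q x 1 1 - jump q x 0 1 ^ 2) = 0 := by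
        exact_mod_cast h1
      linear_combination (1 / 4 : ℝ) * h2

/-- At a common atom with a singular mass of `w`, invertibility for all real spectral parameters
forces the mixed term of `det (Δ_q - λ Δ_w)` to vanish. -/
theorem mixed_det_eq_zero (hJ : J.transpose = -J) (hJinv : IsUnit J) (hq : q.transpose = q)
    (hB : ∀ l x : ℝ, IsUnit (J + (1 / 2 : ℝ) • (jump q x - l • jump w x))) {x : ℝ}
    (hx : baseMeasure q w {x} ≠ 0) (hW : (weightDensity q w x).det = 0) :
    potDensity q w x 0 0 * weightDensity q w x 1 1 + potDensity q w x 1 1 * weightDensity q w x 0 0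
      - 2 * potDensity q w x 0 1 * weightDensity q w x 0 1 = 0 := by
  by_cases hW0 : weightDensity q w x = 0
  · simp [hW0]
  obtain ⟨h00, h11, h10, ha⟩ := skew_entries hJ hJinv
  have hj := jump_eq_smul_potDensity q w hx
  have hk := jump_eq_smul_weightDensity q w hx hW0
  have hν : ((baseMeasure q w).real {x} : ℂ) ≠ 0 := by
    have : (baseMeasure q w).real {x} ≠ 0 := by
      rw [Measure.real, Ne, ENNReal.toReal_eq_zero_iff, not_or]
      exact ⟨hx, measure_singleton_lt_top.ne⟩
    exact_mod_cast this
  have hws : jump w x 1 0 = jump w x 0 1 := by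
    have := (hk 1 0).trans ((weightDensity_symm q w x 1 0).symm ▸ (hk 0 1).symm)
    exact_mod_cast this
  have hdw : jump w x 0 0 * jump w x 1 1 - jump w x 0 1 * jump w x 0 1 = 0 := by
    rw [det_fin_two, weightDensity_symm q w x 1 0] at hW
    have : ((jump w x 0 0 : ℝ) : ℂ) * (jump w x 1 1 : ℝ) - (jump w x 0 1 : ℝ) * (jump w x 0 1 : ℝ)
        = 0 := by
      rw [hk, hk, hk]
      linear_combination ((baseMeasure q w).real {x} : ℂ) ^ 2 * hW
    exact_mod_cast this
  set B := jump q x 0 0 * jump w x 1 1 + jump q x 1 1 * jump w x 0 0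
    - 2 * jump q x 0 1 * jump w x 0 1 with hBdef
  have hB0 : B = 0 := by
    by_contra hB0
    -- As `det Δ_w = 0`, four times the determinant of `J + (Δ_q - λ Δ_w)/2` is `4 (J 0 1)² + det
    -- Δ_q - λ B`; for `B ≠ 0` the number `r` is its real root.
    obtain ⟨r, hr⟩ : ∃ r, r * B = 4 * (J 0 1) ^ 2 +
        (jump q x 0 0 * jump q x 1 1 - jump q x 0 1 ^ 2) := ⟨_, div_mul_cancel₀ _ hB0⟩
    have hu := hB r x
    rw [Matrix.isUnit_iff_isUnit_det, isUnit_iff_ne_zero, det_fin_two] at hu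
    simp only [Matrix.add_apply, Matrix.sub_apply, Matrix.smul_apply, smul_eq_mul, h00, h11, h10,
      jump_symm q hq, hws] at hu
    apply hu
    rw [hBdef] at hr
    linear_combination (-1 / 4 : ℝ) * hr + (1 / 4) * r ^ 2 * hdw
  have hBc : ((jump q x 0 0 : ℝ) : ℂ) * (jump w x 1 1 : ℝ) + (jump q x 1 1 : ℝ) * (jump w x 0 0 : ℝ)
      - 2 * (jump q x 0 1 : ℝ) * (jump w x 0 1 : ℝ) = 0 := by exact_mod_cast hB0
  rw [hj, hj, hj, hk, hk, hk] at hBc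
  have : ((baseMeasure q w).real {x} : ℂ) ^ 2 *
      (potDensity q w x 0 0 * weightDensity q w x 1 1
        + potDensity q w x 1 1 * weightDensity q w x 0 0
        - 2 * potDensity q w x 0 1 * weightDensity q w x 0 1) = 0 := by
    linear_combination hBc
  exact (mul_eq_zero.1 this).resolve_left (pow_ne_zero 2 hν)

end Equation

/-! ### Distributional derivatives of vector functions -/

section Vector

variable {ν : Measure ℝ} [IsLocallyFiniteMeasure ν] {n : ℕ}

theorem locallyIntegrable_pi_iff {h : ℝ → Fin n → ℂ} :
    LocallyIntegrable h ν ↔ ∀ i, LocallyIntegrable (fun x => h x i) ν := by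
  simp only [locallyIntegrable_iff_integrableOn_Icc, IntegrableOn, integrable_pi_iff]
  exact ⟨fun H i R => H R i, fun H R i => H i R⟩

theorem balPrim_apply {h : ℝ → Fin n → ℂ} (hh : LocallyIntegrable h ν) (x : ℝ) (i : Fin n) :
    balPrim ν h x i = balPrim ν (fun t => h t i) x := by
  have := (ContinuousLinearMap.proj (R := ℝ) (φ := fun _ : Fin n => ℂ)
    i).intervalIntegral_comp_comm (hh.intervalIntegrable (0 : ℝ) x)
  simp only [ContinuousLinearMap.proj_apply] at this
  rw [balPrim, balPrim, this]
  rfl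

theorem isPrim_iff_apply {u h : ℝ → Fin n → ℂ} :
    IsPrim ν u h ↔ ∀ i, IsPrim ν (fun x => u x i) fun x => h x i := by
  constructor
  · rintro ⟨hh, c, hc⟩ i
    refine ⟨locallyIntegrable_pi_iff.1 hh i, c i, fun x => ?_⟩
    show u x i = _
    rw [hc, Pi.add_apply, balPrim_apply hh]
  · intro H
    have hh := locallyIntegrable_pi_iff.2 fun i => (H i).1
    choose c hc using fun i => (H i).2
    refine ⟨hh, c, fun x => funext fun i => ?_⟩
    rw [Pi.add_apply, balPrim_apply hh]
    exact hc i x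

theorem IsPrim.isBalancedBV {u h : ℝ → Fin n → ℂ} (H : IsPrim ν u h) : IsBalancedBV u := by
  refine ⟨H.locallyBoundedVariationOn, fun x => ?_⟩
  rw [rightLim_eq_of_tendsto (H.tendsto_right x), leftLim_eq_of_tendsto (H.tendsto_left x)]
  ext i
  simp
  ring

/-- A balanced function of locally bounded variation is an antiderivative of its distributional
derivative. -/
theorem isPrim_of_integral_mul_deriv {u h : ℝ → Fin n → ℂ} (hu : IsBalancedBV u)
    (hh : LocallyIntegrable h ν)
    (H : ∀ φ, IsTest φ → ∀ i, -∫ x, u x i * deriv φ x = ∫ x, h x i * φ x ∂ν) : IsPrim ν u h := by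
  have hhi := locallyIntegrable_pi_iff.1 hh
  have hui := fun i => locallyBoundedVariationOn_apply hu.1 i
  have key : ∀ i, ∃ c, ∀ᵐ x, u x i - balPrim ν (fun t => h t i) x = c := by
    intro i
    have hb : LocallyBoundedVariationOn (balPrim ν fun t => h t i) univ := by
      simpa using locallyBoundedVariationOn_balPrim (hhi i) 0
    refine ae_eq_const_of_integral_mul_deriv
      ((locallyIntegrable_of_locallyBoundedVariationOn (hui i)).sub
        (locallyIntegrable_of_locallyBoundedVariationOn hb)) fun φ hφ => ?_
    have h1 := integral_balPrim_mul_deriv (hhi i) 0 hφ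
    have h2 := H φ hφ i
    simp only [zero_add] at h1
    simp only [sub_mul]
    rw [integral_sub
      (integrable_mul_of_hasCompactSupport (locallyIntegrable_of_locallyBoundedVariationOn (hui i))
        hφ.continuous_deriv hφ.hasCompactSupport_deriv)
      (integrable_mul_of_hasCompactSupport (locallyIntegrable_of_locallyBoundedVariationOn hb)
        hφ.continuous_deriv hφ.hasCompactSupport_deriv), h1, ← h2]
    ring
  choose c hc using key
  have hae : ∀ᵐ x, u x = c + balPrim ν h x := by
    filter_upwards [ae_all_iff.2 hc] with x hx
    funext i
    rw [Pi.add_apply, balPrim_apply hh, ← hx i]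
    ring
  refine ⟨hh, c, fun x => ?_⟩
  have hP : IsPrim ν (fun x => c + balPrim ν h x) h := ⟨hh, c, fun _ => rfl⟩
  -- The almost everywhere identity becomes an identity at every point, since both sides are
  -- balanced and have the same one-sided limits.
  have hr := tendsto_right_unique_of_ae hae
    (tendsto_rightLim_of_locallyBoundedVariationOn hu.1 x) (hP.tendsto_right x)
  have hl := tendsto_left_unique_of_ae hae
    (tendsto_leftLim_of_locallyBoundedVariationOn hu.1 x) (hP.tendsto_left x)
  rw [hu.2 x, hr, hl]
  ext i
  simp
  ring

theorem IsPrim.integral_mul_deriv {u h : ℝ → Fin n → ℂ} (H : IsPrim ν u h) {φ : ℝ → ℂ}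
    (hφ : IsTest φ) (i : Fin n) : -∫ x, u x i * deriv φ x = ∫ x, h x i * φ x ∂ν := by
  obtain ⟨hh, c, hc⟩ := isPrim_iff_apply.1 H i
  simp only at hc
  simp only [hc]
  rw [integral_balPrim_mul_deriv hh c hφ, neg_neg]

end Vector

/-! ### The distributional equation as an integral equation -/

section Equivalence

variable {J : Matrix (Fin 2) (Fin 2) ℝ} (q w : Matrix (Fin 2) (Fin 2) OrderZeroDist)

/-- The right-hand side `J⁻¹ (w f - q u)` of the system, as a density. -/
noncomputable def sysRhs (a : ℂ) (u f : ℝ → Fin 2 → ℂ) (x : ℝ) : Fin 2 → ℂ :=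
  sysCoeff a (potDensity q w x) *ᵥ u x + skewInv a (weightDensity q w x *ᵥ f x)

theorem solves_iff (hJ : J.transpose = -J) (hJinv : IsUnit J) {u f : ℝ → Fin 2 → ℂ}
    (hum : Measurable u) (hub : ∀ R : ℝ, ∃ C, ∀ x ∈ Icc (-R) R, ‖u x‖ ≤ C)
    (hf : ∀ i, LocallyIntegrable (fun x => (weightDensity q w x *ᵥ f x) i) (baseMeasure q w)) :
    LocallyIntegrable (sysRhs q w (J 0 1) u f) (baseMeasure q w) ∧
      (Solves J q w u f ↔ ∀ φ, IsTest φ → ∀ i, -∫ x, u x i * deriv φ x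
        = ∫ x, sysRhs q w (J 0 1) u f x i * φ x ∂(baseMeasure q w)) := by
  obtain ⟨h00, h11, h10, ha⟩ := skew_entries hJ hJinv
  have ha' : ((J 0 1 : ℝ) : ℂ) ≠ 0 := by exact_mod_cast ha
  have hu : ∀ i, LocallyIntegrable (fun x => (potDensity q w x *ᵥ u x) i) (baseMeasure q w) := by
    intro i
    have h : ∀ j, LocallyIntegrable (fun x => potDensity q w x i j * u x j) (baseMeasure q w) := by
      intro j
      have := locallyIntegrable_mul_of_bounded (ν := baseMeasure q w)
        ((measurable_pi_apply j).comp hum)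
        (fun R => (hub R).imp fun C hC x hx => (norm_le_pi_norm (u x) j).trans (hC x hx))
        (locallyIntegrable_potDensity q w i j)
      simpa only [mul_comm, Function.comp] using this
    simp only [mulVec, dotProduct, Fin.sum_univ_two]
    exact (h 0).add (h 1)
  have e0 : ∀ x, sysRhs q w (J 0 1) u f x 0 = (J 0 1 : ℂ)⁻¹ *
      ((potDensity q w x *ᵥ u x) 1 - (weightDensity q w x *ᵥ f x) 1) := by
    intro x
    rw [sysRhs, sysCoeff_mulVec]
    simp [skewInv]
    ring
  have e1 : ∀ x, sysRhs q w (J 0 1) u f x 1 = (J 0 1 : ℂ)⁻¹ *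
      ((weightDensity q w x *ᵥ f x) 0 - (potDensity q w x *ᵥ u x) 0) := by
    intro x
    rw [sysRhs, sysCoeff_mulVec]
    simp [skewInv]
    ring
  refine ⟨?_, ?_⟩
  · rw [locallyIntegrable_pi_iff, Fin.forall_fin_two]
    constructor
    · simp only [e0]
      exact ((hu 1).sub (hf 1)).smul ((J 0 1 : ℂ)⁻¹)
    · simp only [e1]
      exact ((hf 0).sub (hu 0)).smul ((J 0 1 : ℂ)⁻¹)
  · refine forall_congr' fun φ => forall_congr' fun hφ => ?_
    have iu := fun i => integrable_mul_of_hasCompactSupport (hu i) hφ.continuous hφ.2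
    have iff := fun i => integrable_mul_of_hasCompactSupport (hf i) hφ.continuous hφ.2
    have i0 : ∫ x, sysRhs q w (J 0 1) u f x 0 * φ x ∂(baseMeasure q w)
        = (J 0 1 : ℂ)⁻¹ * (potentialTerm q u 1 φ - weightTerm w f 1 φ) := by
      rw [potentialTerm_eq q w hum hub 1 hφ, weightTerm_eq q w, ← integral_sub (iu 1) (iff 1),
        ← integral_const_mul]
      congr 1
      funext x
      rw [e0]
      ring
    have i1 : ∫ x, sysRhs q w (J 0 1) u f x 1 * φ x ∂(baseMeasure q w)
        = (J 0 1 : ℂ)⁻¹ * (weightTerm w f 0 φ - potentialTerm q u 0 φ) := by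
      rw [potentialTerm_eq q w hum hub 0 hφ, weightTerm_eq q w, ← integral_sub (iff 0) (iu 0),
        ← integral_const_mul]
      congr 1
      funext x
      rw [e1]
      ring
    rw [Fin.forall_fin_two, Fin.forall_fin_two, i0, i1]
    simp only [derivTerm, Fin.sum_univ_two, h00, h11, h10]
    push_cast
    rw [eq_inv_mul_iff_mul_eq₀ ha', eq_inv_mul_iff_mul_eq₀ ha']
    constructor
    · rintro ⟨h1, h2⟩
      exact ⟨by linear_combination -h2, by linear_combination h1⟩
    · rintro ⟨h1, h2⟩
      exact ⟨by linear_combination h2, by linear_combination -h1⟩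

/-- The distributional equation is equivalent to an integral equation. -/
theorem isBalancedBV_and_solves_iff (hJ : J.transpose = -J) (hJinv : IsUnit J)
    {u f : ℝ → Fin 2 → ℂ}
    (hf : ∀ i, LocallyIntegrable (fun x => (weightDensity q w x *ᵥ f x) i) (baseMeasure q w)) :
    (IsBalancedBV u ∧ Solves J q w u f)
      ↔ IsPrim (baseMeasure q w) u (sysRhs q w (J 0 1) u f) := by
  have hb : ∀ {u : ℝ → Fin 2 → ℂ}, LocallyBoundedVariationOn u univ →
      ∀ R : ℝ, ∃ C, ∀ x ∈ Icc (-R) R, ‖u x‖ ≤ C := fun hu R =>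
    (exists_norm_le_of_locallyBoundedVariationOn hu R).imp fun C hC => hC.2
  constructor
  · rintro ⟨hu, hs⟩
    obtain ⟨h1, h2⟩ := solves_iff q w hJ hJinv (measurable_of_locallyBoundedVariationOn hu.1)
      (hb hu.1) hf
    exact isPrim_of_integral_mul_deriv hu h1 (h2.1 hs)
  · intro H
    have hu := H.isBalancedBV
    obtain ⟨h1, h2⟩ := solves_iff q w hJ hJinv (measurable_of_locallyBoundedVariationOn hu.1)
      (hb hu.1) hf
    exact ⟨hu, h2.2 fun φ hφ i => H.integral_mul_deriv hφ i⟩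

end Equivalence

/-! ### Invariance of solutions and densities under the period -/

section Translation

variable {ν : Measure ℝ} [IsLocallyFiniteMeasure ν] {ω : ℝ}

theorem measurePreserving_add (h : ν.map (· + ω) = ν) : MeasurePreserving (· + ω) ν ν :=
  ⟨measurable_add_const ω, h⟩

theorem real_singleton_add (h : ν.map (· + ω) = ν) (x : ℝ) : ν.real {x + ω} = ν.real {x} := by
  conv_lhs => rw [← h]
  rw [Measure.real, (measurableEmbedding_addRight ω).map_apply, Measure.real]
  congr 2
  ext y
  simp

theorem IsPrim.comp_add {E : Type*} [NormedAddCommGroup E] [NormedSpace ℝ E] [CompleteSpace E]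
    {u h : ℝ → E} (hω : ν.map (· + ω) = ν) (H : IsPrim ν u h) :
    IsPrim ν (fun x => u (x + ω)) fun x => h (x + ω) := by
  obtain ⟨hh, c, hc⟩ := H
  have hh' : LocallyIntegrable (fun x => h (x + ω)) ν := by
    have := (MeasureTheory.locallyIntegrable_map_homeomorph (Homeomorph.addRight ω) (f := h)
      (μ := ν)).1 (by
        rw [show ν.map (Homeomorph.addRight ω) = ν from hω]
        exact hh)
    exact this
  have hmp := measurePreserving_add hω
  have hI : ∀ a b : ℝ, ∫ t in (a + ω)..(b + ω), h t ∂ν = ∫ t in a..b, h (t + ω) ∂ν := by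
    intro a b
    have hset : ∀ a b : ℝ, ∫ t in Ioc (a + ω) (b + ω), h t ∂ν = ∫ t in Ioc a b, h (t + ω) ∂ν := by
      intro a b
      rw [← hmp.setIntegral_preimage_emb (measurableEmbedding_addRight ω),
        preimage_add_const_Ioc, add_sub_cancel_right, add_sub_cancel_right]
    rw [intervalIntegral, intervalIntegral, hset, hset]
  refine ⟨hh', c + ∫ t in (0 : ℝ)..(0 + ω), h t ∂ν, fun x => ?_⟩
  show u (x + ω) = _
  rw [hc, balPrim, balPrim, real_singleton_add hω, ← hI,
    ← intervalIntegral.integral_add_adjacent_intervals (hh.intervalIntegrable 0 (0 + ω))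
      (hh.intervalIntegrable (0 + ω) (x + ω))]
  abel

variable {n : ℕ} (q w : Matrix (Fin n) (Fin n) OrderZeroDist)

theorem map_finsetSum_eq {ι : Type*} (s : Finset ι) {μ : ι → Measure ℝ} {f : ℝ → ℝ}
    (hf : Measurable f) (h : ∀ i, (μ i).map f = μ i) : (∑ i ∈ s, μ i).map f = ∑ i ∈ s, μ i := by
  rw [← Measure.mapₗ_apply_of_measurable hf, map_sum]
  exact Finset.sum_congr rfl fun i _ => by rw [Measure.mapₗ_apply_of_measurable hf, h]

theorem map_traceMeasure (hwper : ∀ i j, (w i j).HasPeriod ω) :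
    (traceMeasure w).map (· + ω) = traceMeasure w :=
  map_finsetSum_eq _ (measurable_add_const ω) fun i => (hwper i i).map_pos_neg.1

theorem map_baseMeasure (hqper : ∀ i j, (q i j).HasPeriod ω)
    (hwper : ∀ i j, (w i j).HasPeriod ω) :
    (baseMeasure q w).map (· + ω) = baseMeasure q w := by
  have hm : Measurable fun x : ℝ => x + ω := measurable_add_const ω
  rw [baseMeasure, Measure.map_add _ _ hm, map_traceMeasure w hwper]
  congr 1
  refine map_finsetSum_eq _ hm fun i => map_finsetSum_eq _ hm fun j => ?_
  rw [Measure.map_add _ _ hm, (hqper i j).map_pos_neg.1, (hqper i j).map_pos_neg.2]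

theorem ae_distDensity_add {r : OrderZeroDist} (hν : ν.map (· + ω) = ν) (hr : r.HasPeriod ω) :
    ∀ᵐ x ∂ν, distDensity r ν (x + ω) = distDensity r ν x := by
  filter_upwards [rnDeriv_add_period hr.map_pos_neg.1 hν,
    rnDeriv_add_period hr.map_pos_neg.2 hν] with x h1 h2
  rw [distDensity, distDensity, h1, h2]

theorem ae_potDensity_add (hqper : ∀ i j, (q i j).HasPeriod ω)
    (hwper : ∀ i j, (w i j).HasPeriod ω) :
    ∀ᵐ x ∂(baseMeasure q w), potDensity q w (x + ω) = potDensity q w x := by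
  have h : ∀ᵐ x ∂(baseMeasure q w), ∀ i j, distDensity (q i j) (baseMeasure q w) (x + ω)
      = distDensity (q i j) (baseMeasure q w) x := by
    simp only [ae_all_iff]
    exact fun i j => ae_distDensity_add (map_baseMeasure q w hqper hwper) (hqper i j)
  filter_upwards [h] with x hx
  ext i j
  rw [potDensity, of_apply, hx, potDensity, of_apply]

theorem ae_weightDensity_add (hqper : ∀ i j, (q i j).HasPeriod ω)
    (hwper : ∀ i j, (w i j).HasPeriod ω) :
    ∀ᵐ x ∂(baseMeasure q w), weightDensity q w (x + ω) = weightDensity q w x := by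
  have h : ∀ᵐ x ∂(traceMeasure w), ∀ i j, distDensity (w i j) (traceMeasure w) (x + ω)
      = distDensity (w i j) (traceMeasure w) x := by
    simp only [ae_all_iff]
    exact fun i j => ae_distDensity_add (map_traceMeasure w hwper) (hwper i j)
  have h' : ∀ᵐ x ∂(traceMeasure w), density w (x + ω) = density w x := by
    filter_upwards [h] with x hx
    have : rawDensity w (x + ω) = rawDensity w x := by
      ext i j
      exact congrArg Complex.ofReal (hx i j)
    rw [density, density, this]
  filter_upwards [(ae_traceMeasure_iff q w).1 h', rnDeriv_add_period (map_traceMeasure w hwper)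
    (map_baseMeasure q w hqper hwper)] with x h1 h2
  rw [weightDensity, weightDensity, h2]
  -- Periodicity of `density` is known only almost everywhere for the trace measure; where the
  -- derivative of the trace vanishes, so does the weight density.
  by_cases h0 : ((traceMeasure w).rnDeriv (baseMeasure q w) x).toReal = 0
  · simp [h0]
  · rw [h1 h0]

end Translation

/-! ### The abstract periodic system -/

section Abstract

/-- The structural properties of the densities of a periodic system with respect to the base
measure. -/
structure IsSystem (ν : Measure ℝ) (ω : ℝ) (a : ℂ) (Q W : ℝ → Matrix (Fin 2) (Fin 2) ℂ) :
    Prop where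
  ne_zero : a ≠ 0
  symm_pot : ∀ x, Q x 1 0 = Q x 0 1
  regular : IsRegularCoeff ν fun x => sysCoeff a (Q x)
  posSemidef : ∀ x, (W x).PosSemidef
  symm_weight : ∀ x i j, W x i j = W x j i
  measurable_weight : ∀ i j, Measurable fun x => W x i j
  locallyIntegrable_weight : ∀ i j, LocallyIntegrable (fun x => W x i j) ν
  mixed : ∀ x, ν {x} ≠ 0 → (W x).det = 0 →
    Q x 0 0 * W x 1 1 + Q x 1 1 * W x 0 0 - 2 * Q x 0 1 * W x 0 1 = 0
  map_add : ν.map (· + ω) = ν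
  pot_add : ∀ᵐ x ∂ν, Q (x + ω) = Q x
  weight_add : ∀ᵐ x ∂ν, W (x + ω) = W x

variable (q w : Matrix (Fin 2) (Fin 2) OrderZeroDist) {J : Matrix (Fin 2) (Fin 2) ℝ} {ω : ℝ}

theorem isSystem (hJ : J.transpose = -J) (hJinv : IsUnit J) (hq : q.transpose = q)
    (hqper : ∀ i j, (q i j).HasPeriod ω) (hwper : ∀ i j, (w i j).HasPeriod ω)
    (hB : ∀ l x : ℝ, IsUnit (J + (1 / 2 : ℝ) • (jump q x - l • jump w x))) :
    IsSystem (baseMeasure q w) ω (J 0 1) (potDensity q w) (weightDensity q w) where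
  ne_zero := by exact_mod_cast (skew_entries hJ hJinv).2.2.2
  symm_pot := potDensity_symm q w hq
  regular := isRegularCoeff_sysCoeff q w hJ hJinv hq hB
  posSemidef := weightDensity_posSemidef q w
  symm_weight := weightDensity_symm q w
  measurable_weight := measurable_weightDensity q w
  locallyIntegrable_weight := locallyIntegrable_weightDensity q w
  mixed x := mixed_det_eq_zero q w hJ hJinv hq hB
  map_add := map_baseMeasure q w hqper hwper
  pot_add := ae_potDensity_add q w hqper hwper
  weight_add := ae_weightDensity_add q w hqper hwper

variable {q w}

theorem locallyIntegrable_mulVec_of_bounded {ν : Measure ℝ} {W : ℝ → Matrix (Fin 2) (Fin 2) ℂ}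
    (hW : ∀ i j, LocallyIntegrable (fun x => W x i j) ν) {u : ℝ → Fin 2 → ℂ} (hum : Measurable u)
    (hub : ∀ R : ℝ, ∃ C, ∀ x ∈ Icc (-R) R, ‖u x‖ ≤ C) (i : Fin 2) :
    LocallyIntegrable (fun x => (W x *ᵥ u x) i) ν := by
  have h : ∀ j, LocallyIntegrable (fun x => W x i j * u x j) ν := by
    intro j
    have := locallyIntegrable_mul_of_bounded (ν := ν) ((measurable_pi_apply j).comp hum)
      (fun R => (hub R).imp fun _ hC x hx => (norm_le_pi_norm (u x) j).trans (hC x hx)) (hW i j)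
    simpa only [mul_comm, Function.comp] using this
  simp only [mulVec, dotProduct, Fin.sum_univ_two]
  exact (h 0).add (h 1)

theorem LocallyBoundedVariationOn.exists_bound {u : ℝ → Fin 2 → ℂ}
    (hu : LocallyBoundedVariationOn u univ) (R : ℝ) : ∃ C, ∀ x ∈ Icc (-R) R, ‖u x‖ ≤ C :=
  (exists_norm_le_of_locallyBoundedVariationOn hu R).imp fun _ hC => hC.2

theorem sysRhs_zero {a : ℂ} (u : ℝ → Fin 2 → ℂ) :
    sysRhs q w a u 0 = fun x => sysCoeff a (potDensity q w x) *ᵥ u x := by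
  funext x
  ext i
  fin_cases i <;> simp [sysRhs, skewInv]

/-- The function `W u` is locally integrable for locally bounded `u`, so its vanishing as a
distribution is vanishing almost everywhere. -/
theorem mem_scriptL0_iff (hJ : J.transpose = -J) (hJinv : IsUnit J) {u : ℝ → Fin 2 → ℂ} :
    u ∈ scriptL0 J q w ↔
      IsPrim (baseMeasure q w) u (fun x => sysCoeff (J 0 1) (potDensity q w x) *ᵥ u x) ∧
        ∀ᵐ x ∂(baseMeasure q w), weightDensity q w x *ᵥ u x = 0 := by
  have h0 : (IsBalancedBV u ∧ Solves J q w u 0)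
      ↔ IsPrim (baseMeasure q w) u (sysRhs q w (J 0 1) u 0) :=
    isBalancedBV_and_solves_iff q w hJ hJinv fun i => by
      simpa using locallyIntegrable_zero
  rw [scriptL0, mem_ofPred_eq, ← and_assoc, h0, sysRhs_zero]
  refine and_congr_right fun H => ?_
  constructor
  · intro h
    have : ∀ i, ∀ᵐ x ∂(baseMeasure q w), (weightDensity q w x *ᵥ u x) i = 0 := by
      intro i
      refine ae_eq_zero_of_integral_mul_isTest (locallyIntegrable_mulVec_of_bounded
        (locallyIntegrable_weightDensity q w)
        (measurable_of_locallyBoundedVariationOn H.locallyBoundedVariationOn)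
        (LocallyBoundedVariationOn.exists_bound H.locallyBoundedVariationOn) i) fun φ hφ => ?_
      rw [← weightTerm_eq q w]
      exact h φ hφ i
    filter_upwards [ae_all_iff.2 this] with x hx
    exact funext hx
  · intro h φ _ i
    rw [weightTerm_eq q w, integral_eq_zero_of_ae]
    filter_upwards [h] with x hx
    rw [hx]
    simp

variable {ν : Measure ℝ} [IsLocallyFiniteMeasure ν] {a : ℂ} {Q W : ℝ → Matrix (Fin 2) (Fin 2) ℂ}

theorem IsSystem.comp_add_mem_solSpace (S : IsSystem ν ω a Q W) {u : ℝ → Fin 2 → ℂ}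
    (hu : u ∈ solSpace ν fun x => sysCoeff a (Q x)) :
    (fun x => u (x + ω)) ∈ solSpace ν fun x => sysCoeff a (Q x) := by
  refine (IsPrim.comp_add S.map_add hu).congr_ae ?_
  filter_upwards [S.pot_add] with x hx
  rw [hx]

theorem IsSystem.ae_comp_add (S : IsSystem ν ω a Q W) {p : ℝ → Prop} (h : ∀ᵐ x ∂ν, p x) :
    ∀ᵐ x ∂ν, p (x + ω) :=
  (measurePreserving_add S.map_add).quasiMeasurePreserving.ae h

end Abstract

/-! ### Balanced products and Lagrange's identity -/

section ProductRule

variable {ν : Measure ℝ} [IsLocallyFiniteMeasure ν]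

theorem isPrim_of_right_sub_right {E : Type*} [NormedAddCommGroup E] [NormedSpace ℝ E]
    [CompleteSpace E] {u h : ℝ → E} (hh : LocallyIntegrable h ν)
    (H : ∀ x y, x ≤ y → (u y + (ν.real {y} / 2) • h y) - (u x + (ν.real {x} / 2) • h x)
      = ∫ t in Ioc x y, h t ∂ν) : IsPrim ν u h := by
  refine ⟨hh, u 0 + (ν.real {0} / 2) • h 0, fun x => ?_⟩
  rw [balPrim]
  rcases le_total 0 x with hx | hx
  · rw [intervalIntegral.integral_of_le hx, ← H 0 x hx]
    abel
  · rw [intervalIntegral.integral_of_ge hx, ← H x 0 hx]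
    abel

theorem IsPrim.locallyIntegrable_mul_add_mul {u h v k : ℝ → ℂ} (H : IsPrim ν u h)
    (K : IsPrim ν v k) : LocallyIntegrable (fun t => u t * k t + h t * v t) ν := by
  have bd : ∀ {f g : ℝ → ℂ}, IsPrim ν f g → ∀ R : ℝ, ∃ C, ∀ x ∈ Icc (-R) R, ‖f x‖ ≤ C :=
    fun F R => (exists_norm_le_of_locallyBoundedVariationOn F.locallyBoundedVariationOn R).imp
      fun _ hC => hC.2
  have h1 := locallyIntegrable_mul_of_bounded
    (measurable_of_locallyBoundedVariationOn_complex H.locallyBoundedVariationOn) (bd H) K.1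
  have h2 := locallyIntegrable_mul_of_bounded
    (measurable_of_locallyBoundedVariationOn_complex K.locallyBoundedVariationOn) (bd K) H.1
  have h3 := h1.add h2
  simp only [mul_comm (h _)]
  exact h3

/-- The balanced version of a product of balanced antiderivatives. -/
theorem IsPrim.mul {u h v k : ℝ → ℂ} (H : IsPrim ν u h) (K : IsPrim ν v k) :
    IsPrim ν (fun t => u t * v t + ((ν.real {t} / 2 : ℝ) : ℂ) ^ 2 * (h t * k t))
      fun t => u t * k t + h t * v t := by
  -- The correction arises from averaging the products of the right- and left-hand limits, `(u + d
  -- h)(v + d k)` and `(u - d h)(v - d k)`. The right-hand limit of the balanced product is then the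
  -- first of these, to which the product rule applies.
  refine isPrim_of_right_sub_right (H.locallyIntegrable_mul_add_mul K) fun x y hxy => ?_
  rw [← H.mul_sub_mul K hxy, Complex.real_smul, Complex.real_smul]
  ring

/-- The Wronskian of two vectors. -/
def wronskian (u v : Fin 2 → ℂ) : ℂ := u 0 * v 1 - u 1 * v 0

theorem IsPrim.wronskian_sub_wronskian {u h v k : ℝ → Fin 2 → ℂ} (H : IsPrim ν u h)
    (K : IsPrim ν v k) {x y : ℝ} (hxy : x ≤ y) :
    wronskian (u y + (ν.real {y} / 2) • h y) (v y + (ν.real {y} / 2) • k y)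
      - wronskian (u x + (ν.real {x} / 2) • h x) (v x + (ν.real {x} / 2) • k x)
      = ∫ t in Ioc x y, (wronskian (h t) (v t) + wronskian (u t) (k t)) ∂ν := by
  have H' := isPrim_iff_apply.1 H
  have K' := isPrim_iff_apply.1 K
  have h1 := (H' 0).mul_sub_mul (K' 1) hxy
  have h2 := (H' 1).mul_sub_mul (K' 0) hxy
  have i1 := ((H' 0).locallyIntegrable_mul_add_mul (K' 1)).integrableOn_of_bounded
    (Metric.isBounded_Ioc x y)
  have i2 := ((H' 1).locallyIntegrable_mul_add_mul (K' 0)).integrableOn_of_bounded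
    (Metric.isBounded_Ioc x y)
  have e : (fun t => wronskian (h t) (v t) + wronskian (u t) (k t)) = fun t =>
      (u t 0 * k t 1 + h t 0 * v t 1) - (u t 1 * k t 0 + h t 1 * v t 0) := by
    funext t
    simp only [wronskian]
    ring
  rw [e, integral_sub i1 i2, ← h1, ← h2]
  simp only [wronskian, Pi.add_apply, Pi.smul_apply, Complex.real_smul]
  ring

end ProductRule

/-! ### Pointwise linear algebra -/

section Pointwise

variable {a : ℂ} {Q W : Matrix (Fin 2) (Fin 2) ℂ}

/-- A trace-free matrix preserves the symplectic form infinitesimally; by this the potential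
disappears from Lagrange's identity. -/
theorem wronskian_sysCoeff_add (ha : a ≠ 0) (hQ : Q 1 0 = Q 0 1) (u v : Fin 2 → ℂ) :
    wronskian (sysCoeff a Q *ᵥ u) v + wronskian u (sysCoeff a Q *ᵥ v) = 0 := by
  simp only [wronskian, sysCoeff, mulVec, dotProduct, Fin.sum_univ_two, hQ, of_apply, cons_val_zero,
    cons_val_one, cons_val', cons_val_fin_one]
  field_simp
  ring

theorem wronskian_sysCoeff_sysCoeff (Q : Matrix (Fin 2) (Fin 2) ℂ) (u v : Fin 2 → ℂ) :
    wronskian (sysCoeff a Q *ᵥ u) (sysCoeff a Q *ᵥ v) = (sysCoeff a Q).det * wronskian u v := by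
  simp only [wronskian, mulVec, dotProduct, Fin.sum_univ_two, det_fin_two]
  ring

theorem wronskian_skewInv (u y : Fin 2 → ℂ) : wronskian u (skewInv a y) = (u ⬝ᵥ y) / a := by
  simp only [wronskian, skewInv, dotProduct, Fin.sum_univ_two, cons_val_zero, cons_val_one]
  ring

theorem wronskian_add_right (u v z : Fin 2 → ℂ) :
    wronskian u (v + z) = wronskian u v + wronskian u z := by
  simp only [wronskian, Pi.add_apply]
  ring

theorem dotProduct_mulVec_of_symm (hW : ∀ i j, W i j = W j i) (u f : Fin 2 → ℂ) :
    u ⬝ᵥ (W *ᵥ f) = f ⬝ᵥ (W *ᵥ u) := by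
  simp only [mulVec, dotProduct, Fin.sum_univ_two, hW 1 0]
  ring

theorem det_eq_zero_of_mulVec_eq_zero {u : Fin 2 → ℂ} (hu : u ≠ 0) (h : W *ᵥ u = 0) :
    W.det = 0 :=
  Matrix.exists_mulVec_eq_zero_iff.1 ⟨u, hu, h⟩

theorem ne_zero_apply {u : Fin 2 → ℂ} (hu : u ≠ 0) {z : ℂ} (h0 : u 0 * z = 0)
    (h1 : u 1 * z = 0) : z = 0 := by
  by_contra hz
  refine hu (funext fun i => ?_)
  fin_cases i
  · exact (mul_eq_zero.1 h0).resolve_right hz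
  · exact (mul_eq_zero.1 h1).resolve_right hz

theorem mulVec_eq_zero_of_wronskian_eq_zero {u v : Fin 2 → ℂ} (hu : u ≠ 0) (h : W *ᵥ u = 0)
    (huv : wronskian u v = 0) : W *ᵥ v = 0 := by
  funext i
  have hi := congrFun h i
  simp only [wronskian] at huv
  simp only [mulVec, dotProduct, Fin.sum_univ_two, Pi.zero_apply] at hi ⊢
  refine ne_zero_apply hu ?_ ?_
  · linear_combination v 0 * hi + W i 1 * huv
  · linear_combination v 1 * hi - W i 0 * huv

theorem eq_zero_of_mulVec_eq_zero {u v : Fin 2 → ℂ} (huv : wronskian u v ≠ 0) (hu : W *ᵥ u = 0)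
    (hv : W *ᵥ v = 0) : W = 0 := by
  ext i j
  have h1 := congrFun hu i
  have h2 := congrFun hv i
  simp only [mulVec, dotProduct, Fin.sum_univ_two, Pi.zero_apply] at h1 h2
  refine (mul_eq_zero.1 ?_).resolve_left huv
  fin_cases j
  · simp only [wronskian, Fin.zero_eta]
    linear_combination v 1 * h1 - u 1 * h2
  · simp only [wronskian, Fin.mk_one]
    linear_combination u 0 * h2 - v 0 * h1

/-- For `u ≠ 0` a symmetric `W` with `W u = 0` is `t p pᵀ` with `p = (-u₁, u₀)`. Then the mixed
determinant is `t uᵀ Q u`, and `W G u` is the multiple `-t uᵀ Q u / a` of `p`. So the mixed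
condition is what makes the coefficient map this kernel vector back into the kernel. -/
theorem mulVec_sysCoeff_mulVec_eq_zero (ha : a ≠ 0) (hQ : Q 1 0 = Q 0 1)
    (hW : ∀ i j, W i j = W j i)
    (hmix : Q 0 0 * W 1 1 + Q 1 1 * W 0 0 - 2 * Q 0 1 * W 0 1 = 0) {u : Fin 2 → ℂ}
    (h : W *ᵥ u = 0) : W *ᵥ (sysCoeff a Q *ᵥ u) = 0 := by
  have h0 := congrFun h 0
  have h1 := congrFun h 1
  funext i
  fin_cases i <;>
    simp only [sysCoeff, mulVec, dotProduct, Fin.sum_univ_two, hQ, hW 1 0, of_apply, cons_val_zero,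
      cons_val_one, cons_val', cons_val_fin_one, Pi.zero_apply, Fin.zero_eta, Fin.mk_one,
      Fin.isValue] at h0 h1 ⊢
  · have e : W 0 0 * (Q 0 1 * u 0 + Q 1 1 * u 1) - W 0 1 * (Q 0 0 * u 0 + Q 0 1 * u 1) = 0 := by
      linear_combination u 1 * hmix + Q 0 1 * h0 - Q 0 0 * h1
    field_simp
    linear_combination e
  · have e : W 0 1 * (Q 0 1 * u 0 + Q 1 1 * u 1) - W 1 1 * (Q 0 0 * u 0 + Q 0 1 * u 1) = 0 := by
      linear_combination (-u 0) * hmix + Q 1 1 * h0 - Q 0 1 * h1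
    field_simp
    linear_combination e

/-- A positive semidefinite matrix with kernel vector `u` is a multiple of the orthogonal
projection onto the complement of `u`. -/
theorem dotProduct_mulVec_mul_normSq (hW : W.PosSemidef) (hs : ∀ i j, W i j = W j i)
    {u : Fin 2 → ℂ} (h : W *ᵥ u = 0) (v : Fin 2 → ℂ) :
    (star v ⬝ᵥ (W *ᵥ v)).re * (Complex.normSq (u 0) + Complex.normSq (u 1))
      = (W 0 0 + W 1 1).re * Complex.normSq (wronskian u v) := by
  have hreal : ∀ i j, (starRingEnd ℂ) (W i j) = W i j := fun i j => by
    rw [starRingEnd_apply, hW.1.apply, hs]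
  have h0 := congrFun h 0
  have h1 := congrFun h 1
  simp only [mulVec, dotProduct, Fin.sum_univ_two, Pi.zero_apply, hs 1 0] at h0 h1
  have h0' := congrArg (starRingEnd ℂ) h0
  have h1' := congrArg (starRingEnd ℂ) h1
  simp only [map_add, map_mul, map_zero, hreal] at h0' h1'
  have e1 : (((star v ⬝ᵥ (W *ᵥ v)).re : ℝ) : ℂ) = star v ⬝ᵥ (W *ᵥ v) :=
    Complex.ext rfl (Complex.le_def.1 (hW.dotProduct_mulVec_nonneg v)).2
  have e2 : (((W 0 0 + W 1 1).re : ℝ) : ℂ) = W 0 0 + W 1 1 := by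
    rw [← Complex.conj_eq_iff_re, map_add, hreal, hreal]
  have key : (((star v ⬝ᵥ (W *ᵥ v)).re * (Complex.normSq (u 0) + Complex.normSq (u 1)) : ℝ) : ℂ)
      = (((W 0 0 + W 1 1).re * Complex.normSq (wronskian u v) : ℝ) : ℂ) := by
    push_cast
    rw [← Complex.mul_conj, ← Complex.mul_conj, ← Complex.mul_conj]
    rw [e1, e2]
    simp only [wronskian, map_sub, map_mul, mulVec, dotProduct, Fin.sum_univ_two, Pi.star_apply,
      hs 1 0, Complex.star_def]
    linear_combination
      ((starRingEnd ℂ) (u 0) * (starRingEnd ℂ) (v 0) * v 0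
        + (starRingEnd ℂ) (u 1) * (starRingEnd ℂ) (v 0) * v 1
        - (starRingEnd ℂ) (u 0) * (starRingEnd ℂ) (v 1) * v 1) * h0
      + (-u 1 * (starRingEnd ℂ) (v 0) * v 0 + u 0 * (starRingEnd ℂ) (v 0) * v 1
        + u 1 * (starRingEnd ℂ) (v 1) * v 1) * h1'
      + (starRingEnd ℂ) (u 0) * (starRingEnd ℂ) (v 1) * v 0 * h1
      + u 1 * (starRingEnd ℂ) (v 1) * v 0 * h0'
  exact_mod_cast key

end Pointwise

/-! ### Constancy of the Wronskian and variation of parameters -/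

section Wronskian

theorem normSq_add_normSq_pos {v : Fin 2 → ℂ} (hv : v ≠ 0) :
    0 < Complex.normSq (v 0) + Complex.normSq (v 1) := by
  have n0 := Complex.normSq_nonneg (v 0)
  have n1 := Complex.normSq_nonneg (v 1)
  refine lt_of_le_of_ne (add_nonneg n0 n1) fun hz => hv ?_
  have h0 : v 0 = 0 := Complex.normSq_eq_zero.1 (by linarith)
  have h1 : v 1 = 0 := Complex.normSq_eq_zero.1 (by linarith)
  ext i
  fin_cases i <;> assumption

theorem mulVec_mulVec_of_trace_eq_zero {A : Matrix (Fin 2) (Fin 2) ℂ} (hA : A 1 1 = -A 0 0)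
    (v : Fin 2 → ℂ) : A *ᵥ (A *ᵥ v) = -A.det • v := by
  ext i
  fin_cases i <;> simp [mulVec, dotProduct, Fin.sum_univ_two, det_fin_two, hA] <;> ring

variable {ν : Measure ℝ} [IsLocallyFiniteMeasure ν] {ω : ℝ} {a : ℂ}
  {Q W : ℝ → Matrix (Fin 2) (Fin 2) ℂ}

theorem apply_of_ae_of_singleton {p : ℝ → Prop} (h : ∀ᵐ x ∂ν, p x) {x : ℝ} (hx : ν {x} ≠ 0) :
    p x := by
  by_contra hne
  exact hx (measure_mono_null (by simpa using hne) (ae_iff.1 h))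

theorem IsSystem.apply_ne_zero (S : IsSystem ν ω a Q W) {u : ℝ → Fin 2 → ℂ}
    (hu : IsPrim ν u fun x => sysCoeff a (Q x) *ᵥ u x) (h0 : u ≠ 0) (x : ℝ) : u x ≠ 0 :=
  fun hx => h0 (funext fun y => hu.eq_zero_of_apply_eq_zero S.regular hx y)

/-- The Wronskian of a solution annihilated by the weight with any solution of an inhomogeneous
equation is, up to the determinant of the jump, constant. -/
theorem IsSystem.exists_wronskian_mul_eq (S : IsSystem ν ω a Q W) {v u f : ℝ → Fin 2 → ℂ}
    (hv : IsPrim ν v fun x => sysCoeff a (Q x) *ᵥ v x) (hWv : ∀ᵐ x ∂ν, W x *ᵥ v x = 0)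
    (hu : IsPrim ν u fun x => sysCoeff a (Q x) *ᵥ u x + skewInv a (W x *ᵥ f x)) :
    ∃ c, ∀ x, wronskian (v x) (u x) * jumpDet ν (fun x => sysCoeff a (Q x)) x = c := by
  set G : ℝ → Matrix (Fin 2) (Fin 2) ℂ := fun x => sysCoeff a (Q x) with hG
  have ha := S.ne_zero
  have h1 : ∀ {x}, W x *ᵥ v x = 0 → wronskian (v x) (skewInv a (W x *ᵥ f x)) = 0 := by
    intro x hx
    rw [wronskian_skewInv, dotProduct_mulVec_of_symm (S.symm_weight x), hx]
    simp
  have h2 : ∀ {x}, ν {x} ≠ 0 → wronskian (G x *ᵥ v x) (skewInv a (W x *ᵥ f x)) = 0 := by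
    intro x hx
    have hWx := apply_of_ae_of_singleton hWv hx
    by_cases h0 : v x = 0
    · simp [h0, wronskian]
    rw [wronskian_skewInv, dotProduct_mulVec_of_symm (S.symm_weight x), hG,
      mulVec_sysCoeff_mulVec_eq_zero ha (S.symm_pot x) (S.symm_weight x)
        (S.mixed x hx (det_eq_zero_of_mulVec_eq_zero h0 hWx)) hWx]
    simp
  -- The Wronskian of the right-hand limits is a quadratic polynomial in `d = ν{x}/2`: the linear
  -- term vanishes by symmetry, and the quadratic one is `det G` times the Wronskian, because at
  -- atoms `G v` too is killed by the weight.
  have key : ∀ x, wronskian (v x + (ν.real {x} / 2) • (G x *ᵥ v x))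
      (u x + (ν.real {x} / 2) • (G x *ᵥ u x + skewInv a (W x *ᵥ f x)))
      = wronskian (v x) (u x) * jumpDet ν G x := by
    intro x
    by_cases hx : ν {x} = 0
    · simp [jumpDet, Measure.real, hx]
    have e1 := h1 (apply_of_ae_of_singleton hWv hx)
    have e2 := h2 hx
    have e3 := wronskian_sysCoeff_add ha (S.symm_pot x) (v x) (u x)
    have e4 := wronskian_sysCoeff_sysCoeff (a := a) (Q x) (v x) (u x)
    simp only [wronskian, hG, jumpDet, Pi.add_apply, Pi.smul_apply, Complex.real_smul]
      at e1 e2 e3 e4 ⊢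
    linear_combination ((ν.real {x} / 2 : ℝ) : ℂ) * (e1 + e3)
      + ((ν.real {x} / 2 : ℝ) : ℂ) ^ 2 * (e2 + e4)
  have hconst : ∀ x y, x ≤ y → wronskian (v y) (u y) * jumpDet ν G y
      = wronskian (v x) (u x) * jumpDet ν G x := by
    intro x y hxy
    rw [← key, ← key, ← sub_eq_zero, hv.wronskian_sub_wronskian hu hxy]
    refine integral_eq_zero_of_ae ?_
    filter_upwards [ae_restrict_of_ae hWv] with t ht
    rw [wronskian_add_right, ← add_assoc, wronskian_sysCoeff_add ha (S.symm_pot t), h1 ht]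
    simp
  refine ⟨wronskian (v 0) (u 0) * jumpDet ν G 0, fun x => ?_⟩
  rcases le_total 0 x with hx | hx
  · exact hconst 0 x hx
  · exact (hconst x 0 hx).symm

theorem IsSystem.exists_wronskian_mul_eq_of_homogeneous (S : IsSystem ν ω a Q W)
    {v u : ℝ → Fin 2 → ℂ}
    (hv : IsPrim ν v fun x => sysCoeff a (Q x) *ᵥ v x) (hWv : ∀ᵐ x ∂ν, W x *ᵥ v x = 0)
    (hu : IsPrim ν u fun x => sysCoeff a (Q x) *ᵥ u x) :
    ∃ c, ∀ x, wronskian (v x) (u x) * jumpDet ν (fun x => sysCoeff a (Q x)) x = c := by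
  refine S.exists_wronskian_mul_eq (f := 0) hv hWv ?_
  convert hu using 2 with x
  ext i
  fin_cases i <;> simp [skewInv]

/-- Variation of parameters: in the presence of a solution annihilated by the weight, the
inhomogeneous equation always has a solution annihilated by the weight. -/
theorem IsSystem.exists_isPrim_mulVec_eq_zero (S : IsSystem ν ω a Q W) {u₀ f : ℝ → Fin 2 → ℂ}
    (hu : IsPrim ν u₀ fun x => sysCoeff a (Q x) *ᵥ u₀ x) (hWu : ∀ᵐ x ∂ν, W x *ᵥ u₀ x = 0)
    (h0 : u₀ ≠ 0) (hf : ∀ i, LocallyIntegrable (fun x => (W x *ᵥ f x) i) ν) :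
    ∃ u, IsPrim ν u (fun x => sysCoeff a (Q x) *ᵥ u x + skewInv a (W x *ᵥ f x)) ∧
      ∀ᵐ x ∂ν, W x *ᵥ u x = 0 := by
  have ha := S.ne_zero
  set G : ℝ → Matrix (Fin 2) (Fin 2) ℂ := fun x => sysCoeff a (Q x) with hG
  -- With this initial value the Wronskian of `u₀` and `v` at `0` is `|u₀ 0|²`, so `v` is
  -- independent of `u₀`.
  obtain ⟨v, hv, hv0⟩ := exists_isPrim_homogeneous_apply S.regular 0
    ![-(starRingEnd ℂ) (u₀ 0 1), (starRingEnd ℂ) (u₀ 0 0)]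
  obtain ⟨c, hc⟩ := S.exists_wronskian_mul_eq_of_homogeneous hu hWu hv
  have hc0 : c ≠ 0 := by
    rw [← hc 0]
    refine mul_ne_zero ?_ (S.regular.jumpDet_ne_zero 0)
    have e : wronskian (u₀ 0) (v 0)
        = ((Complex.normSq (u₀ 0 0) + Complex.normSq (u₀ 0 1) : ℝ) : ℂ) := by
      rw [hv0]
      push_cast
      rw [← Complex.mul_conj, ← Complex.mul_conj]
      simp [wronskian]
    rw [e]
    intro hz
    exact (normSq_add_normSq_pos (S.apply_ne_zero hu h0 0)).ne' (by exact_mod_cast hz)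
  -- The coefficient of `u₀` in variation of parameters. The coefficient of `v` would be the
  -- antiderivative of a multiple of `u₀ · W f`, which vanishes.
  set g : ℝ → ℂ := fun x => (-(a * c)⁻¹) * (v x ⬝ᵥ (W x *ᵥ f x)) with hg
  have hgi : LocallyIntegrable g ν := by
    have hvm := measurable_of_locallyBoundedVariationOn hv.locallyBoundedVariationOn
    have hvb := LocallyBoundedVariationOn.exists_bound hv.locallyBoundedVariationOn
    have h : ∀ i, LocallyIntegrable (fun x => v x i * (W x *ᵥ f x) i) ν := fun i =>
      locallyIntegrable_mul_of_bounded ((measurable_pi_apply i).comp hvm)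
        (fun R => (hvb R).imp fun _ hC x hx => (norm_le_pi_norm (v x) i).trans (hC x hx)) (hf i)
    have := ((h 0).add (h 1)).smul (-(a * c)⁻¹)
    simp only [hg, dotProduct, Fin.sum_univ_two]
    exact this
  have hα : IsPrim ν (balPrim ν g) g := ⟨hgi, 0, fun x => (zero_add _).symm⟩
  set α := balPrim ν g with hαdef
  have hP := fun i => hα.mul (isPrim_iff_apply.1 hu i)
  set d : ℝ → ℂ := fun x => (ν.real {x} / 2 : ℝ) with hd
  -- This is the balanced version of `α u₀`; the second term is present only at atoms.
  set u : ℝ → Fin 2 → ℂ := fun x => α x • u₀ x + (d x ^ 2 * g x) • (G x *ᵥ u₀ x) with hudef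
  have hu' : IsPrim ν u fun x => α x • (G x *ᵥ u₀ x) + g x • u₀ x := by
    refine isPrim_iff_apply.2 fun i => ?_
    have e : (fun x => u x i) = fun x => α x * u₀ x i + d x ^ 2 * (g x * (G x *ᵥ u₀ x) i) := by
      funext x
      simp only [hudef, Pi.add_apply, Pi.smul_apply, smul_eq_mul]
      ring
    rw [e]
    exact hP i
  refine ⟨u, hu'.congr_ae ?_, ?_⟩
  · filter_upwards [hWu] with x hx
    have h1 : u₀ x ⬝ᵥ (W x *ᵥ f x) = 0 := by
      rw [dotProduct_mulVec_of_symm (S.symm_weight x), hx]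
      simp
    have hcx := hc x
    have hG2 := mulVec_mulVec_of_trace_eq_zero (S.regular.trace_eq_zero x) (u₀ x)
    -- Since `u₀ · W f = 0`, the vector `J⁻¹ W f` is a multiple of `u₀`. The jump determinant in the
    -- factor compensates the term `-d² g det(G) u₀` which `G` produces from the correction in `u`.
    have hk : skewInv a (W x *ᵥ f x) = (jumpDet ν G x * g x) • u₀ x := by
      rw [hg]
      simp only [dotProduct, Fin.sum_univ_two, wronskian] at h1 hcx ⊢
      generalize W x *ᵥ f x = y at h1 ⊢
      ext i
      fin_cases i <;> simp only [skewInv, Fin.zero_eta, Fin.mk_one, Fin.isValue, cons_val_zero,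
        cons_val_one, Pi.smul_apply, smul_eq_mul, mul_inv]
      · have e : c * y 1 = jumpDet ν G x * (v x 0 * y 0 + v x 1 * y 1) * u₀ x 0 := by
          rw [← hcx]
          linear_combination (-jumpDet ν G x * v x 0) * h1
        field_simp
        linear_combination -e
      · have e : c * y 0 = -(jumpDet ν G x * (v x 0 * y 0 + v x 1 * y 1) * u₀ x 1) := by
          rw [← hcx]
          linear_combination (jumpDet ν G x * v x 1) * h1
        field_simp
        linear_combination e
    rw [hk, hudef]
    show _ = G x *ᵥ (α x • u₀ x + (d x ^ 2 * g x) • (G x *ᵥ u₀ x)) + _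
    rw [mulVec_add, mulVec_smul, mulVec_smul, hG2, jumpDet]
    simp only [hd]
    module
  · filter_upwards [hWu] with x hx
    show W x *ᵥ (α x • u₀ x + (d x ^ 2 * g x) • (G x *ᵥ u₀ x)) = 0
    rw [mulVec_add, mulVec_smul, mulVec_smul, hx, smul_zero, zero_add]
    by_cases hνx : ν {x} = 0
    · simp [hd, Measure.real, hνx]
    · rw [hG, mulVec_sysCoeff_mulVec_eq_zero ha (S.symm_pot x) (S.symm_weight x)
        (S.mixed x hνx (det_eq_zero_of_mulVec_eq_zero (S.apply_ne_zero hu h0 x) hx)) hx, smul_zero]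

end Wronskian

/-! ### Solutions of finite norm have norm zero -/

section Periodicity

variable {ν : Measure ℝ} {ω : ℝ}

/-- A finite measure on the line which is invariant under a translation vanishes. -/
theorem eq_zero_of_map_add_eq {μ : Measure ℝ} [IsFiniteMeasure μ] (hω : 0 < ω)
    (h : μ.map (· + ω) = μ) : μ = 0 := by
  have hn : ∀ n : ℕ, ∀ x : ℝ, μ (Iic (x + n * ω)) = μ (Iic x) := by
    intro n
    induction n with
    | zero => simp
    | succ k ih =>
      intro x
      rw [← ih x]
      nth_rewrite 1 [← h]
      rw [(measurableEmbedding_addRight ω).map_apply]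
      congr 1
      ext y
      simp only [mem_preimage, mem_Iic]
      push_cast
      constructor <;> intro h <;> linarith
  have htop : Tendsto (fun n : ℕ => (n : ℝ) * ω) atTop atTop :=
    tendsto_natCast_atTop_atTop.atTop_mul_const hω
  have h1 : ∀ x, μ (Iic x) = μ univ := by
    intro x
    refine tendsto_nhds_unique ?_ ((tendsto_measure_Iic_atTop μ).comp
      (tendsto_atTop_add_const_left _ x htop))
    simp only [Function.comp_def, hn]
    exact tendsto_const_nhds
  have h2 : ∀ x, μ (Ioi x) = 0 := by
    intro x
    rw [← compl_Iic, measure_compl measurableSet_Iic (measure_ne_top _ _), h1, tsub_self]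
  have h3 : (⋃ n : ℕ, Ioi (-(n : ℝ))) = univ := by
    refine eq_univ_of_forall fun x => mem_iUnion.2 ?_
    obtain ⟨n, hn⟩ := exists_nat_gt (-x)
    exact ⟨n, by simp only [mem_Ioi]; linarith⟩
  rw [← Measure.measure_univ_eq_zero, ← h3, measure_iUnion_null fun n => h2 _]

/-- Translation invariance of `ν` gives `∫ F = κ ∫ F`. A finite nonzero integral would force `κ =
1`, and `F dν` would be a nonzero finite measure invariant under a translation. -/
theorem lintegral_eq_zero_of_ae_add [SFinite ν] {F : ℝ → ℝ≥0∞} (hω : 0 < ω)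
    (hν : ν.map (· + ω) = ν) (hF : Measurable F) {κ : ℝ≥0∞}
    (h : ∀ᵐ x ∂ν, F (x + ω) = κ * F x) (hfin : ∫⁻ x, F x ∂ν ≠ ∞) : ∫⁻ x, F x ∂ν = 0 := by
  have hmp : MeasurePreserving (· + ω) ν ν := ⟨measurable_add_const ω, hν⟩
  have hemb := measurableEmbedding_addRight ω
  have e : ∫⁻ x, F x ∂ν = κ * ∫⁻ x, F x ∂ν := by
    rw [← lintegral_const_mul _ hF, ← lintegral_congr_ae h, hmp.lintegral_comp_emb hemb]
  by_contra hne
  have hκ : κ = 1 := by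
    have : 1 * ∫⁻ x, F x ∂ν = κ * ∫⁻ x, F x ∂ν := by rwa [one_mul]
    exact ((ENNReal.mul_left_inj hne hfin).1 this).symm
  have : IsFiniteMeasure (ν.withDensity F) := isFiniteMeasure_withDensity hfin
  have hinv : (ν.withDensity F).map (· + ω) = ν.withDensity F := by
    ext s hs
    rw [Measure.map_apply (measurable_add_const ω) hs, withDensity_apply _ hs,
      withDensity_apply _ (measurable_add_const ω hs),
      ← hmp.setLIntegral_comp_preimage_emb hemb F s]
    refine lintegral_congr_ae (ae_restrict_of_ae ?_)
    filter_upwards [h] with x hx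
    rw [hx, hκ, one_mul]
  have h0 := eq_zero_of_map_add_eq hω hinv
  apply hne
  have := congrArg (fun m : Measure ℝ => m univ) h0
  simpa [withDensity_apply _ MeasurableSet.univ] using this

variable [IsLocallyFiniteMeasure ν] {a : ℂ} {Q W : ℝ → Matrix (Fin 2) (Fin 2) ℂ}

theorem jumpDet_add (hν : ν.map (· + ω) = ν) (hQ : ∀ᵐ x ∂ν, Q (x + ω) = Q x) :
    ∀ᵐ x ∂ν, jumpDet ν (fun x => sysCoeff a (Q x)) (x + ω)
      = jumpDet ν (fun x => sysCoeff a (Q x)) x := by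
  filter_upwards [hQ] with x hx
  rw [jumpDet, jumpDet, real_singleton_add hν, hx]

/-- In the presence of a solution annihilated by the weight, any solution of finite norm of the
inhomogeneous equation is annihilated by the weight. -/
theorem IsSystem.ae_mulVec_eq_zero (S : IsSystem ν ω a Q W) (hω : 0 < ω)
    {v u f : ℝ → Fin 2 → ℂ}
    (hv : IsPrim ν v fun x => sysCoeff a (Q x) *ᵥ v x) (hWv : ∀ᵐ x ∂ν, W x *ᵥ v x = 0)
    (h0 : v ≠ 0) (hu : IsPrim ν u fun x => sysCoeff a (Q x) *ᵥ u x + skewInv a (W x *ᵥ f x))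
    (hfin : ∫⁻ x, ENNReal.ofReal (star (u x) ⬝ᵥ (W x *ᵥ u x)).re ∂ν < ∞) :
    ∀ᵐ x ∂ν, W x *ᵥ u x = 0 := by
  set k := jumpDet ν fun x => sysCoeff a (Q x) with hk
  have hk0 : ∀ x, k x ≠ 0 := S.regular.jumpDet_ne_zero
  have hv0 := S.apply_ne_zero hv h0
  obtain ⟨c, hc⟩ := S.exists_wronskian_mul_eq hv hWv hu
  -- For `c = 0` the vector `u x` is a multiple of `v x` at every point. For `c ≠ 0` it is shown
  -- that the weight itself vanishes.
  by_cases hc0 : c = 0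
  · filter_upwards [hWv] with x hx
    refine mulVec_eq_zero_of_wronskian_eq_zero (hv0 x) hx ?_
    exact (mul_eq_zero.1 ((hc x).trans hc0)).resolve_right (hk0 x)
  suffices hW0 : ∀ᵐ x ∂ν, W x = 0 by
    filter_upwards [hW0] with x hx
    rw [hx, zero_mulVec]
  have hv' := S.comp_add_mem_solSpace hv
  have hWv' : ∀ᵐ x ∂ν, W x *ᵥ v (x + ω) = 0 := by
    filter_upwards [S.ae_comp_add hWv, S.weight_add] with x hx hx'
    rwa [← hx']
  obtain ⟨e, he⟩ := S.exists_wronskian_mul_eq_of_homogeneous hv hWv hv'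
  -- If the translate of `v` is independent of `v`, the weight has two independent kernel vectors at
  -- almost every point. Otherwise `v` is a Floquet solution with multiplier `ρ`.
  by_cases he0 : e = 0
  swap
  · filter_upwards [hWv, hWv'] with x hx hx'
    refine eq_zero_of_mulVec_eq_zero (fun hw => he0 ?_) hx hx'
    rw [← he x, hw, zero_mul]
  obtain ⟨ρ, hρ⟩ : ∃ ρ : ℂ, v (0 + ω) = ρ • v 0 := by
    have hw : wronskian (v 0) (v (0 + ω)) = 0 :=
      (mul_eq_zero.1 ((he 0).trans he0)).resolve_right (hk0 0)
    rw [wronskian] at hw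
    by_cases h00 : v 0 0 = 0
    · have h01 : v 0 1 ≠ 0 := fun h01 => hv0 0 (funext fun i => by fin_cases i <;> assumption)
      refine ⟨v (0 + ω) 1 / v 0 1, funext fun i => ?_⟩
      fin_cases i <;> simp only [Fin.zero_eta, Fin.mk_one, Pi.smul_apply, smul_eq_mul]
      · field_simp
        linear_combination -hw
      · field_simp
    · refine ⟨v (0 + ω) 0 / v 0 0, funext fun i => ?_⟩
      fin_cases i <;> simp only [Fin.zero_eta, Fin.mk_one, Pi.smul_apply, smul_eq_mul]
      · field_simp
      · field_simp
        linear_combination hw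
  have hper : ∀ x, v (x + ω) = ρ • v x := by
    intro x
    have hd := (solSpace ν fun x => sysCoeff a (Q x)).sub_mem hv'
      ((solSpace ν fun x => sysCoeff a (Q x)).smul_mem ρ hv)
    have := IsPrim.eq_zero_of_apply_eq_zero S.regular hd (a := 0) (sub_eq_zero.2 hρ) x
    exact sub_eq_zero.1 this
  have hρ0 : ρ ≠ 0 := by
    rintro rfl
    exact hv0 (0 + ω) (by rw [hρ, zero_smul])
  set N : ℝ → ℝ := fun x => Complex.normSq (v x 0) + Complex.normSq (v x 1) with hN
  have hNpos : ∀ x, 0 < N x := fun x => normSq_add_normSq_pos (hv0 x)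
  -- Up to the constant `|c|²` this is the density `u* W u`: a positive semidefinite `W` with kernel
  -- vector `v` depends only on its trace and `v`, and the modulus of the Wronskian is `|c| / |k|`.
  set F : ℝ → ℝ := fun x => (W x 0 0 + W x 1 1).re / (N x * Complex.normSq (k x)) with hF
  have htr : ∀ x, 0 ≤ (W x 0 0 + W x 1 1).re := fun x =>
    add_nonneg (Complex.le_def.1 (S.posSemidef x).diag_nonneg).1
      (Complex.le_def.1 (S.posSemidef x).diag_nonneg).1
  have hcpos : 0 < Complex.normSq c := Complex.normSq_pos.2 hc0
  have hFu : ∀ᵐ x ∂ν, ENNReal.ofReal (star (u x) ⬝ᵥ (W x *ᵥ u x)).re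
      = ENNReal.ofReal (Complex.normSq c) * ENNReal.ofReal (F x) := by
    filter_upwards [hWv] with x hx
    have h1 := dotProduct_mulVec_mul_normSq (S.posSemidef x) (S.symm_weight x) hx (u x)
    have h2 := congrArg Complex.normSq (hc x)
    rw [map_mul] at h2
    change _ * N x = _ at h1
    change _ * Complex.normSq (k x) = _ at h2
    rw [← ENNReal.ofReal_mul hcpos.le, hF, ← h2]
    congr 1
    have hkx := (Complex.normSq_pos.2 (hk0 x)).ne'
    have hNx := (hNpos x).ne'
    field_simp
    linear_combination h1
  have hvm := measurable_of_locallyBoundedVariationOn hv.locallyBoundedVariationOn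
  have hFm : Measurable F := by
    have hvi := fun i => (measurable_pi_apply i).comp hvm
    have hns := Complex.continuous_normSq.measurable
    exact (Complex.measurable_re.comp
      ((S.measurable_weight 0 0).add (S.measurable_weight 1 1))).div
      (((hns.comp (hvi 0)).add (hns.comp (hvi 1))).mul
        (hns.comp (measurable_jumpDet S.regular.measurable)))
  have hFfin : ∫⁻ x, ENNReal.ofReal (F x) ∂ν ≠ ∞ := by
    rw [lintegral_congr_ae hFu, lintegral_const_mul _ hFm.ennreal_ofReal] at hfin
    intro hinf
    rw [hinf, ENNReal.mul_top (by simpa using hcpos)] at hfin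
    exact lt_irrefl _ hfin
  have hFper : ∀ᵐ x ∂ν, ENNReal.ofReal (F (x + ω))
      = ENNReal.ofReal (Complex.normSq ρ)⁻¹ * ENNReal.ofReal (F x) := by
    filter_upwards [S.weight_add, jumpDet_add (a := a) S.map_add S.pot_add] with x h1 h2
    rw [← ENNReal.ofReal_mul (inv_nonneg.2 (Complex.normSq_nonneg _)), hF]
    congr 1
    have hρn := (Complex.normSq_pos.2 hρ0).ne'
    have hNx : N (x + ω) = Complex.normSq ρ * N x := by
      simp only [hN, hper, Pi.smul_apply, smul_eq_mul, map_mul]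
      ring
    simp only [h1, hk, h2, hNx]
    field_simp
  have hzero := lintegral_eq_zero_of_ae_add hω S.map_add hFm.ennreal_ofReal hFper hFfin
  rw [lintegral_eq_zero_iff hFm.ennreal_ofReal] at hzero
  filter_upwards [hzero] with x hx
  have hFx : F x ≤ 0 := ENNReal.ofReal_eq_zero.1 hx
  have hden : 0 < N x * Complex.normSq (k x) :=
    mul_pos (hNpos x) (Complex.normSq_pos.2 (hk0 x))
  have ht : (W x 0 0 + W x 1 1).re ≤ 0 := by
    by_contra hlt
    exact absurd hFx (not_le.2 (div_pos (not_le.1 hlt) hden))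
  rw [← (S.posSemidef x).trace_eq_zero_iff, trace_fin_two]
  refine Complex.ext (le_antisymm ht (htr x)) ?_
  have him := fun i => (Complex.le_def.1 ((S.posSemidef x).diag_nonneg (i := i))).2
  simp [← him 0, ← him 1]

end Periodicity

/-! ### Solutions killed by the weight on a half-line -/

section Annihilator

variable {ν : Measure ℝ} [IsLocallyFiniteMeasure ν] {ω : ℝ} {a : ℂ}
  {Q W : ℝ → Matrix (Fin 2) (Fin 2) ℂ}

/-- The solutions of the homogeneous equation which are annihilated by the weight on a set. -/
def annihilated (ν : Measure ℝ) [IsLocallyFiniteMeasure ν] (a : ℂ)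
    (Q W : ℝ → Matrix (Fin 2) (Fin 2) ℂ) (E : Set ℝ) :
    Submodule ℂ (solSpace ν fun x => sysCoeff a (Q x)) where
  carrier := {y | ∀ᵐ x ∂ν, x ∈ E → W x *ᵥ (y : ℝ → Fin 2 → ℂ) x = 0}
  add_mem' {y z} hy hz := by
    simp only [mem_ofPred_eq] at hy hz ⊢
    filter_upwards [hy, hz] with x h1 h2 hx
    rw [Submodule.coe_add, Pi.add_apply, mulVec_add, h1 hx, h2 hx, add_zero]
  zero_mem' := by
    simp only [mem_ofPred_eq]
    exact Eventually.of_forall fun x _ => mulVec_zero _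
  smul_mem' c y hy := by
    simp only [mem_ofPred_eq] at hy ⊢
    filter_upwards [hy] with x h1 hx
    rw [Submodule.coe_smul, Pi.smul_apply, mulVec_smul, h1 hx, smul_zero]

theorem mem_annihilated {E : Set ℝ} {y : solSpace ν fun x => sysCoeff a (Q x)} :
    y ∈ annihilated ν a Q W E ↔ ∀ᵐ x ∂ν, x ∈ E → W x *ᵥ (y : ℝ → Fin 2 → ℂ) x = 0 := Iff.rfl

/-- Translation of the solutions of the homogeneous equation by the period. -/
def translate (S : IsSystem ν ω a Q W) :
    (solSpace ν fun x => sysCoeff a (Q x)) →ₗ[ℂ] (solSpace ν fun x => sysCoeff a (Q x)) where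
  toFun y := ⟨fun x => (y : ℝ → Fin 2 → ℂ) (x + ω), S.comp_add_mem_solSpace y.2⟩
  map_add' _ _ := rfl
  map_smul' _ _ := rfl

theorem translate_injective (S : IsSystem ν ω a Q W) : Function.Injective (translate S) := by
  rw [injective_iff_map_eq_zero]
  intro y hy
  ext1
  funext x
  have := congrFun (congrArg Subtype.val hy) (x - ω)
  simpa [translate] using this

/-- A solution annihilated on a set which contains its translate is annihilated on the preimage
of that set under translation. -/
theorem IsSystem.mem_annihilated_preimage (S : IsSystem ν ω a Q W) {E : Set ℝ}
    (hE : ∀ x ∈ E, x + ω ∈ E) {y : solSpace ν fun x => sysCoeff a (Q x)}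
    (hy : y ∈ annihilated ν a Q W E) : y ∈ annihilated ν a Q W ((· + ω) ⁻¹' E) := by
  have := finiteDimensional_solSpace S.regular
  have hshift : ∀ z ∈ annihilated ν a Q W E,
      translate S z ∈ annihilated ν a Q W ((· + ω) ⁻¹' E) := by
    intro z hz
    rw [mem_annihilated] at hz ⊢
    filter_upwards [S.ae_comp_add hz, S.weight_add] with x h1 h2 hx
    rw [← h2]
    exact h1 hx
  -- Translation maps this finite-dimensional space injectively into itself, hence onto itself. So
  -- `y` is the translate of a solution killed on `E` and is therefore killed on the preimage of
  -- `E`.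
  have hle : (annihilated ν a Q W E).map (translate S) ≤ annihilated ν a Q W E := by
    rintro _ ⟨z, hz, rfl⟩
    rw [mem_annihilated]
    filter_upwards [mem_annihilated.1 (hshift z hz)] with x hx hxE
    exact hx (hE x hxE)
  have heq := Submodule.eq_of_le_of_finrank_eq hle
    (Submodule.equivMapOfInjective _ (translate_injective S) _).finrank_eq.symm
  rw [← heq] at hy
  obtain ⟨z, hz, rfl⟩ := hy
  exact hshift z hz

/-- A solution annihilated by the weight on a half-line is annihilated everywhere. -/
theorem IsSystem.ae_mulVec_eq_zero_of_mem_annihilated (S : IsSystem ν ω a Q W) {E : Set ℝ}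
    (hE : ∀ x ∈ E, x + ω ∈ E) (hcov : ∀ x, ∃ m : ℕ, x + m * ω ∈ E)
    {y : solSpace ν fun x => sysCoeff a (Q x)} (hy : y ∈ annihilated ν a Q W E) :
    ∀ᵐ x ∂ν, W x *ᵥ (y : ℝ → Fin 2 → ℂ) x = 0 := by
  have h : ∀ m : ℕ, y ∈ annihilated ν a Q W {x | x + m * ω ∈ E} := by
    intro m
    induction m with
    | zero => simpa using hy
    | succ m ih =>
      have := S.mem_annihilated_preimage (fun x hx => by
        have := hE _ hx
        simp only [mem_ofPred_eq] at hx ⊢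
        convert this using 1
        ring) ih
      convert this using 3 with x
      push_cast
      rw [preimage_ofPred_eq]
      ext x
      simp only [mem_ofPred_eq]
      rw [show x + (m + 1) * ω = x + ω + m * ω by ring]
  filter_upwards [ae_all_iff.2 fun m => mem_annihilated.1 (h m)] with x hx
  obtain ⟨m, hm⟩ := hcov x
  exact hx m hm

end Annihilator

/-! ### Cut-off right-hand sides when no nonzero solution is killed -/

section Converse

variable {ν : Measure ℝ} [IsLocallyFiniteMeasure ν] {ω : ℝ} {a : ℂ}
  {Q W : ℝ → Matrix (Fin 2) (Fin 2) ℂ}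

/-- Beyond `b` the function `u` agrees with the homogeneous solution on the line that has the same
right-hand limit at `b`. This solution is killed by the weight on a half-line, hence everywhere, and
so is zero. Only the right-hand limit is reached, because the equation at `b` itself may be
inhomogeneous. -/
theorem IsSystem.right_eq_zero (S : IsSystem ν ω a Q W) (hω : 0 < ω)
    (hL : ∀ y : ℝ → Fin 2 → ℂ, IsPrim ν y (fun x => sysCoeff a (Q x) *ᵥ y x) →
      (∀ᵐ x ∂ν, W x *ᵥ y x = 0) → y = 0) {u h : ℝ → Fin 2 → ℂ} (hu : IsPrim ν u h) {b : ℝ}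
    (hh : ∀ x, b < x → h x = sysCoeff a (Q x) *ᵥ u x) (hWu : ∀ᵐ x ∂ν, W x *ᵥ u x = 0) :
    u b + (ν.real {b} / 2) • h b = 0 := by
  set G : ℝ → Matrix (Fin 2) (Fin 2) ℂ := fun x => sysCoeff a (Q x) with hG
  obtain ⟨y, hy, hyb⟩ := exists_isPrim_homogeneous_apply S.regular b
    (cayley ν G (-1) b *ᵥ (u b + (ν.real {b} / 2) • h b))
  have hs := sub_cayley_mulVec S.regular (s := -1) (by norm_num) b (u b + (ν.real {b} / 2) • h b)
  rw [neg_one_mul, neg_smul, sub_neg_eq_add, ← hG, ← hyb] at hs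
  have hd : ∀ x, b < x → y x = u x := by
    intro x hx
    refine sub_eq_zero.1 ((hy.sub hu).eq_zero_of_right S.regular (a := b) ?_ (fun t ht => ?_) hx)
    · have e : (y b - u b) + (ν.real {b} / 2) • (G b *ᵥ y b - h b)
          = (y b + (ν.real {b} / 2) • (G b *ᵥ y b)) - (u b + (ν.real {b} / 2) • h b) := by module
      exact e.trans (sub_eq_zero.2 hs)
    · rw [hh t ht, mulVec_sub]
  have hy0 : y = 0 := by
    refine hL y hy (S.ae_mulVec_eq_zero_of_mem_annihilated (E := Ioi b) (y := ⟨y, hy⟩)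
      (fun x hx => ?_) (fun x => ?_) ?_)
    · simp only [mem_Ioi] at hx ⊢
      linarith
    · obtain ⟨m, hm⟩ := exists_nat_gt ((b - x) / ω)
      refine ⟨m, ?_⟩
      rw [div_lt_iff₀ hω] at hm
      simp only [mem_Ioi]
      linarith
    · filter_upwards [hWu] with x hx hxb
      show W x *ᵥ y x = 0
      rw [hd x hxb, hx]
  rw [← hs, hy0]
  simp

/-- The mirror image, with translation by the negative period moving half-lines to the left. As the
equation is homogeneous at `b` too, the balanced value itself vanishes. -/
theorem IsSystem.left_eq_zero (S : IsSystem ν (-ω) a Q W) (hω : 0 < ω)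
    (hL : ∀ y : ℝ → Fin 2 → ℂ, IsPrim ν y (fun x => sysCoeff a (Q x) *ᵥ y x) →
      (∀ᵐ x ∂ν, W x *ᵥ y x = 0) → y = 0) {u h : ℝ → Fin 2 → ℂ} (hu : IsPrim ν u h) {b : ℝ}
    (hh : ∀ x, x ≤ b → h x = sysCoeff a (Q x) *ᵥ u x) (hWu : ∀ᵐ x ∂ν, W x *ᵥ u x = 0) :
    u b = 0 := by
  obtain ⟨y, hy, hyb⟩ := exists_isPrim_homogeneous_apply S.regular b (u b)
  have hd : ∀ x, x < b → y x = u x := by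
    intro x hx
    refine sub_eq_zero.1 ((hy.sub hu).eq_zero_of_left S.regular (a := b) ?_ (fun t ht => ?_) hx)
    · simp [hyb, hh b le_rfl]
    · rw [hh t ht.le, mulVec_sub]
  have hy0 : y = 0 := by
    refine hL y hy (S.ae_mulVec_eq_zero_of_mem_annihilated (E := Iio b) (y := ⟨y, hy⟩)
      (fun x hx => ?_) (fun x => ?_) ?_)
    · simp only [mem_Iio] at hx ⊢
      linarith
    · obtain ⟨m, hm⟩ := exists_nat_gt ((x - b) / ω)
      refine ⟨m, ?_⟩
      rw [div_lt_iff₀ hω] at hm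
      simp only [mem_Iio]
      linarith
    · filter_upwards [hWu] with x hx hxb
      show W x *ᵥ y x = 0
      rw [hd x hxb, hx]
  rw [← hyb, hy0, Pi.zero_apply]

/-- If no nonzero solution is annihilated by the weight, a solution of the inhomogeneous equation
which is annihilated by the weight and whose right-hand side is the conjugate of a homogeneous
solution, cut off to a bounded interval, exists only for trivial right-hand sides. -/
theorem IsSystem.ae_mulVec_eq_zero_on_Ioc (S : IsSystem ν ω a Q W) (S' : IsSystem ν (-ω) a Q W)
    (hω : 0 < ω)
    (hL : ∀ y : ℝ → Fin 2 → ℂ, IsPrim ν y (fun x => sysCoeff a (Q x) *ᵥ y x) →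
      (∀ᵐ x ∂ν, W x *ᵥ y x = 0) → y = 0) {v u : ℝ → Fin 2 → ℂ} {b c : ℝ} (hbc : b ≤ c)
    (hv : IsPrim ν v fun x => sysCoeff a (Q x) *ᵥ v x)
    (hu : IsPrim ν u fun x => sysCoeff a (Q x) *ᵥ u x
      + skewInv a (W x *ᵥ (Ioc b c).indicator (fun t => star (v t)) x))
    (hWu : ∀ᵐ x ∂ν, W x *ᵥ u x = 0) : ∀ᵐ x ∂ν, x ∈ Ioc b c → W x *ᵥ v x = 0 := by
  have ha := S.ne_zero
  have hskew0 : skewInv a 0 = 0 := by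
    ext i
    fin_cases i <;> simp [skewInv]
  have hb0 : ∀ x, x ≤ b → sysCoeff a (Q x) *ᵥ u x
      + skewInv a (W x *ᵥ (Ioc b c).indicator (fun t => star (v t)) x)
      = sysCoeff a (Q x) *ᵥ u x := by
    intro x hx
    rw [indicator_of_notMem (fun h => not_lt.2 hx h.1), mulVec_zero, hskew0, add_zero]
  have hc0 : ∀ x, c < x → sysCoeff a (Q x) *ᵥ u x
      + skewInv a (W x *ᵥ (Ioc b c).indicator (fun t => star (v t)) x)
      = sysCoeff a (Q x) *ᵥ u x := by
    intro x hx
    rw [indicator_of_notMem (fun h => not_lt.2 h.2 hx), mulVec_zero, hskew0, add_zero]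
  have hR := S.right_eq_zero hω hL hu hc0 hWu
  have hLb := S'.left_eq_zero hω hL hu hb0 hWu
  -- Both boundary terms vanish: the right-hand limit of `u` at `c` is zero, and so is the one at
  -- `b`, since `b` lies outside `(b, c]` and `u b = 0`.
  have hlag := hv.wronskian_sub_wronskian hu hbc
  rw [hR, hb0 b le_rfl, hLb] at hlag
  have hw0 : ∀ z, wronskian z 0 = 0 := fun z => by simp [wronskian]
  simp only [mulVec_zero, smul_zero, add_zero, hw0, sub_zero] at hlag
  have hvm := measurable_of_locallyBoundedVariationOn hv.locallyBoundedVariationOn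
  have hvb := LocallyBoundedVariationOn.exists_bound hv.locallyBoundedVariationOn
  have hstar : Measurable fun x => star (v x) :=
    measurable_pi_lambda _ fun i =>
      Complex.continuous_conj.measurable.comp ((measurable_pi_apply i).comp hvm)
  have hstarb : ∀ R : ℝ, ∃ C, ∀ x ∈ Icc (-R) R, ‖star (v x)‖ ≤ C := by simpa using hvb
  have hWi := locallyIntegrable_mulVec_of_bounded S.locallyIntegrable_weight hstar hstarb
  have hform : LocallyIntegrable (fun x => v x ⬝ᵥ (W x *ᵥ star (v x))) ν := by
    have h : ∀ i, LocallyIntegrable (fun x => v x i * (W x *ᵥ star (v x)) i) ν := fun i =>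
      locallyIntegrable_mul_of_bounded ((measurable_pi_apply i).comp hvm)
        (fun R => (hvb R).imp fun _ hC x hx => (norm_le_pi_norm (v x) i).trans (hC x hx)) (hWi i)
    simp only [dotProduct, Fin.sum_univ_two]
    exact (h 0).add (h 1)
  have hint := hform.integrableOn_of_bounded (Metric.isBounded_Ioc b c)
  have hzero : ∫ x in Ioc b c, v x ⬝ᵥ (W x *ᵥ star (v x)) ∂ν = 0 := by
    have e : ∫ x in Ioc b c, (v x ⬝ᵥ (W x *ᵥ star (v x))) / a ∂ν = 0 := by
      rw [hlag]
      refine setIntegral_congr_fun measurableSet_Ioc fun t ht => ?_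
      rw [indicator_of_mem ht, wronskian_add_right, ← add_assoc,
        wronskian_sysCoeff_add ha (S.symm_pot t), zero_add, wronskian_skewInv]
    rw [integral_div] at e
    exact (div_eq_zero_iff.1 e).resolve_right ha
  -- The conjugate in the right-hand side turns the bilinear form of Lagrange's identity into the
  -- positive form of `W`, so the zero integral forces the integrand to vanish.
  have hnn : ∀ x, 0 ≤ v x ⬝ᵥ (W x *ᵥ star (v x)) := fun x => by
    have := (S.posSemidef x).dotProduct_mulVec_nonneg (star (v x))
    rwa [star_star] at this
  have hre : ∫ x in Ioc b c, (v x ⬝ᵥ (W x *ᵥ star (v x))).re ∂ν = 0 := by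
    have := integral_re hint
    simp only [RCLike.re_to_complex] at this
    rw [this, hzero, Complex.zero_re]
  rw [integral_eq_zero_iff_of_nonneg (fun x => (Complex.le_def.1 (hnn x)).1) hint.re,
    Filter.EventuallyEq, ae_restrict_iff' measurableSet_Ioc] at hre
  filter_upwards [hre] with x hx hxbc
  have h1 : v x ⬝ᵥ (W x *ᵥ star (v x)) = 0 :=
    Complex.ext (hx hxbc) (Complex.le_def.1 (hnn x)).2.symm
  have h2 : W x *ᵥ star (v x) = 0 := by
    rw [← (S.posSemidef x).dotProduct_mulVec_zero_iff, star_star, h1]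
  have h3 : star (W x *ᵥ star (v x)) = W x *ᵥ v x := by
    rw [star_mulVec, star_star, (S.posSemidef x).1, ← mulVec_transpose]
    congr 1
    ext i j
    exact S.symm_weight x j i
  rw [← h3, h2, star_zero]

end Converse

/-! ### The maximal relation and its spectrum -/

section MaximalRelation

variable {q w : Matrix (Fin 2) (Fin 2) OrderZeroDist} {J : Matrix (Fin 2) (Fin 2) ℝ} {ω : ℝ}

/-- Subtracting a multiple of the first component, which is always zero, leaves this relation
unchanged, so every complex number lies in the resolvent set. -/
theorem relSpectrum_zero_prod_univ {H : Type*} [AddCommGroup H] [Module ℂ H] :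
    relSpectrum (({0} : Set H) ×ˢ (univ : Set H)) = ∅ := by
  rw [relSpectrum, compl_empty_iff]
  refine eq_univ_of_forall fun z => ?_
  rw [relResolventSet, mem_ofPred_eq]
  constructor
  · ext u
    simp only [relSub, mem_ofPred_eq, mem_prod, mem_singleton_iff, mem_univ, and_true]
    constructor
    · rintro ⟨g, hu, _⟩
      exact hu
    · rintro rfl
      exact ⟨0, rfl, by simp⟩
  · refine eq_univ_of_forall fun f => ⟨0, f, ?_, ?_⟩
    · simp
    · simp

theorem zero_mem_scriptL0 (hJ : J.transpose = -J) (hJinv : IsUnit J) : 0 ∈ scriptL0 J q w := by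
  rw [mem_scriptL0_iff hJ hJinv]
  exact ⟨(solSpace (baseMeasure q w) fun x => sysCoeff (J 0 1) (potDensity q w x)).zero_mem,
    Eventually.of_forall fun x => mulVec_zero _⟩

theorem scriptL0_ne_iff (hJ : J.transpose = -J) (hJinv : IsUnit J) :
    scriptL0 J q w ≠ {0} ↔ ∃ u, IsPrim (baseMeasure q w) u
        (fun x => sysCoeff (J 0 1) (potDensity q w x) *ᵥ u x) ∧
      (∀ᵐ x ∂(baseMeasure q w), weightDensity q w x *ᵥ u x = 0) ∧ u ≠ 0 := by
  constructor
  · intro h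
    by_contra! hne
    refine h (Subset.antisymm (fun u hu => ?_) ?_)
    · obtain ⟨h1, h2⟩ := (mem_scriptL0_iff hJ hJinv).1 hu
      exact hne u h1 h2
    · rintro _ rfl
      exact zero_mem_scriptL0 hJ hJinv
  · rintro ⟨u, h1, h2, h3⟩ h
    have : u ∈ scriptL0 J q w := (mem_scriptL0_iff hJ hJinv).2 ⟨h1, h2⟩
    rw [h] at this
    exact h3 this

theorem mem_Tmax_iff (hJ : J.transpose = -J) (hJinv : IsUnit J) {p : L2 w × L2 w} :
    p ∈ Tmax J q w ↔ ∃ u f : scriptL2 w, IsPrim (baseMeasure q w) (u : ℝ → Fin 2 → ℂ)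
      (sysRhs q w (J 0 1) u f) ∧ p = (toL2 w u, toL2 w f) := by
  rw [Tmax, mem_ofPred_eq]
  refine exists_congr fun u => exists_congr fun f => ?_
  rw [← and_assoc, isBalancedBV_and_solves_iff q w hJ hJinv
    (locallyIntegrable_weightDensity_mulVec q w f.2)]

/-- Measurable functions annihilated by the weight belong to `𝓛²(w)`. -/
theorem mem_scriptL2_of_ae {u : ℝ → Fin 2 → ℂ} (hum : Measurable u)
    (hu : ∀ᵐ x ∂(baseMeasure q w), weightDensity q w x *ᵥ u x = 0) : u ∈ scriptL2 w := by
  refine ⟨hum.aemeasurable, ?_⟩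
  rw [(sqNorm_eq_zero_iff q w hum.aemeasurable).2 hu]
  exact ENNReal.zero_lt_top

/-- Locally bounded measurable functions cut off to a bounded interval belong to `𝓛²(w)`. -/
theorem indicator_mem_scriptL2 {u : ℝ → Fin 2 → ℂ} (hum : Measurable u)
    (hub : ∀ R : ℝ, ∃ C, ∀ x ∈ Icc (-R) R, ‖u x‖ ≤ C) (b c : ℝ) :
    (Ioc b c).indicator u ∈ scriptL2 w := by
  have hm : Measurable ((Ioc b c).indicator u) := hum.indicator measurableSet_Ioc
  refine ⟨hm.aemeasurable, ?_⟩
  have hD : ∀ i, LocallyIntegrable (fun x => (density w x *ᵥ u x) i) (traceMeasure w) :=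
    locallyIntegrable_mulVec_of_bounded (locallyIntegrable_density w) hum hub
  have hstar : Measurable fun x => star (u x) :=
    measurable_pi_lambda _ fun i =>
      Complex.continuous_conj.measurable.comp ((measurable_pi_apply i).comp hum)
  have hform : LocallyIntegrable (fun x => star (u x) ⬝ᵥ (density w x *ᵥ u x))
      (traceMeasure w) := by
    have h : ∀ i, LocallyIntegrable (fun x => star (u x) i * (density w x *ᵥ u x) i)
        (traceMeasure w) := fun i =>
      locallyIntegrable_mul_of_bounded ((measurable_pi_apply i).comp hstar)
        (fun R => (hub R).imp fun _ hC x hx => (norm_le_pi_norm (star (u x)) i).trans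
          ((norm_star (u x)).le.trans (hC x hx))) (hD i)
    simp only [dotProduct, Fin.sum_univ_two]
    exact (h 0).add (h 1)
  have hint := (hform.integrableOn_of_bounded (Metric.isBounded_Ioc b c)).re
  have e : sqNorm w ((Ioc b c).indicator u)
      = ∫⁻ x in Ioc b c, ENNReal.ofReal (quadDensity w u x) ∂(traceMeasure w) := by
    rw [sqNorm, ← lintegral_indicator measurableSet_Ioc]
    refine lintegral_congr fun x => ?_
    by_cases hx : x ∈ Ioc b c
    · rw [indicator_of_mem hx, quadDensity, indicator_of_mem hx, quadDensity]
    · rw [indicator_of_notMem hx, quadDensity, indicator_of_notMem hx]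
      simp
  rw [e]
  have : HasFiniteIntegral (quadDensity w u) ((traceMeasure w).restrict (Ioc b c)) := hint.2
  rwa [hasFiniteIntegral_iff_ofReal (Eventually.of_forall fun x => quadDensity_nonneg w u x)]
    at this

theorem Tmax_eq_of_scriptL0_ne (hJ : J.transpose = -J) (hJinv : IsUnit J)
    (S : IsSystem (baseMeasure q w) ω (J 0 1) (potDensity q w) (weightDensity q w)) (hω : 0 < ω)
    (h : scriptL0 J q w ≠ {0}) : Tmax J q w = ({0} : Set (L2 w)) ×ˢ (univ : Set (L2 w)) := by
  obtain ⟨v, hv, hWv, hv0⟩ := (scriptL0_ne_iff hJ hJinv).1 h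
  ext ⟨p, g⟩
  rw [mem_Tmax_iff hJ hJinv]
  simp only [mem_prod, mem_singleton_iff, mem_univ, and_true, Prod.mk.injEq]
  constructor
  · rintro ⟨u, f, hu, rfl, -⟩
    rw [toL2_eq_zero_iff q w]
    refine S.ae_mulVec_eq_zero hω hv hWv hv0 hu ?_
    rw [← sqNorm_eq]
    exact u.2.2
  · rintro rfl
    obtain ⟨f, rfl⟩ := (normKer w).mkQ_surjective g
    obtain ⟨u, hu, hWu⟩ := S.exists_isPrim_mulVec_eq_zero (f := f) hv hWv hv0
      (locallyIntegrable_weightDensity_mulVec q w f.2)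
    have hum := measurable_of_locallyBoundedVariationOn hu.locallyBoundedVariationOn
    have h0 := (toL2_eq_zero_iff q w ⟨u, mem_scriptL2_of_ae hum hWu⟩).2 hWu
    exact ⟨⟨u, mem_scriptL2_of_ae hum hWu⟩, f, hu, h0.symm, rfl⟩

theorem scriptL0_ne_of_Tmax_eq (hJ : J.transpose = -J) (hJinv : IsUnit J)
    (S : IsSystem (baseMeasure q w) ω (J 0 1) (potDensity q w) (weightDensity q w))
    (S' : IsSystem (baseMeasure q w) (-ω) (J 0 1) (potDensity q w) (weightDensity q w))
    (hω : 0 < ω) (h : Tmax J q w = ({0} : Set (L2 w)) ×ˢ (univ : Set (L2 w))) :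
    scriptL0 J q w ≠ {0} := by
  rw [scriptL0_ne_iff hJ hJinv]
  by_contra! hL
  -- Any nonzero homogeneous solution would do; it will turn out to be killed by the weight.
  obtain ⟨v, hv, hv0⟩ := exists_isPrim_homogeneous_apply S.regular 0 ![1, 0]
  have hvm := measurable_of_locallyBoundedVariationOn hv.locallyBoundedVariationOn
  have hvb := LocallyBoundedVariationOn.exists_bound hv.locallyBoundedVariationOn
  have hstar : Measurable fun x => star (v x) :=
    measurable_pi_lambda _ fun i =>
      Complex.continuous_conj.measurable.comp ((measurable_pi_apply i).comp hvm)
  have hstarb : ∀ R : ℝ, ∃ C, ∀ x ∈ Icc (-R) R, ‖star (v x)‖ ≤ C := by simpa using hvb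
  have key : ∀ n : ℕ, ∀ᵐ x ∂(baseMeasure q w), x ∈ Ioc (-(n : ℝ)) n →
      weightDensity q w x *ᵥ v x = 0 := by
    intro n
    set f : scriptL2 w := ⟨_, indicator_mem_scriptL2 hstar hstarb (-(n : ℝ)) n⟩ with hf
    have hmem : ((0 : L2 w), toL2 w f) ∈ Tmax J q w := by
      rw [h]
      exact ⟨rfl, mem_univ _⟩
    obtain ⟨u, g, hu, he⟩ := (mem_Tmax_iff hJ hJinv).1 hmem
    rw [Prod.mk.injEq] at he
    have hWu := (toL2_eq_zero_iff q w u).1 he.1.symm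
    have hfg := (toL2_eq_iff q w f g).1 he.2
    -- The pair supplies only a representative `g` of the class of `f`, but the equation involves `W
    -- g` alone, which agrees with `W f` almost everywhere.
    refine S.ae_mulVec_eq_zero_on_Ioc S' hω hL (neg_le_self n.cast_nonneg) hv
      (hu.congr_ae ?_) hWu
    filter_upwards [hfg] with x hx
    rw [sysRhs, ← hx]
  have hWv : ∀ᵐ x ∂(baseMeasure q w), weightDensity q w x *ᵥ v x = 0 := by
    filter_upwards [ae_all_iff.2 key] with x hx
    obtain ⟨n, hn⟩ := exists_nat_gt |x|
    exact hx n ⟨(abs_lt.1 hn).1, (abs_lt.1 hn).2.le⟩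
  have h10 := congrFun (hL v hv hWv) 0
  rw [hv0] at h10
  exact one_ne_zero (congrFun h10 0)

/-- One implication needs the system with both periods `ω` and `-ω`, one for each half-line. -/
theorem Tmax_eq_iff (hJ : J.transpose = -J) (hJinv : IsUnit J) (hq : q.transpose = q)
    (hω : 0 < ω) (hqper : ∀ i j, (q i j).HasPeriod ω) (hwper : ∀ i j, (w i j).HasPeriod ω)
    (hB : ∀ l x : ℝ, IsUnit (J + (1 / 2 : ℝ) • (jump q x - l • jump w x))) :
    Tmax J q w = ({0} : Set (L2 w)) ×ˢ (univ : Set (L2 w)) ↔ scriptL0 J q w ≠ {0} :=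
  ⟨scriptL0_ne_of_Tmax_eq hJ hJinv (isSystem q w hJ hJinv hq hqper hwper hB)
    (isSystem q w hJ hJinv hq (fun i j => (hqper i j).neg) (fun i j => (hwper i j).neg) hB) hω,
    Tmax_eq_of_scriptL0_ne hJ hJinv (isSystem q w hJ hJinv hq hqper hwper hB) hω⟩

end MaximalRelation

end PeriodicSystem

theorem theorem6p6
    (J : Matrix (Fin 2) (Fin 2) ℝ) (q w : Matrix (Fin 2) (Fin 2) OrderZeroDist) (ω : ℝ)
    (hJ : J.transpose = -J) (hJinv : IsUnit J)
    (hq : q.transpose = q) (hw : IsNonneg w)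
    (hω : 0 < ω)
    (hqper : ∀ i j, (q i j).HasPeriod ω) (hwper : ∀ i j, (w i j).HasPeriod ω)
    (hBplus : ∀ l x : ℝ, IsUnit (J + (1 / 2 : ℝ) • (jump q x - l • jump w x)))
    (hBminus : ∀ l x : ℝ, IsUnit (J - (1 / 2 : ℝ) • (jump q x - l • jump w x))) :
    (Tmax J q w = ({0} : Set (L2 w)) ×ˢ (Set.univ : Set (L2 w)) ↔ scriptL0 J q w ≠ {0}) ∧
      (scriptL0 J q w ≠ {0} → relSpectrum (Tmax J q w) = ∅) := by
  have hiff := Tmax_eq_iff hJ hJinv hq hω hqper hwper hBplus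
  exact ⟨hiff, fun h => by rw [hiff.2 h, relSpectrum_zero_prod_univ]⟩
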